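/- **Notation.** For $L>0$, a real-valued $a\in L^1(0,L)$ and $M\in\mathbb N$ let $D_a=i\frac{d}{dx}-a$ act on the space $\mathcal D_a$ of all absolutely continuous $u:[0,L]\to\mathbb C^M$ with $u(0)=u(L)$ and $D_au\in L^2((0,L);\mathbb C^M)$ (for $a\in L^2$ this is the periodic Sobolev space $H^1$). Let $\alpha=\frac1{2\pi}\int_0^La(x)\,dx$ be the magnetic flux. For $\alpha\notin\mathbb Z$ let $\mathrm K(\alpha)$ be the smallest constant such that $$\int_0^{L}\operatorname{Tr}[U(x)^3]\,dx\le \mathrm K(\alpha)\sum_{n=1}^N\int_0^{L}|i\psi_n'(x)-a(x)\psi_n(x)|^2_{\mathbb C^M}\,dx,\qquad U(x)=\sum_{n=1}^N\psi_n(x)\overline{\psi_n(x)}^{T},$$ for all $L>0$, all real $a\in L^1(0,L)$ with flux $\alpha$, all $M,N$ and all systems $\psi_1,\dots,\psi_N\in\mathcal D_a$ that are orthonormal in $L^2((0,L);\mathbb C^M)$. For $\gamma>0$ and $d\ge1$ let $L^{\mathrm{cl}}_{\gamma,d}=\frac1{(2\pi)^d}\int_{\mathbb R^d}(1-|\xi|^2)_+^\gamma\,d\xi$.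 **Theorem 3.2.** Let $L>0$, let $a\in L^1(0,L)$ be real-valued with flux $\alpha\notin\mathbb Z$, and let $V(x)\ge0$ be a measurable $M\times M$ Hermitian matrix-valued function with $\operatorname{Tr}V^{3/2}\in L^1(0,L)$. Let $H=\left(i\frac{d}{dx}-a(x)\right)^2-V$ be the operator in $L^2((0,L);\mathbb C^M)$ with periodic boundary conditions that is associated with the quadratic form $\int_0^L|D_au|^2dx-\int_0^L\langle Vu,u\rangle dx$ on $\mathcal D_a$. Then the spectrum of $H$ is discrete (it consists of isolated eigenvalues of finite multiplicity), and its negative eigenvalues $-\lambda_n<0$, repeated according to multiplicity, satisfy $$\sum_n\lambda_n\le\frac{2}{3\sqrt3}\sqrt{\mathrm K(\alpha)}\int_0^L\operatorname{Tr}[V(x)^{3/2}]\,dx=\frac{\pi}{\sqrt3}\sqrt{\mathrm K(\alpha)}\,L^{\mathrm{cl}}_{1,1}\int_0^L\operatorname{Tr}[V(x)^{3/2}]\,dx.$$ Here $\mathrm K(\alpha)$ is finite (the smallest constant exists) and $\mathrm K(\alpha)\le\min(\mathrm K_1(\alpha),\mathrm K_2(\alpha))$, where $\mathrm K_1(\alpha)=\mathrm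 k(\alpha)^2$ with $\mathrm k(\alpha)=1$ if $\frac14\le\alpha\bmod 1\le\frac34$ and $\mathrm k(\alpha)=\frac1{|\sin(2\pi\alpha)|}$ otherwise, and $$\mathrm K_2(\alpha)=\frac5{3\sqrt3\,\pi}\left[\sup_{b\ge0}b^{5/3}\sum_{k\in\mathbb Z}\frac1{(|k+\alpha|^3+b)^2}\right]^2,$$ and, for all $\gamma>0$ and $d\ge1$, $$L^{\mathrm{cl}}_{\gamma,d}=\frac{\Gamma(\gamma+1)}{2^d\pi^{d/2}\,\Gamma(\gamma+d/2+1)}.$$ -/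

import Mathlib

open MeasureTheory
open scoped ComplexOrder

noncomputable section

namespace MagneticLT

/-! ### Unbounded operators, given by their graphs -/

section Graphs

variable {X : Type*} [NormedAddCommGroup X] [NormedSpace ℂ X]

/-- The resolvent set of the operator with graph `T` (that is, `T u = f` means `(u, f) ∈ T`):
the numbers `z` for which `T - z` is a bijection from the domain of `T` onto `X` with bounded
inverse `R`. Indeed `(u, f + z • u) ∈ T` says that `u` is in the domain and `(T - z) u = f`. -/
def resolventSet (T : Submodule ℂ (X × X)) : Set ℂ :=
  {z | ∃ R : X →L[ℂ] X, ∀ f u : X, (u, f + z • u) ∈ T ↔ u = R f}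

/-- The spectrum of the operator with graph `T`. -/
def spectrum (T : Submodule ℂ (X × X)) : Set ℂ := (resolventSet T)ᶜ

/-- The eigenspace `{u | T u = z u}` of the operator with graph `T`. -/
def eigenspace (T : Submodule ℂ (X × X)) (z : ℂ) : Submodule ℂ X where
  carrier := {u | (u, z • u) ∈ T}
  zero_mem' := by
    simp [← Prod.zero_eq_mk]
  add_mem' := by
    intro u v hu hv
    have h := T.add_mem hu hv
    simpa [smul_add] using h
  smul_mem' := by
    intro c u hu
    have h := T.smul_mem c hu
    simpa [smul_comm c z u] using h

/-- The spectrum is discrete: it consists of isolated points, each of which is an eigenvalue of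
finite multiplicity. -/
def HasDiscreteSpectrum (T : Submodule ℂ (X × X)) : Prop :=
  ∀ z ∈ spectrum T, (∃ r > 0, ∀ w ∈ spectrum T, w ≠ z → r ≤ dist w z) ∧
    eigenspace T z ≠ ⊥ ∧ FiniteDimensional ℂ (eigenspace T z)

/-- The set of negative eigenvalues of the operator with graph `T`. -/
def negEigenvalues (T : Submodule ℂ (X × X)) : Set ℝ :=
  {E | E < 0 ∧ eigenspace T (E : ℂ) ≠ ⊥}

/-- The multiplicity of `z` as an eigenvalue of the operator with graph `T`. -/
def multiplicity (T : Submodule ℂ (X × X)) (z : ℂ) : ℕ := Module.finrank ℂ (eigenspace T z)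

end Graphs

/-! ### The magnetic derivative and the magnetic Schrödinger operator -/

/-- The Hilbert space `L²((0, L); ℂ^M)`. -/
abbrev L2Space (L : ℝ) (M : ℕ) : Type :=
  Lp (EuclideanSpace ℂ (Fin M)) 2 (volume.restrict (Set.Ioc 0 L))

/-- The magnetic flux `(1 / 2π) ∫₀ᴸ a`. -/
def flux (L : ℝ) (a : ℝ → ℝ) : ℝ := 1 / (2 * Real.pi) * ∫ x in Set.Ioc 0 L, a x

/-- `IsMagDeriv L a M u g` : the function `u` on `(0, L)` is (almost everywhere equal to) an
absolutely continuous function `x ↦ c + ∫₀ˣ w` with `u(L) = u(0)`, whose derivative is `w`, and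
`g = i u' - a u` almost everywhere. -/
def IsMagDeriv (L : ℝ) (a : ℝ → ℝ) (M : ℕ) (u g : ℝ → EuclideanSpace ℂ (Fin M)) : Prop :=
  ∃ (c : EuclideanSpace ℂ (Fin M)) (w : ℝ → EuclideanSpace ℂ (Fin M)),
    IntervalIntegrable w volume 0 L ∧ (∫ t in (0 : ℝ)..L, w t) = 0 ∧
    (∀ᵐ x ∂volume.restrict (Set.Ioc 0 L), u x = c + ∫ t in (0 : ℝ)..x, w t) ∧
    (∀ᵐ x ∂volume.restrict (Set.Ioc 0 L), g x = Complex.I • w x - (a x : ℂ) • u x)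

theorem intervalIntegrable_left {F : Type*} [NormedAddCommGroup F] {L x : ℝ} {w : ℝ → F}
    (hw : IntervalIntegrable w volume 0 L) (hx : x ∈ Set.Ioc 0 L) :
    IntervalIntegrable w volume 0 x := by
  refine hw.mono_set ?_
  rw [Set.uIcc_of_le hx.1.le, Set.uIcc_of_le (hx.1.le.trans hx.2)]
  exact Set.Icc_subset_Icc le_rfl hx.2

/-- The graph of `i d/dx - a` in `L²((0, L); ℂ^M)` with periodic boundary condition, on its
maximal domain: the periodic absolutely continuous `u` with `i u' - a u ∈ L²`.
For `a ∈ L²(0, L)` this domain is the periodic Sobolev space `H¹`. -/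
def magDeriv (L : ℝ) (a : ℝ → ℝ) (M : ℕ) : Submodule ℂ (L2Space L M × L2Space L M) where
  carrier := {p | IsMagDeriv L a M p.1 p.2}
  zero_mem' := by
    refine ⟨0, 0, IntervalIntegrable.zero, by simp, ?_, ?_⟩
    · filter_upwards [Lp.coeFn_zero (EuclideanSpace ℂ (Fin M)) 2
        (volume.restrict (Set.Ioc 0 L))] with x hx
      simp only [Prod.fst_zero, hx]
      simp
    · filter_upwards [Lp.coeFn_zero (EuclideanSpace ℂ (Fin M)) 2
        (volume.restrict (Set.Ioc 0 L))] with x hx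
      simp only [Prod.fst_zero, Prod.snd_zero, hx]
      simp
  add_mem' := by
    rintro ⟨u, g⟩ ⟨v, h⟩ ⟨c, w, hw, hw0, hu, hg⟩ ⟨c', w', hw', hw0', hv, hh⟩
    refine ⟨c + c', w + w', hw.add hw', ?_, ?_, ?_⟩
    · simp only [Pi.add_apply]
      rw [intervalIntegral.integral_add hw hw', hw0, hw0', add_zero]
    · filter_upwards [hu, hv, Lp.coeFn_add u v, ae_restrict_mem measurableSet_Ioc]
        with x h1 h2 h3 h4
      simp only [Prod.mk_add_mk, Pi.add_apply] at *
      rw [h3, h1, h2, intervalIntegral.integral_add (intervalIntegrable_left hw h4)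
        (intervalIntegrable_left hw' h4)]
      abel
    · filter_upwards [hg, hh, Lp.coeFn_add u v, Lp.coeFn_add g h] with x h1 h2 h3 h4
      simp only [Prod.mk_add_mk, Pi.add_apply] at *
      rw [h4, h3, h1, h2, smul_add, smul_add]
      abel
  smul_mem' := by
    rintro k ⟨u, g⟩ ⟨c, w, hw, hw0, hu, hg⟩
    refine ⟨k • c, k • w, hw.smul k, ?_, ?_, ?_⟩
    · simp only [Pi.smul_apply]
      rw [intervalIntegral.integral_smul, hw0, smul_zero]
    · filter_upwards [hu, Lp.coeFn_smul k u] with x h1 h3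
      simp only [Prod.smul_mk, Pi.smul_apply] at *
      rw [h3, h1, intervalIntegral.integral_smul, smul_add]
    · filter_upwards [hg, Lp.coeFn_smul k u, Lp.coeFn_smul k g] with x h1 h3 h4
      simp only [Prod.smul_mk, Pi.smul_apply] at *
      rw [h4, h3, h1, smul_sub, smul_comm k Complex.I, smul_comm k (a x : ℂ)]

/-- The density `⟨V(x) u(x), v(x)⟩` of the potential energy form (Mathlib's inner product is
conjugate-linear in its first argument). -/
def potentialDensity {M : ℕ} (V : ℝ → Matrix (Fin M) (Fin M) ℂ)
    (v u : ℝ → EuclideanSpace ℂ (Fin M)) (x : ℝ) : ℂ :=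
  inner ℂ (v x) (Matrix.toEuclideanLin (V x) (u x))

/-- The graph of the magnetic Schrödinger operator `H = (i d/dx - a)² - V` with periodic boundary
condition, as the operator associated with its quadratic form: `H u = f` means that `u` is in the
form domain and, for every `v` in the form domain,
`∫ ⟨(i d/dx - a) u, (i d/dx - a) v⟩ - ∫ ⟨V u, v⟩ = ∫ ⟨f, v⟩`
(the second integral being absolutely convergent). -/
def schrodinger (L : ℝ) (a : ℝ → ℝ) (M : ℕ) (V : ℝ → Matrix (Fin M) (Fin M) ℂ) :
    Submodule ℂ (L2Space L M × L2Space L M) where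
  carrier := {p | ∃ g : L2Space L M, (p.1, g) ∈ magDeriv L a M ∧
    ∀ v h : L2Space L M, (v, h) ∈ magDeriv L a M →
      IntegrableOn (potentialDensity V v p.1) (Set.Ioc 0 L) ∧
      inner ℂ h g - (∫ x in Set.Ioc 0 L, potentialDensity V v p.1 x) = inner ℂ v p.2}
  zero_mem' := by
    refine ⟨0, (magDeriv L a M).zero_mem, ?_⟩
    intro v h _
    have h0 : potentialDensity V v ((0 : L2Space L M × L2Space L M).1)
        =ᵐ[volume.restrict (Set.Ioc 0 L)] 0 := by
      filter_upwards [Lp.coeFn_zero (EuclideanSpace ℂ (Fin M)) 2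
        (volume.restrict (Set.Ioc 0 L))] with x hx
      simp only [potentialDensity, Prod.fst_zero, hx]
      simp
    refine ⟨(integrable_zero _ _ _).congr h0.symm, ?_⟩
    rw [integral_congr_ae h0]
    simp
  add_mem' := by
    rintro ⟨u, f⟩ ⟨u', f'⟩ ⟨g, hg, H⟩ ⟨g', hg', H'⟩
    refine ⟨g + g', (magDeriv L a M).add_mem hg hg', ?_⟩
    intro v h hv
    obtain ⟨i1, e1⟩ := H v h hv
    obtain ⟨i2, e2⟩ := H' v h hv
    have h0 : potentialDensity V v ((u, f) + (u', f')).1 =ᵐ[volume.restrict (Set.Ioc 0 L)]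
        fun x => potentialDensity V v u x + potentialDensity V v u' x := by
      filter_upwards [Lp.coeFn_add u u'] with x hx
      simp only [Prod.mk_add_mk, Pi.add_apply] at *
      simp only [potentialDensity]
      rw [hx, map_add, inner_add_right]
    refine ⟨(i1.add i2).congr h0.symm, ?_⟩
    rw [integral_congr_ae h0, integral_add i1 i2]
    simp only [Prod.mk_add_mk, inner_add_right] at *
    rw [← e1, ← e2]
    ring
  smul_mem' := by
    rintro k ⟨u, f⟩ ⟨g, hg, H⟩
    refine ⟨k • g, (magDeriv L a M).smul_mem k hg, ?_⟩
    intro v h hv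
    obtain ⟨i1, e1⟩ := H v h hv
    have h0 : potentialDensity V v (k • (u, f)).1 =ᵐ[volume.restrict (Set.Ioc 0 L)]
        fun x => k * potentialDensity V v u x := by
      filter_upwards [Lp.coeFn_smul k u] with x hx
      simp only [Prod.smul_mk, Pi.smul_apply] at *
      simp only [potentialDensity]
      rw [hx, map_smul, inner_smul_right]
    refine ⟨(i1.const_mul k).congr h0.symm, ?_⟩
    rw [integral_congr_ae h0, integral_const_mul]
    simp only [Prod.smul_mk, inner_smul_right] at *
    rw [← e1]
    ring

/-- `Tr A^{3/2}` for a positive semidefinite matrix `A` (functional calculus). -/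
def traceThreeHalves {M : ℕ} (A : Matrix (Fin M) (Fin M) ℂ) : ℝ :=
  (cfc (fun t : ℝ => t ^ (3 / 2 : ℝ)) A).trace.re

/-! ### The constants -/

/-- The matrix `U = ∑ₙ ψₙ ψₙ*` of a family of vectors in `ℂ^M`. -/
def densityMatrix {M N : ℕ} (ψ : Fin N → EuclideanSpace ℂ (Fin M)) :
    Matrix (Fin M) (Fin M) ℂ :=
  ∑ n, Matrix.vecMulVec (ψ n).ofLp (star (ψ n).ofLp)

/-- `C` is a constant in the magnetic Lieb–Thirring inequality for orthonormal systems of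
vector-functions with flux `α`:
`∫₀ᴸ Tr U³ ≤ C ∑ₙ ∫₀ᴸ |i ψₙ' - a ψₙ|²`, for all periods `L`, all magnetic potentials `a` of flux
`α`, all `M`, and all finite orthonormal systems `ψ₁, …, ψ_N` in `L²((0, L); ℂ^M)`. -/
def IsLiebThirringConst (α C : ℝ) : Prop :=
  0 ≤ C ∧ ∀ (L : ℝ) (a : ℝ → ℝ), 0 < L → IntegrableOn a (Set.Ioc 0 L) → flux L a = α →
    ∀ (M N : ℕ) (ψ Dψ : Fin N → L2Space L M), Orthonormal ℂ ψ →
      (∀ n, (ψ n, Dψ n) ∈ magDeriv L a M) →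
      ∫ x in Set.Ioc 0 L, ((densityMatrix fun n => ψ n x) ^ 3).trace.re ≤
        C * ∑ n, ‖Dψ n‖ ^ 2

/-- `K(α)`: the optimal constant in the Lieb–Thirring inequality for orthonormal systems. -/
def K (α : ℝ) : ℝ := sInf {C | IsLiebThirringConst α C}

/-- The constant `k(α)`. -/
def k (α : ℝ) : ℝ :=
  if 1 / 4 ≤ Int.fract α ∧ Int.fract α ≤ 3 / 4 then 1 else 1 / |Real.sin (2 * Real.pi * α)|

/-- `K₁(α) = k(α)²`. -/
def K₁ (α : ℝ) : ℝ := k α ^ 2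

/-- `K₂(α) = 5 / (3 √3 π) * [sup_{b ≥ 0} b^{5/3} ∑_{k ∈ ℤ} (|k + α|³ + b)⁻²]²`. -/
def K₂ (α : ℝ) : ℝ :=
  5 / (3 * √3 * Real.pi) *
    (sSup ((fun b : ℝ => b ^ (5 / 3 : ℝ) * ∑' j : ℤ, 1 / (|(j : ℝ) + α| ^ 3 + b) ^ 2) ''
      Set.Ici 0)) ^ 2

/-- The semiclassical constant `(2π)⁻ᵈ ∫_{ℝᵈ} (1 - |ξ|²)₊^γ dξ`. -/
def Lcl (γ : ℝ) (d : ℕ) : ℝ :=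
  1 / (2 * Real.pi) ^ d * ∫ ξ : EuclideanSpace ℝ (Fin d), (max (1 - ‖ξ‖ ^ 2) 0) ^ γ

end MagneticLT

end

/-!
The eigenvalue bound follows by duality from the inequality `∫ Tr U³ ≤ K ∑ ‖D ψₙ‖²` for orthonormal
systems, where `D = i d/dx - a`. If `ψₙ` are orthonormal eigenfunctions of `H` with eigenvalues
`-λₙ < 0`, then `∑ λₙ = ∫ Tr (V U) - ∑ ‖D ψₙ‖²`, and the matrix form of Young's inequality,
`Tr (V U) ≤ Tr U³ / K + 2 / (3√3) √K Tr V^{3/2}` (`sum_inner_toEuclideanLin_le`), lets the kinetic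
energy cancel the cubic term (`sum_neg_eigenvalue_le`). This is applied to orthonormal bases of
finitely many eigenspaces.

Everything else rests on the diagonalization of `D`: the functions
`L^{-1/2} exp (i (ω_k x - ∫₀ˣ a))` with `ω_k = 2π (k + α) / L` form a Hilbert basis (`modeBasis`),
and `(u, g)` belongs to the graph of `D` if and only if the coefficients satisfy `ĝ = -ω û`
(`mem_magDeriv_iff`). That this describes the whole maximal domain is seen by solving `D u = g`
explicitly, which is possible since `α ∉ ℤ`.

* `K ≤ K₁`: the diagonal of the Green function of `D² + s²` is a lattice sum that is computed by
  Parseval's identity and is at most `k(α) / (2s)`, so that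
  `‖u(x)‖² ≤ k(α) / (2s) (‖D u‖² + s² ‖u‖²)`. For an eigenvector `e` of `U(x)` one takes
  `u = ∑ ⟨ψₙ(x), e⟩ ψₙ` and optimizes in `s`; summing over `e` and integrating gives the claim
  (`isLiebThirringConst_K₁`).
* `K ≤ K₂`: split `ψₙ` by the multiplier `|D|³ / (|D|³ + s³)`. By Bessel's inequality the
  low-frequency parts contribute at most `A s` to the density in every direction, with
  `A = sup / (2π)`; by Minkowski's inequality the high-frequency parts contribute at least
  `(√μ - √(A s))₊²` for each eigenvalue `μ` of `U(x)`. Integrating against `2 s ds` gives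
  `μ³ / (15 A²)` on one side and a multiple of `‖D ψₙ‖²` on the other
  (`isLiebThirringConst_K₂`).
* Discreteness of the spectrum: `G = D⁻¹` is compact and self-adjoint, and the pointwise bound makes
  `V` form-bounded with relative bound zero. If `W` represents the form of `V` pulled back by `G`,
  then `G (1 - W + Λ G²)⁻¹ G` is the resolvent of `H` at `-Λ` (`exists_compact_resolvent`); it is
  compact and symmetric, and the Fredholm alternative applies
  (`hasDiscreteSpectrum_of_compact_resolvent`).
* The semiclassical constant is computed in polar coordinates from Euler's Beta integral
  (`Lcl_eq`).
-/

noncomputable section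

namespace MagneticLT

/-! ### Absolutely continuous functions -/

theorem absolutelyContinuousOnInterval_of_dist_le {X Y : Type*} [PseudoMetricSpace X]
    [PseudoMetricSpace Y] {f : ℝ → X} {g : ℝ → Y} {a b : ℝ}
    (hg : AbsolutelyContinuousOnInterval g a b)
    (h : ∀ x ∈ Set.uIcc a b, ∀ y ∈ Set.uIcc a b, dist (f x) (f y) ≤ dist (g x) (g y)) :
    AbsolutelyContinuousOnInterval f a b := by
  rw [absolutelyContinuousOnInterval_iff] at hg ⊢
  intro ε hε
  obtain ⟨δ, hδ, H⟩ := hg ε hε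
  refine ⟨δ, hδ, fun E hE hlt => lt_of_le_of_lt (Finset.sum_le_sum fun i hi => ?_) (H E hE hlt)⟩
  have := hE.1 i (by simpa using hi)
  exact h _ this.1 _ this.2

theorem intervalIntegrable_of_mem {E : Type*} [NormedAddCommGroup E] {L x y : ℝ} {w : ℝ → E}
    (hw : IntervalIntegrable w volume 0 L)
    (hx : x ∈ Set.uIcc 0 L) (hy : y ∈ Set.uIcc 0 L) : IntervalIntegrable w volume x y :=
  hw.mono_set (Set.uIcc_subset_uIcc hx hy)

section Primitive

variable {E : Type*} [NormedAddCommGroup E] [NormedSpace ℝ E]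

theorem absolutelyContinuousOnInterval_primitive {L : ℝ} {w : ℝ → E}
    (hw : IntervalIntegrable w volume 0 L) (c : E) :
    AbsolutelyContinuousOnInterval (fun x => c + ∫ t in (0 : ℝ)..x, w t) 0 L := by
  have h0 : (0 : ℝ) ∈ Set.uIcc 0 L := Set.left_mem_uIcc
  refine absolutelyContinuousOnInterval_of_dist_le
    (hw.norm.absolutelyContinuousOnInterval_intervalIntegral h0) fun x hx y hy => ?_
  rw [dist_add_left, dist_comm, dist_comm (∫ v in (0 : ℝ)..x, ‖w v‖), dist_eq_norm, Real.dist_eq,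
    intervalIntegral.integral_interval_sub_left (intervalIntegrable_of_mem hw h0 hy)
      (intervalIntegrable_of_mem hw h0 hx),
    intervalIntegral.integral_interval_sub_left (intervalIntegrable_of_mem hw.norm h0 hy)
      (intervalIntegrable_of_mem hw.norm h0 hx)]
  exact intervalIntegral.norm_integral_le_abs_integral_norm

theorem ae_hasDerivAt_primitive [CompleteSpace E] {L : ℝ} {w : ℝ → E}
    (hw : IntervalIntegrable w volume 0 L) (c : E) :
    ∀ᵐ x : ℝ, x ∈ Set.uIcc 0 L → HasDerivAt (fun x => c + ∫ t in (0 : ℝ)..x, w t) (w x) x := by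
  filter_upwards [hw.ae_hasDerivAt_integral] with x hx hxL
  exact (hx hxL 0 Set.left_mem_uIcc).const_add c

/-- The fundamental theorem of calculus for absolutely continuous functions with values in a
Banach space, the derivative being given almost everywhere. -/
theorem eq_primitive_of_ae_hasDerivAt [CompleteSpace E] {L : ℝ} {f w : ℝ → E}
    (hf : AbsolutelyContinuousOnInterval f 0 L) (hw : IntervalIntegrable w volume 0 L)
    (hd : ∀ᵐ x : ℝ, x ∈ Set.uIcc 0 L → HasDerivAt f (w x) x) {x : ℝ} (hx : x ∈ Set.uIcc 0 L) :
    f x = f 0 + ∫ t in (0 : ℝ)..x, w t := by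
  have hac : AbsolutelyContinuousOnInterval (fun x => f x - (f 0 + ∫ t in (0 : ℝ)..x, w t)) 0 L :=
    hf.sub (absolutelyContinuousOnInterval_primitive hw (f 0))
  obtain ⟨C, hC⟩ := hac.const_of_ae_hasDerivAt_zero (by
    filter_upwards [hd, ae_hasDerivAt_primitive hw (f 0)] with x h1 h2 hx
    simpa using (h1 hx).fun_sub (h2 hx))
  have e0 := hC 0 Set.left_mem_uIcc
  have ex := hC x hx
  simp only [intervalIntegral.integral_same, add_zero, sub_self] at e0
  rw [← e0, sub_eq_zero] at ex
  exact ex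

/-- The product rule for primitives of integrable functions. -/
theorem primitive_smul_primitive [NormedSpace ℂ E] [CompleteSpace E] {L : ℝ} {p : ℝ → ℂ}
    {w : ℝ → E} (hp : IntervalIntegrable p volume 0 L) (hw : IntervalIntegrable w volume 0 L)
    (c : ℂ) (d : E) :
    IntervalIntegrable (fun x => (c + ∫ t in (0 : ℝ)..x, p t) • w x +
        p x • (d + ∫ t in (0 : ℝ)..x, w t)) volume 0 L ∧
      ∀ x ∈ Set.uIcc 0 L, (c + ∫ t in (0 : ℝ)..x, p t) • (d + ∫ t in (0 : ℝ)..x, w t) =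
        c • d + ∫ s in (0 : ℝ)..x, ((c + ∫ t in (0 : ℝ)..s, p t) • w s +
          p s • (d + ∫ t in (0 : ℝ)..s, w t)) := by
  have hP := absolutelyContinuousOnInterval_primitive hp c
  have hW := absolutelyContinuousOnInterval_primitive hw d
  have hint : IntervalIntegrable (fun x => (c + ∫ t in (0 : ℝ)..x, p t) • w x +
        p x • (d + ∫ t in (0 : ℝ)..x, w t)) volume 0 L :=
    (hw.continuousOn_smul hP.continuousOn).add (hp.smul_continuousOn hW.continuousOn)
  refine ⟨hint, fun x hx => ?_⟩
  have hPW := AbsolutelyContinuousOnInterval.smul hP hW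
  have := eq_primitive_of_ae_hasDerivAt hPW hint (by
    filter_upwards [ae_hasDerivAt_primitive hp c, ae_hasDerivAt_primitive hw d] with x h1 h2 hx
    exact (h1 hx).smul (h2 hx)) hx
  simpa using this

end Primitive

/-- The chain rule for `exp (i θ)`, where `θ` is the primitive of an integrable function. -/
theorem cexp_primitive {L : ℝ} {w : ℝ → ℝ} (hw : IntervalIntegrable w volume 0 L) :
    IntervalIntegrable (fun x => Complex.I * w x *
        Complex.exp (Complex.I * ((∫ t in (0 : ℝ)..x, w t : ℝ) : ℂ))) volume 0 L ∧
      ∀ x ∈ Set.uIcc 0 L, Complex.exp (Complex.I * ((∫ t in (0 : ℝ)..x, w t : ℝ) : ℂ)) =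
        1 + ∫ s in (0 : ℝ)..x, Complex.I * w s *
          Complex.exp (Complex.I * ((∫ t in (0 : ℝ)..s, w t : ℝ) : ℂ)) := by
  have hθ : AbsolutelyContinuousOnInterval (fun x => ∫ t in (0 : ℝ)..x, w t) 0 L := by
    simpa using absolutelyContinuousOnInterval_primitive hw 0
  have hθd := ae_hasDerivAt_primitive hw 0
  simp only [zero_add] at hθd
  have hac : AbsolutelyContinuousOnInterval
      (fun x => Complex.exp (Complex.I * ((∫ t in (0 : ℝ)..x, w t : ℝ) : ℂ))) 0 L := by
    refine absolutelyContinuousOnInterval_of_dist_le hθ fun x _ y _ => ?_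
    rw [dist_eq_norm, Real.dist_eq]
    have := Real.norm_exp_I_mul_ofReal_sub_one_le
      (x := (∫ t in (0 : ℝ)..x, w t) - ∫ t in (0 : ℝ)..y, w t)
    set p := ∫ t in (0 : ℝ)..x, w t
    set q := ∫ t in (0 : ℝ)..y, w t
    have e : Complex.exp (Complex.I * p) - Complex.exp (Complex.I * q) =
        Complex.exp (Complex.I * q) * (Complex.exp (Complex.I * ((p - q : ℝ) : ℂ)) - 1) := by
      rw [mul_sub, ← Complex.exp_add, mul_one]
      congr 2
      push_cast
      ring
    rw [e, norm_mul, mul_comm Complex.I (q : ℂ), Complex.norm_exp_ofReal_mul_I, one_mul]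
    exact this
  have hint : IntervalIntegrable (fun x => Complex.I * w x *
        Complex.exp (Complex.I * ((∫ t in (0 : ℝ)..x, w t : ℝ) : ℂ))) volume 0 L :=
    ((show IntervalIntegrable (fun x => (w x : ℂ)) volume 0 L from
      ⟨hw.1.ofReal, hw.2.ofReal⟩).const_mul Complex.I).mul_continuousOn hac.continuousOn
  refine ⟨hint, fun x hx => ?_⟩
  have := eq_primitive_of_ae_hasDerivAt hac hint (by
    filter_upwards [hθd] with x h1 hx
    have h2 := ((h1 hx).ofReal_comp.const_mul Complex.I).cexp
    rwa [mul_comm] at h2) hx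
  simpa using this

/-! ### The eigenfunctions of the magnetic derivative -/

/-- The primitive `∫₀ˣ a` of the magnetic potential, extended by constants outside `(0, L]`. -/
def magPhase (L : ℝ) (a : ℝ → ℝ) (x : ℝ) : ℝ := ∫ t in (0 : ℝ)..x, (Set.Ioc 0 L).indicator a t

/-- The frequencies `(2π / L) (k + α)`; up to sign these are the eigenvalues of `i d/dx - a`. -/
def freq (L : ℝ) (a : ℝ → ℝ) (k : ℤ) : ℝ := 2 * Real.pi / L * (k + flux L a)

/-- The normalized scalar eigenfunction `L^{-1/2} exp(i (ω_k x - ∫₀ˣ a))` of `i d/dx - a`, with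
eigenvalue `-ω_k`. -/
def mode (L : ℝ) (a : ℝ → ℝ) (k : ℤ) (x : ℝ) : ℂ :=
  ((√L)⁻¹ : ℝ) * Complex.exp (Complex.I * ((freq L a k * x - magPhase L a x : ℝ) : ℂ))

section Mode

variable {L : ℝ} {a : ℝ → ℝ}

theorem integrable_indicator_potential (ha : IntegrableOn a (Set.Ioc 0 L)) :
    Integrable ((Set.Ioc 0 L).indicator a) volume :=
  ha.integrable_indicator measurableSet_Ioc

theorem magPhase_right (hL : 0 < L) : magPhase L a L = 2 * Real.pi * flux L a := by
  have : magPhase L a L = ∫ x in Set.Ioc 0 L, a x := by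
    rw [magPhase, intervalIntegral.integral_of_le hL.le, setIntegral_indicator measurableSet_Ioc,
      Set.inter_self]
  rw [this, flux]
  field_simp [Real.pi_ne_zero]

theorem continuous_magPhase (ha : IntegrableOn a (Set.Ioc 0 L)) : Continuous (magPhase L a) :=
  intervalIntegral.continuous_primitive
    (fun _ _ => (integrable_indicator_potential ha).intervalIntegrable) 0

theorem continuous_mode (ha : IntegrableOn a (Set.Ioc 0 L)) (k : ℤ) :
    Continuous (mode L a k) := by
  have := continuous_magPhase ha
  unfold mode
  fun_prop

theorem norm_mode (k : ℤ) (x : ℝ) : ‖mode L a k x‖ = (√L)⁻¹ := by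
  rw [mode, norm_mul, mul_comm Complex.I, Complex.norm_exp_ofReal_mul_I, mul_one,
    Complex.norm_real, Real.norm_of_nonneg (by positivity)]

theorem norm_mode_sq (hL : 0 < L) (k : ℤ) (x : ℝ) : ‖mode L a k x‖ ^ 2 = 1 / L := by
  rw [norm_mode, inv_pow, Real.sq_sqrt hL.le, one_div]

theorem freq_ne_zero (hL : 0 < L) (hflux : ∀ j : ℤ, flux L a ≠ j) (k : ℤ) : freq L a k ≠ 0 := by
  have h := hflux (-k)
  have : (k : ℝ) + flux L a ≠ 0 := fun h' => h (by push_cast; linarith)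
  exact mul_ne_zero (by positivity) this

theorem mode_eq_fourier_mul [Fact (0 < L)] (k : ℤ) (x : ℝ) :
    mode L a k x = fourier k (x : AddCircle L) * mode L a 0 x := by
  rw [fourier_coe_apply, mode, mode, mul_left_comm, ← Complex.exp_add]
  congr 2
  simp only [freq]
  push_cast
  have : (L : ℂ) ≠ 0 := by exact_mod_cast (Fact.out : 0 < L).ne'
  field_simp
  ring

theorem integral_mode_mul_mode (hL : 0 < L) (k l : ℤ) :
    ∫ x in Set.Ioc 0 L, (starRingEnd ℂ) (mode L a k x) * mode L a l x = if k = l then 1 else 0 := by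
  have : Fact (0 < L) := ⟨hL⟩
  have h1 := fourierCoeff_eq_intervalIntegral (T := L) (fourier l : AddCircle L → ℂ) k 0
  rw [fourierCoeff_fourier, zero_add, intervalIntegral.integral_of_le hL.le] at h1
  have h2 : ∀ x, (starRingEnd ℂ) (mode L a k x) * mode L a l x =
      ((1 / L : ℝ) : ℂ) * (fourier (-k) (x : AddCircle L) • fourier l (x : AddCircle L)) := by
    intro x
    rw [mode_eq_fourier_mul k, mode_eq_fourier_mul l, map_mul, fourier_neg, smul_eq_mul,
      ← norm_mode_sq (a := a) hL 0 x, mul_mul_mul_comm]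
    push_cast
    rw [← Complex.conj_mul']
    exact mul_comm _ _
  simp_rw [h2]
  rw [integral_const_mul]
  rw [Complex.real_smul] at h1
  rw [← h1]
  simp [Pi.single_apply]

theorem mode_hasPrimitive (ha : IntegrableOn a (Set.Ioc 0 L)) (k : ℤ) :
    ∃ p : ℝ → ℂ, IntervalIntegrable p volume 0 L ∧
      (∀ x ∈ Set.Ioc 0 L, p x = -(Complex.I * (freq L a k - a x : ℝ)) *
        (starRingEnd ℂ) (mode L a k x)) ∧
      ∀ x ∈ Set.uIcc 0 L, (starRingEnd ℂ) (mode L a k x) =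
        ((√L)⁻¹ : ℝ) + ∫ t in (0 : ℝ)..x, p t := by
  have hi := (integrable_indicator_potential ha)
  have hw : IntervalIntegrable (fun t => -(freq L a k) + (Set.Ioc 0 L).indicator a t) volume 0 L :=
    intervalIntegrable_const.add hi.intervalIntegrable
  obtain ⟨h1, h2⟩ := cexp_primitive hw
  have e : ∀ x, (∫ t in (0 : ℝ)..x, (-(freq L a k) + (Set.Ioc 0 L).indicator a t)) =
      -(freq L a k * x - magPhase L a x) := by
    intro x
    rw [intervalIntegral.integral_add intervalIntegrable_const hi.intervalIntegrable,
      intervalIntegral.integral_const, magPhase]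
    simp
    ring
  have econj : ∀ x, (starRingEnd ℂ) (mode L a k x) = ((√L)⁻¹ : ℝ) *
      Complex.exp (Complex.I * ((∫ t in (0 : ℝ)..x, (-(freq L a k) + (Set.Ioc 0 L).indicator a t) :
        ℝ) : ℂ)) := by
    intro x
    rw [e, mode, map_mul, Complex.conj_ofReal, ← Complex.exp_conj, map_mul, Complex.conj_I,
      Complex.conj_ofReal]
    push_cast
    ring_nf
  refine ⟨_, h1.const_mul ((√L)⁻¹ : ℝ), fun x hx => ?_, fun x hx => ?_⟩
  · rw [econj, Set.indicator_of_mem hx]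
    push_cast
    ring
  · rw [econj, h2 x hx, intervalIntegral.integral_const_mul]
    ring

theorem mode_right (hL : 0 < L) (k : ℤ) : mode L a k L = mode L a k 0 := by
  have h : freq L a k * L - magPhase L a L = k * (2 * Real.pi) := by
    rw [magPhase_right hL, freq]
    field_simp
    ring
  have h0 : freq L a k * 0 - magPhase L a 0 = 0 := by simp [magPhase]
  rw [mode, mode, h, h0]
  congr 1
  push_cast
  rw [mul_comm, mul_assoc, Complex.exp_int_mul_two_pi_mul_I]
  simp

end Mode

/-! ### The Hilbert basis of eigenfunctions -/

section Basis

variable {L : ℝ} {a : ℝ → ℝ} {M : ℕ}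

theorem memLp_modeVec (ha : IntegrableOn a (Set.Ioc 0 L)) (i : ℤ × Fin M) :
    MemLp (fun x => mode L a i.1 x • EuclideanSpace.single i.2 (1 : ℂ)) 2
      (volume.restrict (Set.Ioc 0 L)) := by
  refine MemLp.of_bound (C := (√L)⁻¹)
    ((continuous_mode ha i.1).smul continuous_const).aestronglyMeasurable ?_
  filter_upwards with x
  rw [norm_smul, norm_mode, PiLp.norm_single, norm_one, mul_one]

/-- The vector-valued eigenfunction `mode k • e_j` as an element of `L²`. -/
def modeVec (ha : IntegrableOn a (Set.Ioc 0 L)) (i : ℤ × Fin M) : L2Space L M :=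
  (memLp_modeVec ha i).toLp _

theorem coeFn_modeVec (ha : IntegrableOn a (Set.Ioc 0 L)) (i : ℤ × Fin M) :
    modeVec ha i =ᵐ[volume.restrict (Set.Ioc 0 L)]
      fun x => mode L a i.1 x • EuclideanSpace.single i.2 (1 : ℂ) :=
  MemLp.coeFn_toLp _

theorem inner_modeVec (ha : IntegrableOn a (Set.Ioc 0 L)) (i : ℤ × Fin M) (u : L2Space L M) :
    inner ℂ (modeVec ha i) u =
      ∫ x in Set.Ioc 0 L, (starRingEnd ℂ) (mode L a i.1 x) * u x i.2 := by
  rw [L2.inner_def]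
  refine integral_congr_ae ?_
  filter_upwards [coeFn_modeVec ha i] with x hx
  rw [hx, inner_smul_left, EuclideanSpace.inner_single_left]
  simp

theorem orthonormal_modeVec (hL : 0 < L) (ha : IntegrableOn a (Set.Ioc 0 L)) :
    Orthonormal ℂ (modeVec (M := M) ha) := by
  classical
  rw [orthonormal_iff_ite]
  rintro ⟨k, i⟩ ⟨l, j⟩
  rw [inner_modeVec]
  have : ∀ᵐ x ∂volume.restrict (Set.Ioc 0 L),
      (starRingEnd ℂ) (mode L a k x) * modeVec ha (l, j) x i =
        (starRingEnd ℂ) (mode L a k x) * mode L a l x * (if i = j then 1 else 0) := by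
    filter_upwards [coeFn_modeVec ha (l, j)] with x hx
    rw [hx]
    simp
  rw [integral_congr_ae this, integral_mul_const, integral_mode_mul_mode hL]
  by_cases h1 : k = l <;> by_cases h2 : i = j <;> simp [h1, h2]

theorem span_modeVec_orthogonal (hL : 0 < L) (ha : IntegrableOn a (Set.Ioc 0 L)) :
    (Submodule.span ℂ (Set.range (modeVec (M := M) ha)))ᗮ = ⊥ := by
  have : Fact (0 < L) := ⟨hL⟩
  rw [Submodule.eq_bot_iff]
  intro u hu
  have h0 : ∀ i, inner ℂ (modeVec ha i) u = 0 := fun i =>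
    (Submodule.mem_orthogonal _ _).1 hu _ (Submodule.subset_span ⟨i, rfl⟩)
  -- each component of `u` times a unimodular function has vanishing Fourier coefficients
  have hcomp : ∀ j : Fin M, ∀ᵐ x ∂volume.restrict (Set.Ioc 0 L), u x j = 0 := by
    intro j
    set f : ℝ → ℂ := fun x => (starRingEnd ℂ) (mode L a 0 x) * u x j with hf
    have huj : MemLp (fun x => u x j) 2 (volume.restrict (Set.Ioc 0 L)) := by
      have := (Lp.memLp u).continuousLinearMap_comp (EuclideanSpace.proj (𝕜 := ℂ) j)
      exact this
    have hfL : MemLp f 2 (volume.restrict (Set.Ioc 0 L)) := by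
      refine MemLp.of_le_mul (c := (√L)⁻¹) huj ?_ ?_
      · exact (Complex.continuous_conj.comp
          (continuous_mode ha 0)).aestronglyMeasurable.mul huj.aestronglyMeasurable
      · filter_upwards with x
        rw [hf, norm_mul, RCLike.norm_conj, norm_mode]
    have hP := hasSum_sq_fourierCoeffOn hL (by simpa using hfL)
    have hzero : ∀ k, fourierCoeffOn hL f k = 0 := by
      intro k
      have h1 := h0 (k, j)
      rw [inner_modeVec] at h1
      rw [fourierCoeffOn_eq_integral, intervalIntegral.integral_of_le hL.le]
      have : ∀ x : ℝ, fourier (-k) (x : AddCircle (L - 0)) • f x =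
          (starRingEnd ℂ) (mode L a k x) * u x j := by
        intro x
        have e : fourier k (x : AddCircle (L - 0)) = fourier k (x : AddCircle L) := by
          rw [fourier_coe_apply, fourier_coe_apply, sub_zero]
        rw [hf, mode_eq_fourier_mul k, fourier_neg, smul_eq_mul, map_mul, mul_assoc, e]
      simp_rw [this]
      rw [h1, smul_zero]
    simp only [hzero, norm_zero, ne_eq, OfNat.ofNat_ne_zero, not_false_eq_true, zero_pow] at hP
    have h2 := hP.unique hasSum_zero
    rw [intervalIntegral.integral_of_le hL.le, sub_zero, smul_eq_mul] at h2
    have h3 : ∫ x in Set.Ioc 0 L, ‖f x‖ ^ 2 = 0 := by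
      rcases mul_eq_zero.1 h2 with h | h
      · exact absurd h (inv_ne_zero hL.ne')
      · exact h
    rw [integral_eq_zero_iff_of_nonneg (fun x => by positivity) hfL.integrable_norm_pow'] at h3
    filter_upwards [h3] with x hx
    have hx' : f x = 0 := by simpa using hx
    rcases mul_eq_zero.1 hx' with h | h
    · have := norm_mode (L := L) (a := a) 0 x
      rw [(map_eq_zero _).1 h, norm_zero] at this
      exact absurd this.symm (inv_ne_zero (Real.sqrt_pos.2 hL).ne')
    · exact h
  rw [Lp.eq_zero_iff_ae_eq_zero]
  filter_upwards [ae_all_iff.2 hcomp] with x hx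
  ext j
  simpa using hx j

/-- The eigenfunctions of `i d/dx - a` form a Hilbert basis of `L²((0, L); ℂ^M)`. -/
def modeBasis (hL : 0 < L) (ha : IntegrableOn a (Set.Ioc 0 L)) :
    HilbertBasis (ℤ × Fin M) ℂ (L2Space L M) :=
  HilbertBasis.mkOfOrthogonalEqBot (orthonormal_modeVec hL ha) (span_modeVec_orthogonal hL ha)

theorem modeBasis_apply (hL : 0 < L) (ha : IntegrableOn a (Set.Ioc 0 L)) (i : ℤ × Fin M) :
    modeBasis hL ha i = modeVec ha i := by
  simp [modeBasis]

theorem modeBasis_repr (hL : 0 < L) (ha : IntegrableOn a (Set.Ioc 0 L)) (u : L2Space L M)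
    (i : ℤ × Fin M) : (modeBasis hL ha).repr u i = inner ℂ (modeVec ha i) u := by
  rw [HilbertBasis.repr_apply_apply, modeBasis_apply]

/-- On the domain of `D = i d/dx - a`, the coefficients of `D u` in the basis of eigenfunctions
are the products of the eigenvalues with the coefficients of `u` (integration by parts). -/
theorem repr_of_mem_magDeriv (hL : 0 < L) (ha : IntegrableOn a (Set.Ioc 0 L)) {u g : L2Space L M}
    (h : (u, g) ∈ magDeriv L a M) (i : ℤ × Fin M) :
    (modeBasis hL ha).repr g i = -(freq L a i.1 : ℂ) * (modeBasis hL ha).repr u i := by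
  obtain ⟨c, w, hw, hw0, hu, hg⟩ := h
  obtain ⟨k, j⟩ := i
  obtain ⟨p, hp, hpx, hpP⟩ := mode_hasPrimitive ha k
  rw [modeBasis_repr, modeBasis_repr, inner_modeVec, inner_modeVec, ← integral_const_mul]
  have huj : MemLp (fun x => u x j) 2 (volume.restrict (Set.Ioc 0 L)) :=
    (Lp.memLp u).continuousLinearMap_comp (EuclideanSpace.proj (𝕜 := ℂ) j)
  have hgj : MemLp (fun x => g x j) 2 (volume.restrict (Set.Ioc 0 L)) :=
    (Lp.memLp g).continuousLinearMap_comp (EuclideanSpace.proj (𝕜 := ℂ) j)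
  have hmul : ∀ {v : ℝ → ℂ}, MemLp v 2 (volume.restrict (Set.Ioc 0 L)) →
      Integrable (fun x => (starRingEnd ℂ) (mode L a k x) * v x)
        (volume.restrict (Set.Ioc 0 L)) := by
    intro v hv
    refine (hv.integrable one_le_two).bdd_mul (c := (√L)⁻¹)
      (Complex.continuous_conj.comp (continuous_mode ha k)).aestronglyMeasurable ?_
    filter_upwards with x
    simp only [RCLike.norm_conj, norm_mode, le_refl]
  obtain ⟨hint, hprod⟩ := primitive_smul_primitive hp hw (((√L)⁻¹ : ℝ) : ℂ) c
  have hL' := hprod L Set.right_mem_uIcc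
  have e0 := hpP 0 Set.left_mem_uIcc
  rw [intervalIntegral.integral_same, add_zero] at e0
  rw [← hpP L Set.right_mem_uIcc, hw0, add_zero, mode_right hL, e0] at hL'
  have hI : ∫ x in Set.Ioc 0 L, (((((√L)⁻¹ : ℝ) : ℂ) + ∫ t in (0 : ℝ)..x, p t) • w x +
      p x • (c + ∫ t in (0 : ℝ)..x, w t)) = 0 := by
    rw [← intervalIntegral.integral_of_le hL.le]
    simpa using hL'.symm
  have hIj := congrArg (fun v : EuclideanSpace ℂ (Fin M) => v j) hI
  have hint' := hint.1
  have hproj := ContinuousLinearMap.integral_comp_comm (EuclideanSpace.proj (𝕜 := ℂ) j) hint'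
  simp only [EuclideanSpace.coe_proj] at hproj hIj
  rw [← hproj] at hIj
  rw [← sub_eq_zero, ← integral_sub (hmul hgj) ((hmul huj).const_mul _)]
  rw [← mul_zero Complex.I, ← show ((0 : EuclideanSpace ℂ (Fin M)) j : ℂ) = 0 from rfl, ← hIj,
    ← integral_const_mul]
  refine integral_congr_ae ?_
  filter_upwards [hu, hg, ae_restrict_mem measurableSet_Ioc] with x h1 h2 h3
  have h4 : x ∈ Set.uIcc 0 L := by
    rw [Set.uIcc_of_le hL.le]
    exact ⟨h3.1.le, h3.2⟩
  rw [← hpP x h4, ← h1, hpx x h3, h2]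
  simp only [PiLp.add_apply, PiLp.sub_apply, PiLp.smul_apply, smul_eq_mul]
  push_cast
  linear_combination ((freq L a k : ℂ) - a x) * (starRingEnd ℂ) (mode L a k x) * u x j *
    Complex.I_mul_I

end Basis

-- Unfolding the basis is never needed below and slows down unification.
attribute [irreducible] modeBasis

section Range

variable {L : ℝ} {a : ℝ → ℝ} {M : ℕ}

/-- For a flux `α ∉ ℤ` the equation `i u' - a u = g` has a periodic solution for every `g ∈ L²`,
given by variation of constants: `u = e^{-iA} (c - i ∫ e^{iA} g)` with `A = ∫ a`. The constant `c`
that makes `u` periodic exists because `e^{-iA(L)} = e^{-2πiα} ≠ 1`. -/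
theorem exists_mem_magDeriv (hL : 0 < L) (ha : IntegrableOn a (Set.Ioc 0 L))
    (hflux : ∀ j : ℤ, flux L a ≠ j) (g : L2Space L M) : ∃ u, (u, g) ∈ magDeriv L a M := by
  have hi := (integrable_indicator_potential ha)
  have hw : IntervalIntegrable (fun t => -(Set.Ioc 0 L).indicator a t) volume 0 L :=
    hi.neg.intervalIntegrable
  obtain ⟨h1, h2⟩ := cexp_primitive hw
  set p : ℝ → ℂ := fun x => Complex.I * ((-(Set.Ioc 0 L).indicator a x : ℝ) : ℂ) *
    Complex.exp (Complex.I * ((∫ t in (0 : ℝ)..x, (-(Set.Ioc 0 L).indicator a t) : ℝ) : ℂ)) with hp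
  set P : ℝ → ℂ := fun x => Complex.exp (Complex.I *
    ((∫ t in (0 : ℝ)..x, (-(Set.Ioc 0 L).indicator a t) : ℝ) : ℂ)) with hP
  have hPe : ∀ x, P x = Complex.exp (Complex.I * ((-magPhase L a x : ℝ) : ℂ)) := by
    intro x
    rw [hP, magPhase, ← intervalIntegral.integral_neg]
  have hPc : Continuous P := by
    have := continuous_magPhase ha
    have e : P = fun x => Complex.exp (Complex.I * ((-magPhase L a x : ℝ) : ℂ)) := funext hPe
    rw [e]
    fun_prop
  have hPn : ∀ x, ‖P x‖ = 1 := by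
    intro x
    rw [hPe, mul_comm, Complex.norm_exp_ofReal_mul_I]
  have hg : IntervalIntegrable (fun x => g x) volume 0 L :=
    (intervalIntegrable_iff_integrableOn_Ioc_of_le hL.le).2
      ((Lp.memLp g).integrable one_le_two)
  set h : ℝ → EuclideanSpace ℂ (Fin M) :=
    fun x => (-Complex.I * (starRingEnd ℂ) (P x)) • g x with hh
  have hhi : IntervalIntegrable h volume 0 L :=
    hg.continuousOn_smul (continuous_const.mul (Complex.continuous_conj.comp hPc)).continuousOn
  have hq : P L ≠ 1 := by
    intro hq
    rw [hPe, magPhase_right hL, Complex.exp_eq_one_iff] at hq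
    obtain ⟨n, hn⟩ := hq
    refine hflux (-n) ?_
    have h3 : ((-(2 * Real.pi * flux L a) : ℝ) : ℂ) = ((n * (2 * Real.pi) : ℝ) : ℂ) := by
      refine mul_left_cancel₀ Complex.I_ne_zero ?_
      rw [hn]
      push_cast
      ring
    have h4 : -(2 * Real.pi * flux L a) = n * (2 * Real.pi) := by exact_mod_cast h3
    have h5 : (2 * Real.pi) * (flux L a + n) = 0 := by linarith
    have h6 := (mul_eq_zero.1 h5).resolve_left (by positivity)
    push_cast
    linarith
  have hq' : (1 - P L) ≠ 0 := sub_ne_zero.2 (Ne.symm hq)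
  set c : EuclideanSpace ℂ (Fin M) := ((1 - P L)⁻¹ * P L) • ∫ t in (0 : ℝ)..L, h t with hc
  obtain ⟨hint, hprod⟩ := primitive_smul_primitive (p := p) h1 hhi 1 c
  have hv := absolutelyContinuousOnInterval_primitive hint ((1 : ℂ) • c)
  set w : ℝ → EuclideanSpace ℂ (Fin M) := fun x => ((1 : ℂ) + ∫ t in (0 : ℝ)..x, p t) • h x +
        p x • (c + ∫ t in (0 : ℝ)..x, h t) with hwdef
  obtain ⟨C, hC⟩ := hv.exists_bound
  have hIoc : Set.Ioc 0 L ⊆ Set.uIcc 0 L := by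
    rw [Set.uIcc_of_le hL.le]
    exact Set.Ioc_subset_Icc_self
  have hmem : MemLp (fun x => (1 : ℂ) • c + ∫ t in (0 : ℝ)..x, w t) 2
      (volume.restrict (Set.Ioc 0 L)) := by
    refine MemLp.of_bound (C := C)
      ((hv.continuousOn.mono hIoc).aestronglyMeasurable measurableSet_Ioc) ?_
    filter_upwards [ae_restrict_mem measurableSet_Ioc] with x hx
    exact hC x (hIoc hx)
  refine ⟨hmem.toLp _, c, w, hint, ?_, ?_, ?_⟩
  · have e := hprod L Set.right_mem_uIcc
    rw [← h2 L Set.right_mem_uIcc] at e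
    change P L • _ = _ at e
    have e2 : P L • (c + ∫ t in (0 : ℝ)..L, h t) = c := by
      rw [smul_add, hc, smul_smul, ← add_smul]
      congr 1
      field_simp
      ring
    rw [e2, one_smul] at e
    simpa using e.symm
  · filter_upwards [hmem.coeFn_toLp] with x hx
    rw [hx, one_smul]
  · filter_upwards [hmem.coeFn_toLp, ae_restrict_mem measurableSet_Ioc] with x hx hx2
    rw [hx, ← hprod x (hIoc hx2)]
    rw [hwdef]
    simp only
    rw [← h2 x (hIoc hx2)]
    change g x = Complex.I • (P x • h x + p x • _) - (a x : ℂ) • (P x • _)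
    have e3 : P x • h x = -Complex.I • g x := by
      rw [hh, smul_smul]
      congr 1
      have := Complex.mul_conj' (P x)
      rw [hPn, Complex.ofReal_one, one_pow] at this
      linear_combination (-Complex.I) * this
    have e4 : p x = -Complex.I * a x * P x := by
      simp only [hp, hP, Set.indicator_of_mem hx2]
      push_cast
      ring
    rw [e3, e4, smul_add, smul_smul, smul_smul, smul_smul]
    rw [show Complex.I * -Complex.I = 1 by rw [mul_neg, Complex.I_mul_I, neg_neg],
      show Complex.I * (-Complex.I * a x * P x) = a x * P x by
        linear_combination (-(a x : ℂ) * P x) * Complex.I_mul_I]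
    simp

/-- The operator `i d/dx - a` is diagonal in the basis of its eigenfunctions. -/
theorem mem_magDeriv_iff (hL : 0 < L) (ha : IntegrableOn a (Set.Ioc 0 L))
    (hflux : ∀ j : ℤ, flux L a ≠ j) {u g : L2Space L M} :
    (u, g) ∈ magDeriv L a M ↔ ∀ i, (modeBasis hL ha).repr g i =
      -(freq L a i.1 : ℂ) * (modeBasis hL ha).repr u i := by
  refine ⟨repr_of_mem_magDeriv hL ha, fun h => ?_⟩
  obtain ⟨v, hv⟩ := exists_mem_magDeriv hL ha hflux g
  have : u = v := by
    refine (modeBasis hL ha).repr.injective (Subtype.ext (funext fun i => ?_))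
    have h1 := repr_of_mem_magDeriv hL ha hv i
    rw [h i] at h1
    refine mul_left_cancel₀ (neg_ne_zero.2 ?_) h1
    exact_mod_cast freq_ne_zero hL hflux i.1
  rwa [this]

end Range

/-! ### Lattice sums -/

/-- Parseval's identity for the function `exp (2π (τ - iα) x)` on `(0, 1]`. -/
theorem hasSum_one_div_sq_add_sq (α : ℝ) {τ : ℝ} (hτ : 0 < τ) :
    HasSum (fun n : ℤ => 1 / (((n : ℝ) + α) ^ 2 + τ ^ 2))
      (Real.pi / τ * (Real.sinh (2 * Real.pi * τ) /
        (Real.cosh (2 * Real.pi * τ) - Real.cos (2 * Real.pi * α)))) := by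
  set z : ℂ := 2 * Real.pi * (τ - Complex.I * α) with hz
  set f : ℝ → ℂ := fun x => Complex.exp (z * x) with hf
  have hπ := Real.pi_pos
  have hzre : z.re = 2 * Real.pi * τ := by
    rw [hz]
    simp
  have hzim : z.im = -(2 * Real.pi * α) := by
    rw [hz]
    simp
  have hfn : ∀ x, ‖f x‖ ^ 2 = Real.exp (4 * Real.pi * τ * x) := by
    intro x
    rw [hf, Complex.norm_exp, ← Real.exp_nat_mul]
    congr 1
    simp [hzre]
    ring
  have hfL : MemLp f 2 (volume.restrict (Set.Ioc 0 1)) := by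
    refine (memLp_two_iff_integrable_sq_norm (by fun_prop)).2 ?_
    simp_rw [hfn]
    exact (Continuous.integrableOn_Icc (by fun_prop)).mono_set Set.Ioc_subset_Icc_self
  have hP := hasSum_sq_fourierCoeffOn (zero_lt_one' ℝ) hfL
  have hden : ∀ n : ℤ, 0 < ((n : ℝ) + α) ^ 2 + τ ^ 2 := fun n => by positivity
  have hcoef : ∀ n : ℤ, ‖fourierCoeffOn (zero_lt_one' ℝ) f n‖ ^ 2 =
      ‖Complex.exp z - 1‖ ^ 2 / (4 * Real.pi ^ 2) * (1 / (((n : ℝ) + α) ^ 2 + τ ^ 2)) := by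
    intro n
    set c : ℂ := z - 2 * Real.pi * Complex.I * n with hc
    have hcn : ‖c‖ ^ 2 = 4 * Real.pi ^ 2 * (((n : ℝ) + α) ^ 2 + τ ^ 2) := by
      rw [Complex.sq_norm, Complex.normSq_apply]
      have h1 : c.re = 2 * Real.pi * τ := by simp [hc, hzre]
      have h2 : c.im = -(2 * Real.pi * α) - 2 * Real.pi * n := by simp [hc, hzim]
      rw [h1, h2]
      ring
    have hc0 : c ≠ 0 := by
      intro h0
      rw [h0, norm_zero] at hcn
      have := hden n
      have : 0 < 4 * Real.pi ^ 2 * (((n : ℝ) + α) ^ 2 + τ ^ 2) := by positivity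
      linarith
    have hI : fourierCoeffOn (zero_lt_one' ℝ) f n = (Complex.exp z - 1) / c := by
      rw [fourierCoeffOn_eq_integral]
      have : ∀ x : ℝ, fourier (-n) (x : AddCircle ((1 : ℝ) - 0)) • f x = Complex.exp (c * x) := by
        intro x
        rw [fourier_coe_apply, hf, smul_eq_mul, ← Complex.exp_add, hc]
        congr 1
        push_cast
        rw [sub_zero, div_one]
        ring
      simp_rw [this]
      rw [integral_exp_mul_complex hc0]
      have he : Complex.exp (c * (1 : ℝ)) = Complex.exp z := by
        rw [hc, Complex.ofReal_one, mul_one, Complex.exp_sub,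
          show 2 * (Real.pi : ℂ) * Complex.I * n = n * (2 * Real.pi * Complex.I) by ring,
          Complex.exp_int_mul_two_pi_mul_I, div_one]
      rw [he]
      simp
    rw [hI, norm_div, div_pow, hcn]
    have := (hden n).ne'
    field_simp
  have hint : ∫ x in (0 : ℝ)..1, ‖f x‖ ^ 2 =
      (Real.exp (4 * Real.pi * τ) - 1) / (4 * Real.pi * τ) := by
    simp_rw [hfn]
    rw [intervalIntegral.integral_comp_mul_left (fun x => Real.exp x) (by positivity), integral_exp]
    simp
    ring
  simp_rw [hcoef] at hP
  rw [hint] at hP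
  have hE : ‖Complex.exp z - 1‖ ^ 2 = 2 * Real.exp (2 * Real.pi * τ) *
      (Real.cosh (2 * Real.pi * τ) - Real.cos (2 * Real.pi * α)) := by
    rw [Complex.sq_norm, Complex.normSq_apply]
    simp only [Complex.sub_re, Complex.sub_im, Complex.exp_re, Complex.exp_im, Complex.one_re,
      Complex.one_im, hzre, hzim, Real.cos_neg, Real.sin_neg, Real.cosh_eq, Real.exp_neg]
    have := Real.exp_pos (2 * Real.pi * τ)
    have h2 := Real.sin_sq_add_cos_sq (2 * Real.pi * α)
    field_simp
    linear_combination (Real.exp (2 * Real.pi * τ)) ^ 2 * h2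
  have hpos : 0 < Real.cosh (2 * Real.pi * τ) - Real.cos (2 * Real.pi * α) := by
    have h1 := Real.one_lt_cosh.2 (show 2 * Real.pi * τ ≠ 0 by positivity)
    have h2 := Real.cos_le_one (2 * Real.pi * α)
    linarith
  have hE0 := Real.exp_pos (2 * Real.pi * τ)
  have hE' : 0 < ‖Complex.exp z - 1‖ ^ 2 := by
    rw [hE]
    positivity
  have := hP.mul_left ((4 * Real.pi ^ 2) / ‖Complex.exp z - 1‖ ^ 2)
  have e1 : ∀ n : ℤ, 4 * Real.pi ^ 2 / ‖Complex.exp z - 1‖ ^ 2 *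
      (‖Complex.exp z - 1‖ ^ 2 / (4 * Real.pi ^ 2) * (1 / (((n : ℝ) + α) ^ 2 + τ ^ 2))) =
      1 / (((n : ℝ) + α) ^ 2 + τ ^ 2) := by
    intro n
    rw [← mul_assoc, div_mul_div_cancel₀ hE'.ne', div_self (by positivity), one_mul]
  have e2 : 4 * Real.pi ^ 2 / ‖Complex.exp z - 1‖ ^ 2 *
      (1 - 0 : ℝ)⁻¹ • ((Real.exp (4 * Real.pi * τ) - 1) / (4 * Real.pi * τ)) =
      Real.pi / τ * (Real.sinh (2 * Real.pi * τ) /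
        (Real.cosh (2 * Real.pi * τ) - Real.cos (2 * Real.pi * α))) := by
    rw [hE, Real.sinh_eq, show 4 * Real.pi * τ = 2 * Real.pi * τ + 2 * Real.pi * τ by ring,
      Real.exp_add, Real.exp_neg, sub_zero, inv_one, one_smul]
    field_simp
    ring
  simp only [e1] at this
  rwa [e2] at this

theorem cos_two_pi_mul_fract (α : ℝ) :
    Real.cos (2 * Real.pi * Int.fract α) = Real.cos (2 * Real.pi * α) := by
  rw [Int.fract, mul_sub, mul_comm (2 * Real.pi) ((⌊α⌋ : ℤ) : ℝ), Real.cos_sub_int_mul_two_pi]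

/-- `k(α)` is an upper bound for `sinh φ / (cosh φ - cos 2πα)`. -/
theorem sinh_le_k_mul {α : ℝ} (hα : ∀ j : ℤ, α ≠ j) (φ : ℝ) :
    Real.sinh φ ≤ k α * (Real.cosh φ - Real.cos (2 * Real.pi * α)) := by
  have hπ := Real.pi_pos
  have hf0 := Int.fract_nonneg α
  have hf1 := Int.fract_lt_one α
  have hsc := Real.sinh_lt_cosh φ
  unfold k
  split_ifs with h
  · have : Real.cos (2 * Real.pi * α) ≤ 0 := by
      rw [← cos_two_pi_mul_fract]
      exact Real.cos_nonpos_of_pi_div_two_le_of_le (by nlinarith [h.1]) (by nlinarith [h.2])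
    linarith
  · have hs : Real.sin (2 * Real.pi * α) ≠ 0 := by
      intro h0
      rw [Real.sin_eq_zero_iff] at h0
      obtain ⟨n, hn⟩ := h0
      have hn' : α = n / 2 := by
        have : Real.pi * (n - 2 * α) = 0 := by linarith
        rcases mul_eq_zero.1 this with h | h
        · exact absurd h hπ.ne'
        · linarith
      rcases Int.even_or_odd' n with ⟨m, hm | hm⟩
      · exact hα m (by rw [hn', hm]; push_cast; ring)
      · refine h ?_
        have : Int.fract α = 1 / 2 := by
          rw [Int.fract_eq_iff]
          refine ⟨by norm_num, by norm_num, m, ?_⟩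
          rw [hn', hm]
          push_cast
          ring
        rw [this]
        norm_num
    have hs' : 0 < |Real.sin (2 * Real.pi * α)| := abs_pos.2 hs
    rw [div_mul_eq_mul_div, one_mul, le_div_iff₀ hs']
    have h1 := Real.sin_sq_add_cos_sq (2 * Real.pi * α)
    have h2 := Real.cosh_sq φ
    have h3 : 0 ≤ Real.cosh φ - Real.cos (2 * Real.pi * α) := by
      have h1 := Real.one_le_cosh φ
      have h2 := Real.cos_le_one (2 * Real.pi * α)
      linarith
    refine (abs_le_of_sq_le_sq' ?_ h3).2
    rw [mul_pow, sq_abs]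
    nlinarith [sq_nonneg (Real.cos (2 * Real.pi * α) * Real.cosh φ - 1)]

theorem k_nonneg (α : ℝ) : 0 ≤ k α := by
  unfold k
  split_ifs
  · exact zero_le_one
  · positivity

theorem k_pos {α : ℝ} (hα : ∀ j : ℤ, α ≠ j) : 0 < k α := by
  have h := sinh_le_k_mul hα 1
  have h1 : 0 < Real.sinh 1 := Real.sinh_pos_iff.2 one_pos
  rcases (k_nonneg α).lt_or_eq with h2 | h2
  · exact h2
  · rw [← h2, zero_mul] at h
    linarith

/-- The Green function of `(i d/dx - a)² + s²` on the diagonal is at most `k(α) / (2 s)`. -/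
theorem tsum_one_div_freq_sq_add_sq {L : ℝ} (hL : 0 < L) {a : ℝ → ℝ}
    (hflux : ∀ j : ℤ, flux L a ≠ j) {s : ℝ} (hs : 0 < s) :
    Summable (fun n : ℤ => 1 / (freq L a n ^ 2 + s ^ 2)) ∧
      (∑' n : ℤ, 1 / (freq L a n ^ 2 + s ^ 2)) / L ≤ k (flux L a) / (2 * s) := by
  have hπ := Real.pi_pos
  have hτ : 0 < L * s / (2 * Real.pi) := by positivity
  have h := (hasSum_one_div_sq_add_sq (flux L a) hτ).mul_left ((L / (2 * Real.pi)) ^ 2)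
  have e : (fun n : ℤ => (L / (2 * Real.pi)) ^ 2 *
      (1 / (((n : ℝ) + flux L a) ^ 2 + (L * s / (2 * Real.pi)) ^ 2))) =
      fun n : ℤ => 1 / (freq L a n ^ 2 + s ^ 2) := by
    funext n
    have h1 : ((n : ℝ) + flux L a) ^ 2 + (L * s / (2 * Real.pi)) ^ 2 =
        (L / (2 * Real.pi)) ^ 2 * (freq L a n ^ 2 + s ^ 2) := by
      rw [freq]
      field_simp
    have h2 : 0 < freq L a n ^ 2 + s ^ 2 := by positivity
    rw [h1]
    field_simp
  rw [e] at h
  refine ⟨h.summable, ?_⟩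
  rw [h.tsum_eq]
  have hpos : 0 < Real.cosh (2 * Real.pi * (L * s / (2 * Real.pi))) -
      Real.cos (2 * Real.pi * flux L a) := by
    have h1 := Real.one_lt_cosh.2
      (show 2 * Real.pi * (L * s / (2 * Real.pi)) ≠ 0 by positivity)
    have h2 := Real.cos_le_one (2 * Real.pi * flux L a)
    linarith
  have h3 := sinh_le_k_mul hflux (2 * Real.pi * (L * s / (2 * Real.pi)))
  rw [← div_le_iff₀ hpos] at h3
  set q := Real.sinh (2 * Real.pi * (L * s / (2 * Real.pi))) /
    (Real.cosh (2 * Real.pi * (L * s / (2 * Real.pi))) - Real.cos (2 * Real.pi * flux L a))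
  calc (L / (2 * Real.pi)) ^ 2 * (Real.pi / (L * s / (2 * Real.pi)) * q) / L
      = q / (2 * s) := by field_simp
    _ ≤ _ := by gcongr

theorem one_div_cube_add_cube_sq_le {x β : ℝ} (hx : 0 ≤ x) (hβ : 0 < β) :
    1 / (x ^ 3 + β ^ 3) ^ 2 ≤ 2 / β ^ 4 * (1 / (x ^ 2 + β ^ 2)) := by
  rw [div_mul_div_comm, mul_one, div_le_div_iff₀ (by positivity) (by positivity), one_mul]
  have h1 : 0 ≤ (x ^ 2 - β ^ 2) ^ 2 * (x ^ 2 + 2 * β ^ 2) := by positivity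
  have h2 : 0 ≤ x ^ 3 * β ^ 3 := by positivity
  have h3 : 0 ≤ x ^ 6 := by positivity
  have h4 : 0 ≤ β ^ 6 := by positivity
  nlinarith

theorem summable_one_div_abs_cube_add (α : ℝ) {β : ℝ} (hβ : 0 < β) :
    Summable (fun j : ℤ => 1 / (|(j : ℝ) + α| ^ 3 + β ^ 3) ^ 2) := by
  refine Summable.of_nonneg_of_le (fun j => by positivity) (fun j => ?_)
    ((hasSum_one_div_sq_add_sq α hβ).summable.mul_left (2 / β ^ 4))
  rw [← sq_abs ((j : ℝ) + α)]
  exact one_div_cube_add_cube_sq_le (abs_nonneg _) hβ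

theorem rpow_five_thirds_cube {β : ℝ} (hβ : 0 ≤ β) : (β ^ 3) ^ (5 / 3 : ℝ) = β ^ 5 := by
  rw [← Real.rpow_natCast, ← Real.rpow_natCast, ← Real.rpow_mul hβ]
  norm_num

theorem exists_cube_eq {b : ℝ} (hb : 0 ≤ b) : ∃ β : ℝ, 0 ≤ β ∧ β ^ 3 = b := by
  refine ⟨b ^ (1 / 3 : ℝ), by positivity, ?_⟩
  rw [← Real.rpow_natCast, ← Real.rpow_mul hb]
  norm_num

/-- The supremum in the definition of `K₂(α)` is finite. -/
theorem bddAbove_K₂_sup {α : ℝ} (hα : ∀ j : ℤ, α ≠ j) :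
    BddAbove ((fun b : ℝ => b ^ (5 / 3 : ℝ) * ∑' j : ℤ, 1 / (|(j : ℝ) + α| ^ 3 + b) ^ 2) ''
      Set.Ici 0) := by
  refine ⟨2 * Real.pi * k α, ?_⟩
  rintro _ ⟨b, hb, rfl⟩
  have hk := k_nonneg α
  have hπ := Real.pi_pos
  obtain ⟨β, hβ, rfl⟩ := exists_cube_eq hb
  rcases hβ.eq_or_lt with h0 | hβ
  · rw [← h0]
    norm_num [Real.zero_rpow]
    positivity
  · have hs := hasSum_one_div_sq_add_sq α hβ
    have h1 : ∑' j : ℤ, 1 / (|(j : ℝ) + α| ^ 3 + β ^ 3) ^ 2 ≤ 2 / β ^ 4 * (Real.pi / β * k α) := by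
      calc _ ≤ ∑' j : ℤ, 2 / β ^ 4 * (1 / (((j : ℝ) + α) ^ 2 + β ^ 2)) := by
            refine (summable_one_div_abs_cube_add α hβ).tsum_le_tsum (fun j => ?_)
              (hs.summable.mul_left _)
            rw [← sq_abs ((j : ℝ) + α)]
            exact one_div_cube_add_cube_sq_le (abs_nonneg _) hβ
        _ ≤ _ := by
            rw [tsum_mul_left, hs.tsum_eq]
            gcongr
            have hpos : 0 < Real.cosh (2 * Real.pi * β) - Real.cos (2 * Real.pi * α) := by
              have h1 := Real.one_lt_cosh.2 (show 2 * Real.pi * β ≠ 0 by positivity)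
              have h2 := Real.cos_le_one (2 * Real.pi * α)
              linarith
            rw [div_le_iff₀ hpos]
            exact sinh_le_k_mul hα _
    simp only [rpow_five_thirds_cube hβ.le]
    calc _ ≤ β ^ 5 * (2 / β ^ 4 * (Real.pi / β * k α)) := by gcongr
      _ = _ := by field_simp

/-- The supremum in the definition of `K₂(α)`. -/
def supK₂ (α : ℝ) : ℝ :=
  sSup ((fun b : ℝ => b ^ (5 / 3 : ℝ) * ∑' j : ℤ, 1 / (|(j : ℝ) + α| ^ 3 + b) ^ 2) '' Set.Ici 0)

theorem K₂_eq (α : ℝ) : K₂ α = 5 / (3 * √3 * Real.pi) * supK₂ α ^ 2 := rfl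

theorem supK₂_pos {α : ℝ} (hα : ∀ j : ℤ, α ≠ j) : 0 < supK₂ α := by
  have h := le_csSup (bddAbove_K₂_sup hα) ⟨1, zero_le_one' ℝ, rfl⟩
  refine lt_of_lt_of_le ?_ h
  have hs : Summable (fun j : ℤ => 1 / (|(j : ℝ) + α| ^ 3 + 1) ^ 2) := by
    simpa using summable_one_div_abs_cube_add α one_pos
  simp only [Real.one_rpow, one_mul]
  exact hs.tsum_pos (fun j => by positivity) 0 (by positivity)

theorem tsum_cube_freq_le {L : ℝ} (hL : 0 < L) {a : ℝ → ℝ} (hflux : ∀ j : ℤ, flux L a ≠ j)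
    {s : ℝ} (hs : 0 < s) :
    Summable (fun n : ℤ => (s ^ 3 / (|freq L a n| ^ 3 + s ^ 3)) ^ 2) ∧
      (∑' n : ℤ, (s ^ 3 / (|freq L a n| ^ 3 + s ^ 3)) ^ 2) / L ≤
        supK₂ (flux L a) / (2 * Real.pi) * s := by
  have hπ := Real.pi_pos
  set β := L * s / (2 * Real.pi) with hβ
  have hβ0 : 0 < β := by positivity
  have e : ∀ n : ℤ, (s ^ 3 / (|freq L a n| ^ 3 + s ^ 3)) ^ 2 =
      β ^ 6 * (1 / (|(n : ℝ) + flux L a| ^ 3 + β ^ 3) ^ 2) := by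
    intro n
    have h1 : |freq L a n| = 2 * Real.pi / L * |(n : ℝ) + flux L a| := by
      rw [freq, abs_mul, abs_of_pos (by positivity)]
    have hs' : s = 2 * Real.pi / L * β := by
      rw [hβ]
      field_simp
    have h2 : 0 < |(n : ℝ) + flux L a| ^ 3 + β ^ 3 := by positivity
    rw [h1, hs']
    field_simp
  have hsum := summable_one_div_abs_cube_add (flux L a) hβ0
  simp_rw [e]
  refine ⟨hsum.mul_left _, ?_⟩
  have h := le_csSup (bddAbove_K₂_sup hflux) ⟨β ^ 3, (by positivity : (0 : ℝ) ≤ β ^ 3), rfl⟩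
  change _ ≤ supK₂ (flux L a) at h
  simp only [rpow_five_thirds_cube hβ0.le] at h
  rw [tsum_mul_left]
  set T := ∑' j : ℤ, 1 / (|(j : ℝ) + flux L a| ^ 3 + β ^ 3) ^ 2
  calc β ^ 6 * T / L = (β ^ 5 * T) / (2 * Real.pi) * s := by
        rw [hβ]
        field_simp
    _ ≤ _ := by gcongr

/-! ### Diagonal operators in a Hilbert basis -/

section Diagonal

variable {ι H : Type*} [NormedAddCommGroup H] [InnerProductSpace ℂ H]

theorem hasSum_norm_repr_sq (b : HilbertBasis ι ℂ H) (u : H) :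
    HasSum (fun i => ‖b.repr u i‖ ^ 2) (‖u‖ ^ 2) := by
  have h := lp.hasSum_norm (p := 2) (by norm_num) (b.repr u)
  rw [b.repr.norm_map] at h
  simpa using h

theorem summable_norm_repr_sq (b : HilbertBasis ι ℂ H) (u : H) :
    Summable (fun i => ‖b.repr u i‖ ^ 2) := (hasSum_norm_repr_sq b u).summable

theorem hasSum_inner_repr (b : HilbertBasis ι ℂ H) (u v : H) :
    HasSum (fun i => (starRingEnd ℂ) (b.repr u i) * b.repr v i) (inner ℂ u v) := by
  have h := lp.hasSum_inner (𝕜 := ℂ) (b.repr u) (b.repr v)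
  rw [b.repr.inner_map_map] at h
  simpa [mul_comm] using h

theorem ext_repr (b : HilbertBasis ι ℂ H) {u v : H} (h : ∀ i, b.repr u i = b.repr v i) : u = v :=
  b.repr.injective (Subtype.ext (funext h))

/-- The vector with prescribed square summable coefficients in a Hilbert basis. -/
def ofCoeff (b : HilbertBasis ι ℂ H) (c : ι → ℂ) (hc : Summable fun i => ‖c i‖ ^ 2) : H :=
  b.repr.symm ⟨c, memℓp_gen (by simpa using hc)⟩

@[simp]
theorem repr_ofCoeff (b : HilbertBasis ι ℂ H) (c : ι → ℂ) (hc : Summable fun i => ‖c i‖ ^ 2)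
    (i : ι) : b.repr (ofCoeff b c hc) i = c i := by
  simp [ofCoeff]

theorem summable_mul_repr_sq (b : HilbertBasis ι ℂ H) {m : ι → ℂ} {C : ℝ} (hm : ∀ i, ‖m i‖ ≤ C)
    (u : H) : Summable fun i => ‖m i * b.repr u i‖ ^ 2 := by
  refine Summable.of_nonneg_of_le (fun i => by positivity) (fun i => ?_)
    ((summable_norm_repr_sq b u).mul_left (C ^ 2))
  rw [norm_mul, mul_pow]
  gcongr
  exact hm i

/-- The bounded operator that is diagonal in a Hilbert basis, with bounded eigenvalues `m i`. -/
def diagOp (b : HilbertBasis ι ℂ H) (m : ι → ℂ) (C : ℝ) (hm : ∀ i, ‖m i‖ ≤ C) (hC : 0 ≤ C) :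
    H →L[ℂ] H :=
  LinearMap.mkContinuous
    { toFun := fun u => ofCoeff b (fun i => m i * b.repr u i) (summable_mul_repr_sq b hm u)
      map_add' := fun u v => ext_repr b fun i => by simp [mul_add]
      map_smul' := fun c u => ext_repr b fun i => by simp [mul_left_comm] } C (by
    intro u
    refine le_of_sq_le_sq ?_ (by positivity)
    simp only [LinearMap.coe_mk, AddHom.coe_mk]
    rw [← (hasSum_norm_repr_sq b _).tsum_eq, mul_pow, ← (hasSum_norm_repr_sq b u).tsum_eq,
      ← tsum_mul_left]
    refine (summable_norm_repr_sq b _).tsum_le_tsum (fun i => ?_)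
      ((summable_norm_repr_sq b u).mul_left _)
    rw [repr_ofCoeff, norm_mul, mul_pow]
    gcongr
    exact hm i)

@[simp]
theorem repr_diagOp (b : HilbertBasis ι ℂ H) (m : ι → ℂ) (C : ℝ) (hm : ∀ i, ‖m i‖ ≤ C)
    (hC : 0 ≤ C) (u : H) (i : ι) : b.repr (diagOp b m C hm hC u) i = m i * b.repr u i :=
  repr_ofCoeff b _ (summable_mul_repr_sq b hm u) i

theorem inner_diagOp_left (b : HilbertBasis ι ℂ H) (m : ι → ℂ) (C : ℝ) (hm : ∀ i, ‖m i‖ ≤ C)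
    (hC : 0 ≤ C) (hreal : ∀ i, (starRingEnd ℂ) (m i) = m i) (u v : H) :
    inner ℂ (diagOp b m C hm hC u) v = inner ℂ u (diagOp b m C hm hC v) := by
  refine (hasSum_inner_repr b _ v).unique ?_
  convert hasSum_inner_repr b u (diagOp b m C hm hC v) using 2 with i
  rw [repr_diagOp, repr_diagOp, map_mul, hreal]
  ring

theorem norm_diagOp_le (b : HilbertBasis ι ℂ H) (m : ι → ℂ) (C : ℝ) (hm : ∀ i, ‖m i‖ ≤ C)
    (hC : 0 ≤ C) : ‖diagOp b m C hm hC‖ ≤ C :=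
  LinearMap.mkContinuous_norm_le _ hC _

/-- A diagonal operator whose eigenvalues tend to zero is compact. -/
theorem isCompactOperator_diagOp [CompleteSpace H] (b : HilbertBasis ι ℂ H) (m : ι → ℂ) (C : ℝ)
    (hm : ∀ i, ‖m i‖ ≤ C) (hC : 0 ≤ C) (h0 : Filter.Tendsto m Filter.cofinite (nhds 0)) :
    IsCompactOperator (diagOp b m C hm hC) := by
  classical
  have hcl := isClosed_setOfPred_isCompactOperator (σ₁₂ := RingHom.id ℂ) (M₁ := H) (M₂ := H)
  change diagOp b m C hm hC ∈ {f : H →L[ℂ] H | IsCompactOperator f}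
  rw [← hcl.closure_eq, Metric.mem_closure_iff]
  intro ε hε
  have hfin : {i | ε / 2 ≤ ‖m i‖}.Finite := by
    have := (Metric.tendsto_nhds.1 h0) (ε / 2) (half_pos hε)
    rw [Filter.eventually_cofinite] at this
    simpa using this
  set F := hfin.toFinset with hF
  set T : H →L[ℂ] H := ∑ i ∈ F, (innerSL ℂ (b i)).smulRight (m i • b i) with hT
  have hTc : T ∈ compactOperator (RingHom.id ℂ) H H := by
    refine Submodule.sum_mem _ fun i _ => ?_
    have h1 : IsCompactOperator (id : ℂ → ℂ) :=
      (isCompactOperator_id_iff_finiteDimensional (𝕜 := ℂ)).2 inferInstance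
    have h2 := (h1.comp_clm (innerSL ℂ (b i))).clm_comp
      (ContinuousLinearMap.toSpanSingleton ℂ (m i • b i))
    exact h2
  refine ⟨T, hTc, ?_⟩
  have hrepr : ∀ u i, b.repr (T u) i = if i ∈ F then m i * b.repr u i else 0 := by
    intro u i
    rw [b.repr_apply_apply, hT, _root_.sum_apply, inner_sum]
    simp only [ContinuousLinearMap.smulRight_apply, innerSL_apply_apply, inner_smul_right,
      orthonormal_iff_ite.1 b.orthonormal, b.repr_apply_apply]
    simp [mul_comm]
  have hdiff : diagOp b m C hm hC - T = diagOp b (fun i => if i ∈ F then 0 else m i) (ε / 2)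
      (fun i => by
        by_cases hi : i ∈ F
        · simpa [hi] using (half_pos hε).le
        · have : ¬ ε / 2 ≤ ‖m i‖ := by simpa [hF] using hi
          simpa [hi] using (not_le.1 this).le) (half_pos hε).le := by
    ext1 u
    refine ext_repr b fun i => ?_
    rw [_root_.sub_apply, map_sub, lp.coeFn_sub, Pi.sub_apply, hrepr, repr_diagOp,
      repr_diagOp]
    by_cases hi : i ∈ F <;> simp [hi]
  rw [dist_eq_norm, hdiff]
  exact (norm_diagOp_le _ _ _ _ _).trans_lt (half_lt_self hε)

end Diagonal

/-! ### Pointwise evaluation -/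

section Evaluation

variable {L : ℝ} {a : ℝ → ℝ} {M : ℕ}

/-- The sum of the expansion of `u` in the eigenfunctions of the magnetic derivative, as a
function defined at every point (with value zero where the series does not converge). -/
def repFun (hL : 0 < L) (ha : IntegrableOn a (Set.Ioc 0 L)) (u : L2Space L M) (x : ℝ) :
    EuclideanSpace ℂ (Fin M) :=
  ∑' i : ℤ × Fin M,
    ((modeBasis hL ha).repr u i * mode L a i.1 x) • EuclideanSpace.single i.2 (1 : ℂ)

theorem summable_repFun (hL : 0 < L) (ha : IntegrableOn a (Set.Ioc 0 L)) {u : L2Space L M}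
    (hu : Summable fun i => ‖(modeBasis hL ha).repr u i‖) (x : ℝ) :
    Summable fun i : ℤ × Fin M =>
      ((modeBasis hL ha).repr u i * mode L a i.1 x) • EuclideanSpace.single i.2 (1 : ℂ) := by
  refine Summable.of_norm ?_
  simp only [norm_smul, norm_mul, norm_mode, PiLp.norm_single, norm_one, mul_one]
  exact hu.mul_right _

/-- A vector of `L²` with absolutely summable coefficients agrees almost everywhere with the sum of
its expansion: the partial sums converge in `L²`, hence almost everywhere along a subsequence. -/
theorem repFun_ae_eq (hL : 0 < L) (ha : IntegrableOn a (Set.Ioc 0 L)) {u : L2Space L M}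
    (hu : Summable fun i => ‖(modeBasis hL ha).repr u i‖) :
    u =ᵐ[volume.restrict (Set.Ioc 0 L)] repFun hL ha u := by
  set b := modeBasis (M := M) hL ha with hb
  have hS : Filter.Tendsto (fun s : Finset (ℤ × Fin M) => ∑ i ∈ s, b.repr u i • b i) Filter.atTop
      (nhds u) := b.hasSum_repr u
  obtain ⟨ns, hns, hae⟩ := (tendstoInMeasure_of_tendsto_Lp hS).exists_seq_tendsto_ae'
  have hcoe : ∀ s : Finset (ℤ × Fin M), ⇑(∑ i ∈ s, b.repr u i • b i : L2Space L M)
      =ᵐ[volume.restrict (Set.Ioc 0 L)]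
      fun x => ∑ i ∈ s, (b.repr u i * mode L a i.1 x) • EuclideanSpace.single i.2 (1 : ℂ) := by
    intro s
    have h1 : ∀ᵐ x ∂volume.restrict (Set.Ioc 0 L), ∀ i ∈ s, (b.repr u i • b i : L2Space L M) x =
        (b.repr u i * mode L a i.1 x) • EuclideanSpace.single i.2 (1 : ℂ) := by
      rw [ae_all_iff]
      intro i
      filter_upwards [Lp.coeFn_smul (b.repr u i) (b i), coeFn_modeVec ha i] with x h1 h2 _
      rw [h1, Pi.smul_apply, hb, modeBasis_apply, h2, smul_smul]
    filter_upwards [Lp.coeFn_finsetSum s (fun i => (b.repr u i • b i : L2Space L M)), h1]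
      with x h2 h3
    rw [h2, Finset.sum_apply]
    exact Finset.sum_congr rfl h3
  filter_upwards [hae, ae_all_iff.2 fun n => hcoe (ns n)] with x h1 h2
  have h3 := (summable_repFun hL ha hu x).hasSum.comp hns
  refine tendsto_nhds_unique h1 (h3.congr fun n => ?_)
  rw [h2 n]
  rfl

theorem summable_multiplier {m : ℤ → ℝ} (hm : Summable fun n => m n ^ 2)
    (hL : 0 < L) (x : ℝ) (e : EuclideanSpace ℂ (Fin M)) :
    HasSum (fun i : ℤ × Fin M => ‖m i.1 * (starRingEnd ℂ) (mode L a i.1 x) * e i.2‖ ^ 2)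
      ((∑' n, m n ^ 2) / L * ‖e‖ ^ 2) := by
  have he : Summable fun j : Fin M => ‖e j‖ ^ 2 := Summable.of_finite
  have h1 : ∀ i : ℤ × Fin M, ‖m i.1 * (starRingEnd ℂ) (mode L a i.1 x) * e i.2‖ ^ 2 =
      1 / L * (m i.1 ^ 2 * ‖e i.2‖ ^ 2) := by
    intro i
    rw [norm_mul, norm_mul, mul_pow, mul_pow, RCLike.norm_conj, norm_mode_sq hL, Complex.norm_real,
      Real.norm_eq_abs, sq_abs]
    ring
  have hs : Summable fun i : ℤ × Fin M => m i.1 ^ 2 * ‖e i.2‖ ^ 2 :=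
    hm.mul_of_nonneg he (fun _ => by positivity) (fun _ => by positivity)
  simp_rw [h1]
  have h2 : (∑' n, m n ^ 2) / L * ‖e‖ ^ 2 =
      1 / L * ∑' i : ℤ × Fin M, m i.1 ^ 2 * ‖e i.2‖ ^ 2 := by
    rw [← hm.tsum_mul_tsum he hs, tsum_fintype (fun j : Fin M => ‖e j‖ ^ 2),
      ← EuclideanSpace.norm_sq_eq]
    ring
  rw [h2]
  exact hs.hasSum.mul_left (1 / L)

/-- The vector representing the functional `y ↦ ⟨e, (m(D) y)(x)⟩`, where `m(D)` multiplies the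
coefficients by `m`. -/
def evalVec (hL : 0 < L) (ha : IntegrableOn a (Set.Ioc 0 L)) {m : ℤ → ℝ}
    (hm : Summable fun n => m n ^ 2) (x : ℝ) (e : EuclideanSpace ℂ (Fin M)) : L2Space L M :=
  ofCoeff (modeBasis hL ha) (fun i => m i.1 * (starRingEnd ℂ) (mode L a i.1 x) * e i.2)
    (summable_multiplier hm hL x e).summable

theorem norm_evalVec_sq (hL : 0 < L) (ha : IntegrableOn a (Set.Ioc 0 L)) {m : ℤ → ℝ}
    (hm : Summable fun n => m n ^ 2) (x : ℝ) (e : EuclideanSpace ℂ (Fin M)) :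
    ‖evalVec hL ha hm x e‖ ^ 2 = (∑' n, m n ^ 2) / L * ‖e‖ ^ 2 := by
  refine (hasSum_norm_repr_sq (modeBasis hL ha) _).unique ?_
  convert summable_multiplier (a := a) hm hL x e using 3 with i
  simp [evalVec]

theorem summable_norm_repr_of_multiplier (hL : 0 < L) (ha : IntegrableOn a (Set.Ioc 0 L))
    {m : ℤ → ℝ} (hm : Summable fun n => m n ^ 2) {u y : L2Space L M}
    (hu : ∀ i, (modeBasis hL ha).repr u i = m i.1 * (modeBasis hL ha).repr y i) :
    Summable fun i => ‖(modeBasis hL ha).repr u i‖ := by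
  have h1 : Summable fun i : ℤ × Fin M => m i.1 ^ 2 * 1 :=
    hm.mul_of_nonneg (g := fun _ : Fin M => (1 : ℝ)) Summable.of_finite
      (fun _ => by positivity) (fun _ => by positivity)
  refine Summable.of_nonneg_of_le (fun i => norm_nonneg _) (fun i => ?_)
    (h1.add (summable_norm_repr_sq (modeBasis hL ha) y))
  rw [hu, norm_mul, Complex.norm_real, Real.norm_eq_abs, ← sq_abs (m i.1)]
  nlinarith [sq_nonneg (|m i.1| - ‖(modeBasis hL ha).repr y i‖), sq_nonneg (|m i.1|),
    sq_nonneg (‖(modeBasis hL ha).repr y i‖)]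

theorem inner_repFun (hL : 0 < L) (ha : IntegrableOn a (Set.Ioc 0 L))
    {m : ℤ → ℝ} (hm : Summable fun n => m n ^ 2) {u y : L2Space L M}
    (hu : ∀ i, (modeBasis hL ha).repr u i = m i.1 * (modeBasis hL ha).repr y i) (x : ℝ)
    (e : EuclideanSpace ℂ (Fin M)) :
    inner ℂ e (repFun hL ha u x) = inner ℂ (evalVec hL ha hm x e) y := by
  have h1 := (summable_repFun hL ha (summable_norm_repr_of_multiplier hL ha hm hu) x).hasSum.mapL
    (innerSL ℂ e)
  have h2 := hasSum_inner_repr (modeBasis hL ha) (evalVec hL ha hm x e) y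
  refine (h1.congr_fun fun i => ?_).unique h2
  rw [innerSL_apply_apply, inner_smul_right, EuclideanSpace.inner_single_right, hu, evalVec,
    repr_ofCoeff]
  simp
  ring

-- As for `modeBasis`, these are only used through the lemmas above.
attribute [irreducible] repFun evalVec

end Evaluation

/-! ### Hermitian matrices -/

section Hermitian

variable {M N : ℕ} {A : Matrix (Fin M) (Fin M) ℂ}

theorem trace_cfc (hA : A.IsHermitian) (f : ℝ → ℝ) :
    (cfc f A).trace = ∑ i, (f (hA.eigenvalues i) : ℂ) := by
  rw [hA.cfc_eq, Matrix.IsHermitian.cfc, Unitary.conjStarAlgAut_apply, Matrix.trace_mul_comm,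
    ← mul_assoc]
  simp [Matrix.trace_diagonal]

theorem traceThreeHalves_eq (hA : A.IsHermitian) :
    traceThreeHalves A = ∑ i, hA.eigenvalues i ^ (3 / 2 : ℝ) := by
  rw [traceThreeHalves, trace_cfc hA, Complex.re_sum]
  simp

theorem trace_pow_three (hA : A.IsHermitian) :
    (A ^ 3).trace.re = ∑ i, hA.eigenvalues i ^ 3 := by
  have h : cfc (fun x : ℝ => x ^ 3) A = A ^ 3 := cfc_pow_id A 3 hA.isSelfAdjoint
  rw [← h, trace_cfc hA, Complex.re_sum]
  simp only [Complex.ofReal_re]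

theorem trace_re_eq (hA : A.IsHermitian) : A.trace.re = ∑ i, hA.eigenvalues i := by
  rw [hA.trace_eq_sum_eigenvalues, Complex.re_sum]
  simp

theorem toEuclideanLin_eigenvectorBasis (hA : A.IsHermitian) (i : Fin M) :
    Matrix.toEuclideanLin A (hA.eigenvectorBasis i) =
      (hA.eigenvalues i : ℂ) • hA.eigenvectorBasis i := by
  ext j
  have := congrFun (hA.mulVec_eigenvectorBasis i) j
  simpa [Matrix.toLpLin_apply] using this

theorem inner_toEuclideanLin_eq_sum (hA : A.IsHermitian) (v u : EuclideanSpace ℂ (Fin M)) :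
    inner ℂ v (Matrix.toEuclideanLin A u) = ∑ i, (hA.eigenvalues i : ℂ) *
      (inner ℂ v (hA.eigenvectorBasis i) * inner ℂ (hA.eigenvectorBasis i) u) := by
  conv_lhs => rw [← hA.eigenvectorBasis.sum_repr' u]
  rw [map_sum, inner_sum]
  refine Finset.sum_congr rfl fun i _ => ?_
  rw [map_smul, toEuclideanLin_eigenvectorBasis, inner_smul_right, inner_smul_right]
  ring

theorem inner_toEuclideanLin_self (hA : A.IsHermitian) (u : EuclideanSpace ℂ (Fin M)) :
    inner ℂ u (Matrix.toEuclideanLin A u) =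
      ((∑ i, hA.eigenvalues i * ‖inner ℂ (hA.eigenvectorBasis i) u‖ ^ 2 : ℝ) : ℂ) := by
  rw [inner_toEuclideanLin_eq_sum hA]
  push_cast
  refine Finset.sum_congr rfl fun i _ => ?_
  rw [← inner_conj_symm u, Complex.conj_mul']

theorem inner_toEuclideanLin_comm (hA : A.IsHermitian) (v u : EuclideanSpace ℂ (Fin M)) :
    inner ℂ (Matrix.toEuclideanLin A v) u = inner ℂ v (Matrix.toEuclideanLin A u) :=
  (Matrix.isSymmetric_toEuclideanLin_iff.2 hA) v u

theorem norm_inner_toEuclideanLin_le (hA : A.PosSemidef) (v u : EuclideanSpace ℂ (Fin M)) :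
    ‖inner ℂ v (Matrix.toEuclideanLin A u)‖ ≤ A.trace.re * (‖v‖ * ‖u‖) := by
  rw [inner_toEuclideanLin_eq_sum hA.1, trace_re_eq hA.1, Finset.sum_mul]
  refine (norm_sum_le _ _).trans (Finset.sum_le_sum fun i _ => ?_)
  have h0 := hA.eigenvalues_nonneg i
  rw [norm_mul, Complex.norm_real, Real.norm_of_nonneg h0, norm_mul]
  gcongr
  · simpa using norm_inner_le_norm (𝕜 := ℂ) v (hA.1.eigenvectorBasis i)
  · simpa using norm_inner_le_norm (𝕜 := ℂ) (hA.1.eigenvectorBasis i) u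

theorem trace_re_nonneg (hA : A.PosSemidef) : 0 ≤ A.trace.re := by
  rw [trace_re_eq hA.1]
  exact Finset.sum_nonneg fun i _ => hA.eigenvalues_nonneg i

theorem trace_re_le (hA : A.PosSemidef) : A.trace.re ≤ M + traceThreeHalves A := by
  rw [trace_re_eq hA.1, traceThreeHalves_eq hA.1]
  have : (M : ℝ) = ∑ _i : Fin M, (1 : ℝ) := by simp
  rw [this, ← Finset.sum_add_distrib]
  refine Finset.sum_le_sum fun i _ => ?_
  have h0 := hA.eigenvalues_nonneg i
  rcases le_total (hA.1.eigenvalues i) 1 with h | h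
  · have : 0 ≤ hA.1.eigenvalues i ^ (3 / 2 : ℝ) := by positivity
    linarith
  · have := Real.rpow_le_rpow_of_exponent_le h (show (1 : ℝ) ≤ 3 / 2 by norm_num)
    rw [Real.rpow_one] at this
    linarith

theorem posSemidef_densityMatrix (ψ : Fin N → EuclideanSpace ℂ (Fin M)) :
    (densityMatrix ψ).PosSemidef :=
  Matrix.posSemidef_sum _ fun _ _ => Matrix.posSemidef_vecMulVec_self_star _

theorem toEuclideanLin_densityMatrix (ψ : Fin N → EuclideanSpace ℂ (Fin M))
    (v : EuclideanSpace ℂ (Fin M)) :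
    Matrix.toEuclideanLin (densityMatrix ψ) v = ∑ n, inner ℂ (ψ n) v • ψ n := by
  rw [densityMatrix, map_sum, LinearMap.sum_apply]
  refine Finset.sum_congr rfl fun n _ => ?_
  ext i
  simp [Matrix.toLpLin_apply, Matrix.vecMulVec_mulVec, EuclideanSpace.inner_eq_star_dotProduct,
    dotProduct_comm, mul_comm]

theorem inner_densityMatrix_self (ψ : Fin N → EuclideanSpace ℂ (Fin M))
    (v : EuclideanSpace ℂ (Fin M)) :
    inner ℂ v (Matrix.toEuclideanLin (densityMatrix ψ) v) =
      ((∑ n, ‖inner ℂ (ψ n) v‖ ^ 2 : ℝ) : ℂ) := by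
  rw [toEuclideanLin_densityMatrix, inner_sum]
  push_cast
  refine Finset.sum_congr rfl fun n _ => ?_
  rw [inner_smul_right, ← inner_conj_symm v, Complex.mul_conj']

theorem eigenvalues_densityMatrix (ψ : Fin N → EuclideanSpace ℂ (Fin M)) (i : Fin M) :
    (posSemidef_densityMatrix ψ).1.eigenvalues i =
      ∑ n, ‖inner ℂ (ψ n) ((posSemidef_densityMatrix ψ).1.eigenvectorBasis i)‖ ^ 2 := by
  have h := inner_densityMatrix_self ψ ((posSemidef_densityMatrix ψ).1.eigenvectorBasis i)
  rw [toEuclideanLin_eigenvectorBasis, inner_smul_right, inner_self_eq_norm_sq_to_K,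
    OrthonormalBasis.norm_eq_one] at h
  simp only [RCLike.ofReal_one, one_pow, mul_one] at h
  exact_mod_cast h

theorem sum_normSq_inner_eq_one {b : OrthonormalBasis (Fin M) ℂ (EuclideanSpace ℂ (Fin M))}
    {v : EuclideanSpace ℂ (Fin M)} (hv : ‖v‖ = 1) : ∑ i, ‖inner ℂ (b i) v‖ ^ 2 = 1 := by
  rw [b.sum_sq_norm_inner_right, hv, one_pow]

/-- The scalar Young inequality behind the passage from the inequality for orthonormal systems to
the bound for eigenvalues. -/
theorem mul_le_cube_div_add {u v C : ℝ} (hu : 0 ≤ u) (hv : 0 ≤ v) (hC : 0 < C) :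
    v * u ≤ u ^ 3 / C + 2 / (3 * √3) * √C * v ^ (3 / 2 : ℝ) := by
  have h3 : 0 < √(3 : ℝ) := by positivity
  have hC' : 0 < √C := Real.sqrt_pos.2 hC
  -- substitute `u = √C t` and `v = 3 r²`; the claim becomes `0 ≤ (t - r)² (t + 2 r)`
  obtain ⟨t, ht⟩ : ∃ t, u = √C * t := ⟨u / √C, by field_simp⟩
  obtain ⟨r, hr0, hr⟩ : ∃ r, 0 ≤ r ∧ √v = √3 * r :=
    ⟨√v / √3, by positivity, by field_simp⟩
  have ht0 : 0 ≤ t := by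
    rw [ht] at hu
    exact nonneg_of_mul_nonneg_right hu hC'
  have hv1 : v = 3 * r ^ 2 := by
    rw [← Real.sq_sqrt hv, hr, mul_pow, Real.sq_sqrt (by norm_num)]
  have hv2 : v ^ (3 / 2 : ℝ) = 3 * √3 * r ^ 3 := by
    rw [show (3 / 2 : ℝ) = (1 / 2) * (3 : ℕ) by norm_num, Real.rpow_mul hv, ← Real.sqrt_eq_rpow,
      Real.rpow_natCast, hr, mul_pow]
    have : √(3 : ℝ) ^ 3 = 3 * √3 := by
      rw [pow_succ, Real.sq_sqrt (by norm_num)]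
    rw [this]
  have hu3 : u ^ 3 / C = √C * t ^ 3 := by
    rw [ht, mul_pow, pow_succ (√C), Real.sq_sqrt hC.le]
    field_simp
  rw [hv2, hu3, hv1, ht]
  have e : 2 / (3 * √3) * √C * (3 * √3 * r ^ 3) = √C * (2 * r ^ 3) := by
    field_simp
  rw [e]
  have h : 0 ≤ (t - r) ^ 2 * (t + 2 * r) := by positivity
  nlinarith [mul_nonneg hC'.le h]

/-- `Tr (V U) ≤ Tr U³ / C + 2 / (3√3) √C Tr V^{3/2}`: expand the trace in the eigenbases of `U`
and `V` and use the scalar inequality for each pair of eigenvalues. -/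
theorem sum_inner_toEuclideanLin_le (hA : A.PosSemidef) (ψ : Fin N → EuclideanSpace ℂ (Fin M))
    {C : ℝ} (hC : 0 < C) :
    ∑ n, (inner ℂ (ψ n) (Matrix.toEuclideanLin A (ψ n))).re ≤
      (densityMatrix ψ ^ 3).trace.re / C + 2 / (3 * √3) * √C * traceThreeHalves A := by
  have hU := posSemidef_densityMatrix ψ
  set e := hA.1.eigenvectorBasis with he
  set f := hU.1.eigenvectorBasis with hf
  have h1 : ∀ j, ∑ n, ‖inner ℂ (e j) (ψ n)‖ ^ 2 =
      ∑ i, hU.1.eigenvalues i * ‖inner ℂ (f i) (e j)‖ ^ 2 := by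
    intro j
    have h2 := inner_densityMatrix_self ψ (e j)
    rw [inner_toEuclideanLin_self hU.1] at h2
    have h3 : ∑ i, hU.1.eigenvalues i * ‖inner ℂ (f i) (e j)‖ ^ 2 =
        ∑ n, ‖inner ℂ (ψ n) (e j)‖ ^ 2 := by exact_mod_cast h2
    rw [h3]
    simp_rw [norm_inner_symm (e j)]
  have h4 : ∑ n, (inner ℂ (ψ n) (Matrix.toEuclideanLin A (ψ n))).re =
      ∑ j, ∑ i, (hA.1.eigenvalues j * hU.1.eigenvalues i) * ‖inner ℂ (f i) (e j)‖ ^ 2 := by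
    simp_rw [inner_toEuclideanLin_self hA.1, Complex.ofReal_re]
    rw [Finset.sum_comm]
    refine Finset.sum_congr rfl fun j _ => ?_
    rw [← Finset.mul_sum, h1, Finset.mul_sum]
    exact Finset.sum_congr rfl fun i _ => by ring
  have h5 : (densityMatrix ψ ^ 3).trace.re / C + 2 / (3 * √3) * √C * traceThreeHalves A =
      ∑ j, ∑ i, (hU.1.eigenvalues i ^ 3 / C +
        2 / (3 * √3) * √C * hA.1.eigenvalues j ^ (3 / 2 : ℝ)) * ‖inner ℂ (f i) (e j)‖ ^ 2 := by
    simp_rw [add_mul, Finset.sum_add_distrib]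
    congr 1
    · rw [Finset.sum_comm, trace_pow_three hU.1, Finset.sum_div]
      refine Finset.sum_congr rfl fun i _ => ?_
      rw [← Finset.mul_sum]
      simp_rw [norm_inner_symm (f i)]
      rw [sum_normSq_inner_eq_one (f.norm_eq_one i), mul_one]
    · rw [traceThreeHalves_eq hA.1, Finset.mul_sum]
      refine Finset.sum_congr rfl fun j _ => ?_
      rw [← Finset.mul_sum, sum_normSq_inner_eq_one (e.norm_eq_one j), mul_one]
  rw [h4, h5]
  refine Finset.sum_le_sum fun j _ => Finset.sum_le_sum fun i _ => ?_
  gcongr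
  exact mul_le_cube_div_add (hU.eigenvalues_nonneg i) (hA.eigenvalues_nonneg j) hC

end Hermitian

/-! ### The magnetic interpolation inequality and the bound `K ≤ K₁` -/

section Interpolation

variable {L : ℝ} {a : ℝ → ℝ} {M N : ℕ}

theorem norm_sq_eq_tsum_of_mem_magDeriv (hL : 0 < L) (ha : IntegrableOn a (Set.Ioc 0 L))
    {u g : L2Space L M} (h : (u, g) ∈ magDeriv L a M) :
    HasSum (fun i => freq L a i.1 ^ 2 * ‖(modeBasis hL ha).repr u i‖ ^ 2) (‖g‖ ^ 2) := by
  have h1 := hasSum_norm_repr_sq (modeBasis hL ha) g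
  simp_rw [repr_of_mem_magDeriv hL ha h, norm_mul, norm_neg, Complex.norm_real, Real.norm_eq_abs,
    mul_pow, sq_abs] at h1
  exact h1

/-- For `u` in the domain of `D = i d/dx - a` and `s > 0`, the function `u` is
`(D² + s²)^{-1/2} y` with `‖y‖² = ‖D u‖² + s² ‖u‖²`. -/
theorem exists_sqrt_resolvent (hL : 0 < L) (ha : IntegrableOn a (Set.Ioc 0 L))
    {u g : L2Space L M} (h : (u, g) ∈ magDeriv L a M) {s : ℝ} (hs : 0 < s) :
    ∃ y : L2Space L M, ‖y‖ ^ 2 = ‖g‖ ^ 2 + s ^ 2 * ‖u‖ ^ 2 ∧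
      ∀ i, (modeBasis hL ha).repr u i =
        ((√(freq L a i.1 ^ 2 + s ^ 2))⁻¹ : ℝ) * (modeBasis hL ha).repr y i := by
  have h1 := (norm_sq_eq_tsum_of_mem_magDeriv hL ha h).add
    ((hasSum_norm_repr_sq (modeBasis hL ha) u).mul_left (s ^ 2))
  have h2 : ∀ i, ‖((√(freq L a i.1 ^ 2 + s ^ 2) : ℝ) : ℂ) * (modeBasis hL ha).repr u i‖ ^ 2 =
      freq L a i.1 ^ 2 * ‖(modeBasis hL ha).repr u i‖ ^ 2 +
        s ^ 2 * ‖(modeBasis hL ha).repr u i‖ ^ 2 := by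
    intro i
    rw [norm_mul, Complex.norm_real, mul_pow, Real.norm_eq_abs, sq_abs,
      Real.sq_sqrt (by positivity), add_mul]
  refine ⟨ofCoeff (modeBasis hL ha) (fun i => ((√(freq L a i.1 ^ 2 + s ^ 2) : ℝ) : ℂ) *
    (modeBasis hL ha).repr u i) (by simp_rw [h2]; exact h1.summable), ?_, ?_⟩
  · refine (hasSum_norm_repr_sq (modeBasis hL ha) _).unique ?_
    simp_rw [repr_ofCoeff, h2]
    exact h1
  · intro i
    have : (√(freq L a i.1 ^ 2 + s ^ 2)) ≠ 0 := (Real.sqrt_pos.2 (by positivity)).ne'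
    rw [repr_ofCoeff, ← mul_assoc, ← Complex.ofReal_mul, inv_mul_cancel₀ this, Complex.ofReal_one,
      one_mul]

theorem inv_sqrt_sq_eq (s : ℝ) (n : ℤ) :
    (√(freq L a n ^ 2 + s ^ 2))⁻¹ ^ 2 = 1 / (freq L a n ^ 2 + s ^ 2) := by
  rw [inv_pow, Real.sq_sqrt (by positivity), one_div]

theorem summable_inv_sqrt_sq (hL : 0 < L) (hflux : ∀ j : ℤ, flux L a ≠ j) {s : ℝ} (hs : 0 < s) :
    Summable fun n : ℤ => (√(freq L a n ^ 2 + s ^ 2))⁻¹ ^ 2 := by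
  simp_rw [inv_sqrt_sq_eq]
  exact (tsum_one_div_freq_sq_add_sq hL hflux hs).1

theorem summable_norm_repr_of_mem_magDeriv (hL : 0 < L) (ha : IntegrableOn a (Set.Ioc 0 L))
    (hflux : ∀ j : ℤ, flux L a ≠ j) {u g : L2Space L M} (h : (u, g) ∈ magDeriv L a M) :
    Summable fun i => ‖(modeBasis hL ha).repr u i‖ := by
  obtain ⟨y, _, hy⟩ := exists_sqrt_resolvent hL ha h one_pos
  exact summable_norm_repr_of_multiplier hL ha (summable_inv_sqrt_sq hL hflux one_pos) hy

/-- The pointwise bound by the diagonal of the Green function of `D² + s²`. -/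
theorem norm_inner_repFun_sq_le (hL : 0 < L) (ha : IntegrableOn a (Set.Ioc 0 L))
    (hflux : ∀ j : ℤ, flux L a ≠ j) {u g : L2Space L M} (h : (u, g) ∈ magDeriv L a M)
    {s : ℝ} (hs : 0 < s) (x : ℝ) (e : EuclideanSpace ℂ (Fin M)) :
    ‖inner ℂ e (repFun hL ha u x)‖ ^ 2 ≤
      k (flux L a) / (2 * s) * ‖e‖ ^ 2 * (‖g‖ ^ 2 + s ^ 2 * ‖u‖ ^ 2) := by
  obtain ⟨y, hyn, hy⟩ := exists_sqrt_resolvent hL ha h hs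
  have hm := summable_inv_sqrt_sq hL hflux hs
  rw [inner_repFun hL ha hm hy, ← hyn]
  have h1 := norm_inner_le_norm (𝕜 := ℂ) (evalVec hL ha hm x e) y
  calc _ ≤ (‖evalVec hL ha hm x e‖ * ‖y‖) ^ 2 := by gcongr
    _ = (∑' n, (√(freq L a n ^ 2 + s ^ 2))⁻¹ ^ 2) / L * ‖e‖ ^ 2 * ‖y‖ ^ 2 := by
        rw [mul_pow, norm_evalVec_sq]
    _ ≤ _ := by
        have h2 := (tsum_one_div_freq_sq_add_sq hL hflux hs).2
        rw [← tsum_congr (inv_sqrt_sq_eq s)] at h2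
        exact mul_le_mul_of_nonneg_right
          (mul_le_mul_of_nonneg_right h2 (by positivity)) (by positivity)

theorem norm_repFun_sq_le (hL : 0 < L) (ha : IntegrableOn a (Set.Ioc 0 L))
    (hflux : ∀ j : ℤ, flux L a ≠ j) {u g : L2Space L M} (h : (u, g) ∈ magDeriv L a M)
    {s : ℝ} (hs : 0 < s) (x : ℝ) :
    ‖repFun hL ha u x‖ ^ 2 ≤ k (flux L a) / (2 * s) * (‖g‖ ^ 2 + s ^ 2 * ‖u‖ ^ 2) := by
  have h1 := norm_inner_repFun_sq_le hL ha hflux h hs x (repFun hL ha u x)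
  rw [inner_self_eq_norm_sq_to_K] at h1
  rcases eq_or_ne (‖repFun hL ha u x‖) 0 with h0 | h0
  · have := k_nonneg (flux L a)
    rw [h0, zero_pow two_ne_zero]
    positivity
  · have h2 : 0 < ‖repFun hL ha u x‖ ^ 2 := by positivity
    simp only [Complex.coe_algebraMap, norm_pow, Complex.norm_real, norm_norm] at h1
    refine le_of_mul_le_mul_left ?_ h2
    linarith

theorem repFun_sum_smul (hL : 0 < L) (ha : IntegrableOn a (Set.Ioc 0 L)) {ψ : Fin N → L2Space L M}
    (hψ : ∀ n, Summable fun i => ‖(modeBasis hL ha).repr (ψ n) i‖) (ξ : Fin N → ℂ) (x : ℝ) :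
    repFun hL ha (∑ n, ξ n • ψ n) x = ∑ n, ξ n • repFun hL ha (ψ n) x := by
  have h := hasSum_sum (s := Finset.univ)
    fun n _ => (summable_repFun hL ha (hψ n) x).hasSum.const_smul (ξ n)
  simp only [repFun]
  refine Eq.trans (tsum_congr fun i => ?_) h.tsum_eq
  have : (modeBasis hL ha).repr (∑ n, ξ n • ψ n) i =
      ∑ n, ξ n * (modeBasis hL ha).repr (ψ n) i := by
    simp only [HilbertBasis.repr_apply_apply, inner_sum, inner_smul_right]
  rw [this, Finset.sum_mul, Finset.sum_smul]
  exact Finset.sum_congr rfl fun n _ => by rw [smul_smul, mul_assoc]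

theorem norm_sum_smul_sq {H : Type*} [NormedAddCommGroup H] [InnerProductSpace ℂ H]
    {ψ : Fin N → H} (hψ : Orthonormal ℂ ψ) (ξ : Fin N → ℂ) :
    ‖∑ n, ξ n • ψ n‖ ^ 2 = ∑ n, ‖ξ n‖ ^ 2 := by
  have h := hψ.inner_sum ξ ξ Finset.univ
  rw [inner_self_eq_norm_sq_to_K] at h
  simp only [Complex.conj_mul'] at h
  rw [← Complex.ofReal_inj]
  push_cast
  exact h

/-- The pointwise form of the Lieb–Thirring inequality with constant `K₁`: apply the interpolation
inequality to `∑ₙ ⟨ψₙ(x), e⟩ ψₙ` for the eigenvectors `e` of `U(x)`. -/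
theorem trace_density_cube_le (hL : 0 < L) (ha : IntegrableOn a (Set.Ioc 0 L))
    (hflux : ∀ j : ℤ, flux L a ≠ j) {ψ Dψ : Fin N → L2Space L M} (hψ : Orthonormal ℂ ψ)
    (hD : ∀ n, (ψ n, Dψ n) ∈ magDeriv L a M) (x : ℝ) :
    ((densityMatrix fun n => repFun hL ha (ψ n) x) ^ 3).trace.re ≤
      K₁ (flux L a) * (∑ n, ∑ m, inner ℂ (repFun hL ha (ψ m) x) (repFun hL ha (ψ n) x) *
        inner ℂ (Dψ n) (Dψ m)).re := by
  set φ := fun n => repFun hL ha (ψ n) x with hφ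
  have hU := posSemidef_densityMatrix φ
  set e := hU.1.eigenvectorBasis with he
  have hk := k_pos hflux
  have key : ∀ i, hU.1.eigenvalues i ^ 3 ≤
      K₁ (flux L a) * ‖∑ n, inner ℂ (φ n) (e i) • Dψ n‖ ^ 2 := by
    intro i
    set μ := hU.1.eigenvalues i with hμ
    have hμ0 : 0 ≤ μ := hU.eigenvalues_nonneg i
    rcases hμ0.eq_or_lt with h0 | hpos
    · rw [← h0, zero_pow three_ne_zero]
      have : 0 ≤ K₁ (flux L a) := by
        rw [K₁]
        positivity
      positivity
    set ξ : Fin N → ℂ := fun n => inner ℂ (φ n) (e i) with hξ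
    have hmem : (∑ n, ξ n • ψ n, ∑ n, ξ n • Dψ n) ∈ magDeriv L a M := by
      have := Submodule.sum_mem (magDeriv L a M) (t := Finset.univ)
        (f := fun n => ξ n • (ψ n, Dψ n)) fun n _ => Submodule.smul_mem _ _ (hD n)
      have e : ∑ n, ξ n • (ψ n, Dψ n) = (∑ n, ξ n • ψ n, ∑ n, ξ n • Dψ n) :=
        Prod.ext (by simp [Prod.fst_sum]) (by simp [Prod.snd_sum])
      rwa [e] at this
    have h1 := norm_inner_repFun_sq_le hL ha hflux hmem (div_pos hpos hk) x (e i)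
    have h2 : repFun hL ha (∑ n, ξ n • ψ n) x = (μ : ℂ) • e i := by
      rw [repFun_sum_smul hL ha
        (fun n => summable_norm_repr_of_mem_magDeriv hL ha hflux (hD n)), hμ, he,
        ← toEuclideanLin_eigenvectorBasis, toEuclideanLin_densityMatrix]
    have h3 : ‖∑ n, ξ n • ψ n‖ ^ 2 = μ := by
      rw [norm_sum_smul_sq hψ, hμ, eigenvalues_densityMatrix φ i]
    rw [h2, h3, inner_smul_right, inner_self_eq_norm_sq_to_K, OrthonormalBasis.norm_eq_one] at h1
    simp only [RCLike.ofReal_one, one_pow, mul_one, Complex.norm_real, Real.norm_eq_abs,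
      sq_abs] at h1
    set X := ‖∑ n, ξ n • Dψ n‖ ^ 2 with hX
    have h4 : k (flux L a) / (2 * (μ / k (flux L a))) * (X + (μ / k (flux L a)) ^ 2 * μ) =
        k (flux L a) ^ 2 * X / (2 * μ) + μ ^ 2 / 2 := by
      field_simp
    rw [h4] at h1
    have h5 : μ ^ 2 / 2 ≤ k (flux L a) ^ 2 * X / (2 * μ) := by linarith
    rw [le_div_iff₀ (by positivity)] at h5
    rw [K₁]
    linarith
  have hsum : ∑ i, ‖∑ n, inner ℂ (φ n) (e i) • Dψ n‖ ^ 2 =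
      (∑ n, ∑ m, inner ℂ (φ m) (φ n) * inner ℂ (Dψ n) (Dψ m)).re := by
    have h1 : ∀ i, ((‖∑ n, inner ℂ (φ n) (e i) • Dψ n‖ ^ 2 : ℝ) : ℂ) =
        ∑ n, ∑ m, (inner ℂ (φ m) (e i) * inner ℂ (e i) (φ n)) * inner ℂ (Dψ n) (Dψ m) := by
      intro i
      have := inner_self_eq_norm_sq_to_K (𝕜 := ℂ) (∑ n, inner ℂ (φ n) (e i) • Dψ n)
      rw [sum_inner] at this
      push_cast
      rw [← Complex.coe_algebraMap, ← this]
      refine Finset.sum_congr rfl fun n _ => ?_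
      rw [inner_sum]
      refine Finset.sum_congr rfl fun m _ => ?_
      rw [inner_smul_left, inner_smul_right, inner_conj_symm]
      ring
    rw [← Complex.ofReal_re (∑ i, ‖∑ n, inner ℂ (φ n) (e i) • Dψ n‖ ^ 2), Complex.ofReal_sum]
    simp_rw [h1]
    rw [Finset.sum_comm]
    congr 1
    refine Finset.sum_congr rfl fun n _ => ?_
    rw [Finset.sum_comm]
    refine Finset.sum_congr rfl fun m _ => ?_
    rw [← Finset.sum_mul, e.sum_inner_mul_inner]
  rw [trace_pow_three hU.1, ← hsum, Finset.mul_sum]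
  exact Finset.sum_le_sum fun i _ => key i

theorem trace_densityMatrix_cube_nonneg (φ : Fin N → EuclideanSpace ℂ (Fin M)) :
    0 ≤ (densityMatrix φ ^ 3).trace.re := by
  rw [trace_pow_three (posSemidef_densityMatrix φ).1]
  exact Finset.sum_nonneg fun i _ =>
    pow_nonneg ((posSemidef_densityMatrix φ).eigenvalues_nonneg i) 3

theorem ae_eq_repFun (hL : 0 < L) (ha : IntegrableOn a (Set.Ioc 0 L))
    (hflux : ∀ j : ℤ, flux L a ≠ j) {ψ Dψ : Fin N → L2Space L M}
    (hD : ∀ n, (ψ n, Dψ n) ∈ magDeriv L a M) :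
    ∀ᵐ x ∂volume.restrict (Set.Ioc 0 L), ∀ n, ψ n x = repFun hL ha (ψ n) x :=
  ae_all_iff.2 fun n =>
    repFun_ae_eq hL ha (summable_norm_repr_of_mem_magDeriv hL ha hflux (hD n))

theorem isLiebThirringConst_K₁ {α : ℝ} (hα : ∀ j : ℤ, α ≠ j) : IsLiebThirringConst α (K₁ α) := by
  refine ⟨by rw [K₁]; positivity, ?_⟩
  rintro L a hL ha rfl M N ψ Dψ hψ hD
  have hint : ∀ n m, Integrable (fun x => inner ℂ (ψ m x) (ψ n x) * inner ℂ (Dψ n) (Dψ m))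
      (volume.restrict (Set.Ioc 0 L)) := fun n m => (L2.integrable_inner (ψ m) (ψ n)).mul_const _
  have hint2 : ∀ n, Integrable (fun x => ∑ m, inner ℂ (ψ m x) (ψ n x) * inner ℂ (Dψ n) (Dψ m))
      (volume.restrict (Set.Ioc 0 L)) := fun n => integrable_finsetSum _ fun m _ => hint n m
  have hint3 : Integrable (fun x => ∑ n, ∑ m, inner ℂ (ψ m x) (ψ n x) * inner ℂ (Dψ n) (Dψ m))
      (volume.restrict (Set.Ioc 0 L)) := integrable_finsetSum _ fun n _ => hint2 n
  have hle : ∫ x in Set.Ioc 0 L, ((densityMatrix fun n => ψ n x) ^ 3).trace.re ≤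
      ∫ x in Set.Ioc 0 L, K₁ (flux L a) *
        (∑ n, ∑ m, inner ℂ (ψ m x) (ψ n x) * inner ℂ (Dψ n) (Dψ m)).re := by
    refine integral_mono_of_nonneg ?_ (hint3.re.const_mul _) ?_
    · exact Filter.Eventually.of_forall fun x => trace_densityMatrix_cube_nonneg _
    · filter_upwards [ae_eq_repFun hL ha hα hD] with x hx
      simp_rw [hx]
      exact trace_density_cube_le hL ha hα hψ hD x
  refine hle.trans (le_of_eq ?_)
  rw [integral_const_mul]
  congr 1
  have h1 := integral_re hint3
  simp only [RCLike.re_to_complex] at h1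
  rw [h1, integral_finsetSum _ fun n _ => hint2 n]
  simp_rw [integral_finsetSum _ fun m _ => hint _ m, integral_mul_const, ← L2.inner_def,
    orthonormal_iff_ite.1 hψ]
  simp only [ite_mul, one_mul, zero_mul, Finset.sum_ite_eq', Finset.mem_univ,
    if_true, Complex.re_sum]
  refine Finset.sum_congr rfl fun n _ => ?_
  rw [inner_self_eq_norm_sq_to_K]
  norm_cast

end Interpolation

/-! ### Two integrals -/

/-- An antiderivative of `2 t / (1 + t³)²` on `[0, ∞)`. -/
def cubePrimitive (t : ℝ) : ℝ :=
  2 / 3 * (t ^ 2 / (1 + t ^ 3) + 1 / 6 * Real.log ((t ^ 2 - t + 1) / (1 + t) ^ 2) +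
    1 / √3 * Real.arctan ((2 * t - 1) / √3))

theorem hasDerivAt_cubePrimitive {t : ℝ} (ht : 0 ≤ t) :
    HasDerivAt cubePrimitive (2 * t / (1 + t ^ 3) ^ 2) t := by
  have h1 : 0 < 1 + t ^ 3 := by positivity
  have h2 : 0 < t ^ 2 - t + 1 := by nlinarith [sq_nonneg (t - 1)]
  have h3 : 0 < 1 + t := by positivity
  have h4 : √(3 : ℝ) ^ 2 = 3 := Real.sq_sqrt (by norm_num)
  have h5 : √(3 : ℝ) ≠ 0 := by positivity
  have d1 : HasDerivAt (fun t : ℝ => t ^ 2 / (1 + t ^ 3))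
      ((2 * t * (1 + t ^ 3) - t ^ 2 * (3 * t ^ 2)) / (1 + t ^ 3) ^ 2) t := by
    refine ((hasDerivAt_pow 2 t).fun_div ((hasDerivAt_pow 3 t).const_add 1) h1.ne').congr_deriv ?_
    norm_num
  have d2 : HasDerivAt (fun t : ℝ => Real.log ((t ^ 2 - t + 1) / (1 + t) ^ 2))
      (((2 * t - 1) * (1 + t) ^ 2 - (t ^ 2 - t + 1) * (2 * (1 + t))) / ((1 + t) ^ 2) ^ 2 /
        ((t ^ 2 - t + 1) / (1 + t) ^ 2)) t := by
    have e1 : HasDerivAt (fun t : ℝ => t ^ 2 - t + 1) (2 * t - 1) t := by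
      refine (((hasDerivAt_pow 2 t).fun_sub (hasDerivAt_id' t)).add_const 1).congr_deriv ?_
      norm_num
    have e2 : HasDerivAt (fun t : ℝ => (1 + t) ^ 2) (2 * (1 + t)) t := by
      refine (((hasDerivAt_id' t).const_add 1).fun_pow 2).congr_deriv ?_
      norm_num
    exact (e1.fun_div e2 (by positivity)).log (by positivity)
  have d3 : HasDerivAt (fun t : ℝ => Real.arctan ((2 * t - 1) / √3))
      (1 / (1 + ((2 * t - 1) / √3) ^ 2) * (2 / √3)) t := by
    have e1 : HasDerivAt (fun t : ℝ => (2 * t - 1) / √3) (2 / √3) t := by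
      refine ((((hasDerivAt_id' t).const_mul 2).sub_const 1).div_const √3).congr_deriv ?_
      norm_num
    exact e1.arctan
  refine (((d1.fun_add (d2.const_mul (1 / 6))).fun_add
    (d3.const_mul (1 / √3))).const_mul (2 / 3)).congr_deriv ?_
  have h6 : 1 + t ^ 3 = (1 + t) * (t ^ 2 - t + 1) := by ring
  have h7 : 1 / √3 * (1 / (1 + ((2 * t - 1) / √3) ^ 2) * (2 / √3)) =
      1 / (2 * (t ^ 2 - t + 1)) := by
    have : 1 + ((2 * t - 1) / √3) ^ 2 = 4 / 3 * (t ^ 2 - t + 1) := by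
      rw [div_pow, h4]
      ring
    rw [this]
    field_simp
    rw [h4]
    ring
  rw [h7, h6]
  field_simp
  ring

theorem tendsto_cubePrimitive :
    Filter.Tendsto cubePrimitive Filter.atTop (nhds (2 / 3 * (1 / √3 * (Real.pi / 2)))) := by
  have hinv : Filter.Tendsto (fun t : ℝ => t⁻¹) Filter.atTop (nhds 0) := tendsto_inv_atTop_zero
  have h1 : Filter.Tendsto (fun t : ℝ => t ^ 2 / (1 + t ^ 3)) Filter.atTop (nhds 0) := by
    refine squeeze_zero' ?_ ?_ hinv
    · filter_upwards [Filter.eventually_gt_atTop 0] with t ht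
      positivity
    · filter_upwards [Filter.eventually_gt_atTop 0] with t ht
      rw [inv_eq_one_div, div_le_div_iff₀ (by positivity) ht]
      linarith
  have h2 : Filter.Tendsto (fun t : ℝ => (t ^ 2 - t + 1) / (1 + t) ^ 2) Filter.atTop (nhds 1) := by
    have h3 : Filter.Tendsto (fun t : ℝ => 3 * t / (1 + t) ^ 2) Filter.atTop (nhds 0) := by
      refine squeeze_zero' ?_ ?_ (by simpa using hinv.const_mul 3)
      · filter_upwards [Filter.eventually_gt_atTop 0] with t ht
        positivity
      · filter_upwards [Filter.eventually_gt_atTop 0] with t ht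
        rw [← div_eq_mul_inv, div_le_div_iff₀ (by positivity) ht]
        nlinarith
    have h4 := h3.const_sub 1
    rw [sub_zero] at h4
    refine h4.congr' ?_
    filter_upwards [Filter.eventually_gt_atTop 0] with t ht
    field_simp
    ring
  have h3 := h2.log one_ne_zero
  rw [Real.log_one] at h3
  have h4 : Filter.Tendsto (fun t : ℝ => (2 * t - 1) / √3) Filter.atTop Filter.atTop := by
    refine Filter.Tendsto.atTop_div_const (by positivity) ?_
    exact Filter.tendsto_atTop_add_const_right _ _ (Filter.tendsto_id.const_mul_atTop two_pos)
  have h5 := (Real.tendsto_arctan_atTop.mono_right nhdsWithin_le_nhds).comp h4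
  have := ((h1.add (h3.const_mul (1 / 6))).add (h5.const_mul (1 / √3))).const_mul (2 / 3)
  rw [mul_zero, add_zero, zero_add] at this
  exact this

theorem cubePrimitive_zero : cubePrimitive 0 = -(2 / 3 * (1 / √3 * (Real.pi / 6))) := by
  have h : Real.arctan ((√3)⁻¹) = Real.pi / 6 := Real.arctan_inv_sqrt_three
  have : ((2 : ℝ) * 0 - 1) / √3 = -(√3)⁻¹ := by
    rw [mul_zero, zero_sub, neg_div, one_div]
  rw [cubePrimitive, this, Real.arctan_neg, h]
  simp

/-- `∫₀^∞ (p³ / (p³ + s³))² 2s ds = 4π / (9√3) p²`. -/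
theorem lintegral_cube_multiplier {p : ℝ} (hp : 0 < p) :
    ∫⁻ s in Set.Ioi (0 : ℝ), ENNReal.ofReal (2 * s * (p ^ 3 / (p ^ 3 + |s| ^ 3)) ^ 2) =
      ENNReal.ofReal (4 * Real.pi / (9 * √3) * p ^ 2) := by
  have hd : ∀ s : ℝ, 0 ≤ s → HasDerivAt (fun s => p ^ 2 * cubePrimitive (s / p))
      (2 * s * (p ^ 3 / (p ^ 3 + |s| ^ 3)) ^ 2) s := by
    intro s hs
    have h1 := (hasDerivAt_cubePrimitive (div_nonneg hs hp.le))
    have h2 := HasDerivAt.comp (h := fun s => s / p) s h1 ((hasDerivAt_id' s).div_const p)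
    refine (h2.const_mul (p ^ 2)).congr_deriv ?_
    have : 0 < p ^ 3 + s ^ 3 := by positivity
    rw [abs_of_nonneg hs]
    field_simp
  have hlim : Filter.Tendsto (fun s => p ^ 2 * cubePrimitive (s / p)) Filter.atTop
      (nhds (p ^ 2 * (2 / 3 * (1 / √3 * (Real.pi / 2))))) :=
    (tendsto_cubePrimitive.comp (Filter.tendsto_id.atTop_div_const hp)).const_mul _
  have hc : ContinuousWithinAt (fun s => p ^ 2 * cubePrimitive (s / p)) (Set.Ici 0) 0 :=
    (hd 0 le_rfl).continuousAt.continuousWithinAt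
  have hnn : ∀ s ∈ Set.Ioi (0 : ℝ), 0 ≤ 2 * s * (p ^ 3 / (p ^ 3 + |s| ^ 3)) ^ 2 := by
    intro s hs
    have : (0 : ℝ) < s := hs
    positivity
  have hi := integrableOn_Ioi_deriv_of_nonneg hc (fun s hs => hd s (le_of_lt hs)) hnn hlim
  have hv := integral_Ioi_of_hasDerivAt_of_nonneg hc (fun s hs => hd s (le_of_lt hs)) hnn hlim
  rw [← ofReal_integral_eq_lintegral_ofReal hi
    ((ae_restrict_mem measurableSet_Ioi).mono fun s hs => hnn s hs), hv, zero_div,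
    cubePrimitive_zero]
  congr 1
  field_simp
  ring

/-- `∫₀^{μ/A} (√μ - √(A s))² 2s ds = μ³ / (15 A²)`. -/
theorem lintegral_sqrt_sub_sqrt {μ A : ℝ} (hμ : 0 ≤ μ) (hA : 0 < A) :
    ∫⁻ s in Set.Ioc 0 (μ / A), ENNReal.ofReal (2 * s * (√μ - √(A * s)) ^ 2) =
      ENNReal.ofReal (μ ^ 3 / (15 * A ^ 2)) := by
  have hle : 0 ≤ μ / A := by positivity
  have hcont : Continuous fun s : ℝ => 2 * s * (√μ - √(A * s)) ^ 2 := by fun_prop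
  have hint : IntervalIntegrable (fun s : ℝ => 2 * s * (√μ - √(A * s)) ^ 2) volume 0 (μ / A) :=
    hcont.intervalIntegrable _ _
  rw [← ofReal_integral_eq_lintegral_ofReal hint.1
    ((ae_restrict_mem measurableSet_Ioc).mono fun s hs => by
      have : (0 : ℝ) < s := hs.1
      simp only [Pi.zero_apply]
      positivity), ← intervalIntegral.integral_of_le hle]
  have hd : ∀ s ∈ Set.Ioo 0 (μ / A), HasDerivAt
      (fun s => μ * s ^ 2 - 8 / 5 * (√μ * √A) * (s ^ 2 * √s) + 2 / 3 * A * s ^ 3)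
      (2 * s * (√μ - √(A * s)) ^ 2) s := by
    intro s hs
    have hs0 : 0 < s := hs.1
    have h1 := (hasDerivAt_pow 2 s).const_mul μ
    have h2 := ((hasDerivAt_pow 2 s).fun_mul (Real.hasDerivAt_sqrt hs0.ne')).const_mul
      (8 / 5 * (√μ * √A))
    have h3 := (hasDerivAt_pow 3 s).const_mul (2 / 3 * A)
    refine ((h1.fun_sub h2).fun_add h3).congr_deriv ?_
    rw [Real.sqrt_mul hA.le]
    have e1 : √s ^ 2 = s := Real.sq_sqrt hs0.le
    have e2 : √A ^ 2 = A := Real.sq_sqrt hA.le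
    have e3 : √μ ^ 2 = μ := Real.sq_sqrt hμ
    have e4 : √s ≠ 0 := (Real.sqrt_pos.2 hs0).ne'
    have e5 : s ^ 2 * (1 / (2 * √s)) = s * √s / 2 := by
      field_simp
      rw [e1]
    rw [e5]
    simp only [Nat.cast_ofNat, Nat.add_one_sub_one, pow_one]
    linear_combination -(2 * s) * e3 - (2 * s * √A ^ 2) * e1 - (2 * s ^ 2) * e2
  rw [intervalIntegral.integral_eq_sub_of_hasDerivAt_of_le hle (by fun_prop) hd hint]
  congr 1
  rw [Real.sqrt_div hμ]
  have e2 : √A ^ 2 = A := Real.sq_sqrt hA.le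
  have e3 : √μ ^ 2 = μ := Real.sq_sqrt hμ
  have e4 : √A ≠ 0 := (Real.sqrt_pos.2 hA).ne'
  have e5 : √μ * √A * ((μ / A) ^ 2 * (√μ / √A)) = μ ^ 3 / A ^ 2 := by
    field_simp
    rw [e3]
    ring
  rw [mul_assoc (8 / 5), e5]
  field_simp
  ring

/-! ### The bound `K ≤ K₂` -/

section Tiling

variable {L : ℝ} {a : ℝ → ℝ} {M N : ℕ}

/-- The multiplier `|ω|³ / (|ω|³ + |s|³)`, where `ω` runs over the eigenvalues of `-D`. -/
def highMult (L : ℝ) (a : ℝ → ℝ) (s : ℝ) (n : ℤ) : ℝ :=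
  |freq L a n| ^ 3 / (|freq L a n| ^ 3 + |s| ^ 3)

theorem highMult_nonneg (s : ℝ) (n : ℤ) : 0 ≤ highMult L a s n := by
  rw [highMult]
  positivity

theorem highMult_le_one (s : ℝ) (n : ℤ) : highMult L a s n ≤ 1 := by
  rw [highMult]
  exact div_le_one_of_le₀ (by linarith [show 0 ≤ |s| ^ 3 by positivity]) (by positivity)

theorem norm_highMult_le_one (s : ℝ) (i : ℤ × Fin M) : ‖(highMult L a s i.1 : ℂ)‖ ≤ 1 := by
  rw [Complex.norm_real, Real.norm_eq_abs, abs_of_nonneg (highMult_nonneg s _)]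
  exact highMult_le_one s _

/-- The vector `|D|³ (|D|³ + |s|³)⁻¹ u`, in which frequencies below `s` are suppressed. -/
def highPass (hL : 0 < L) (ha : IntegrableOn a (Set.Ioc 0 L)) (s : ℝ) (u : L2Space L M) :
    L2Space L M :=
  diagOp (modeBasis hL ha) (fun i => (highMult L a s i.1 : ℂ)) 1 (norm_highMult_le_one s)
    zero_le_one u

theorem repr_highPass (hL : 0 < L) (ha : IntegrableOn a (Set.Ioc 0 L)) (s : ℝ) (u : L2Space L M)
    (i : ℤ × Fin M) :
    (modeBasis hL ha).repr (highPass hL ha s u) i =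
      (highMult L a s i.1 : ℂ) * (modeBasis hL ha).repr u i :=
  repr_diagOp _ _ _ _ _ _ _

attribute [irreducible] highPass

theorem norm_repr_highPass_le (hL : 0 < L) (ha : IntegrableOn a (Set.Ioc 0 L)) (s : ℝ)
    (u : L2Space L M) (i : ℤ × Fin M) :
    ‖(modeBasis hL ha).repr (highPass hL ha s u) i‖ ≤ ‖(modeBasis hL ha).repr u i‖ := by
  rw [repr_highPass, norm_mul]
  exact mul_le_of_le_one_left (norm_nonneg _) (norm_highMult_le_one s i)

theorem summable_norm_repr_highPass (hL : 0 < L) (ha : IntegrableOn a (Set.Ioc 0 L)) (s : ℝ)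
    {u : L2Space L M} (hu : Summable fun i => ‖(modeBasis hL ha).repr u i‖) :
    Summable fun i => ‖(modeBasis hL ha).repr (highPass hL ha s u) i‖ :=
  Summable.of_nonneg_of_le (fun _ => norm_nonneg _) (norm_repr_highPass_le hL ha s u) hu

theorem continuous_repFun_highPass (hL : 0 < L) (ha : IntegrableOn a (Set.Ioc 0 L))
    (hflux : ∀ j : ℤ, flux L a ≠ j)
    {u : L2Space L M} (hu : Summable fun i => ‖(modeBasis hL ha).repr u i‖) :
    Continuous fun q : ℝ × ℝ => repFun hL ha (highPass hL ha q.1 u) q.2 := by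
  simp only [repFun]
  refine continuous_tsum (u := fun i => ‖(modeBasis hL ha).repr u i‖ * (√L)⁻¹) (fun i => ?_)
    (hu.mul_right _) fun i q => ?_
  · simp_rw [repr_highPass]
    have h1 : Continuous fun q : ℝ × ℝ => highMult L a q.1 i.1 := by
      refine Continuous.div (by fun_prop) (by fun_prop) fun q => ?_
      have := abs_pos.2 (freq_ne_zero hL hflux i.1)
      positivity
    have h2 : Continuous fun q : ℝ × ℝ => mode L a i.1 q.2 :=
      (continuous_mode ha i.1).comp continuous_snd
    fun_prop
  · rw [norm_smul, norm_mul, norm_mode, PiLp.norm_single, norm_one, mul_one]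
    exact mul_le_mul_of_nonneg_right (norm_repr_highPass_le hL ha q.1 u i) (by positivity)

theorem continuous_repFun_highPass_left (hL : 0 < L) (ha : IntegrableOn a (Set.Ioc 0 L))
    (hflux : ∀ j : ℤ, flux L a ≠ j)
    {u : L2Space L M} (hu : Summable fun i => ‖(modeBasis hL ha).repr u i‖) (x : ℝ) :
    Continuous fun s : ℝ => repFun hL ha (highPass hL ha s u) x :=
  (continuous_repFun_highPass hL ha hflux hu).comp (continuous_id.prodMk continuous_const)

theorem repFun_sub (hL : 0 < L) (ha : IntegrableOn a (Set.Ioc 0 L)) {u v : L2Space L M}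
    (hu : Summable fun i => ‖(modeBasis hL ha).repr u i‖)
    (hv : Summable fun i => ‖(modeBasis hL ha).repr v i‖) (x : ℝ) :
    repFun hL ha (u - v) x = repFun hL ha u x - repFun hL ha v x := by
  rw [repFun, repFun, repFun]
  refine Eq.trans (tsum_congr fun i => ?_) ((summable_repFun hL ha hu x).hasSum.sub
    (summable_repFun hL ha hv x).hasSum).tsum_eq
  rw [map_sub, lp.coeFn_sub, Pi.sub_apply, sub_mul, sub_smul]

/-- Minkowski's inequality for the Euclidean norm on `ℂ^N`. -/
theorem sqrt_sum_norm_add_sq_le (p q : Fin N → ℂ) :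
    √(∑ n, ‖p n + q n‖ ^ 2) ≤ √(∑ n, ‖p n‖ ^ 2) + √(∑ n, ‖q n‖ ^ 2) := by
  have h := norm_add_le (WithLp.toLp 2 p : EuclideanSpace ℂ (Fin N)) (WithLp.toLp 2 q)
  simpa [EuclideanSpace.norm_eq] using h

/-- Bessel's inequality for the low-frequency part of an orthonormal system, at a point. -/
theorem sum_inner_lowPass_le (hL : 0 < L) (ha : IntegrableOn a (Set.Ioc 0 L))
    (hflux : ∀ j : ℤ, flux L a ≠ j) {ψ : Fin N → L2Space L M} (hψ : Orthonormal ℂ ψ)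
    {s : ℝ} (hs : 0 < s) (x : ℝ) (e : EuclideanSpace ℂ (Fin M)) :
    ∑ n, ‖inner ℂ e (repFun hL ha (ψ n - highPass hL ha s (ψ n)) x)‖ ^ 2 ≤
      supK₂ (flux L a) / (2 * Real.pi) * s * ‖e‖ ^ 2 := by
  obtain ⟨hm, hle⟩ := tsum_cube_freq_le hL hflux hs
  have hrep : ∀ n i, (modeBasis hL ha).repr (ψ n - highPass hL ha s (ψ n)) i =
      ((s ^ 3 / (|freq L a i.1| ^ 3 + s ^ 3) : ℝ) : ℂ) * (modeBasis hL ha).repr (ψ n) i := by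
    intro n i
    rw [map_sub, lp.coeFn_sub, Pi.sub_apply, repr_highPass, ← one_sub_mul, highMult,
      abs_of_pos hs]
    have h0 : |freq L a i.1| ^ 3 + s ^ 3 ≠ 0 := by positivity
    have h1 : (1 : ℝ) - |freq L a i.1| ^ 3 / (|freq L a i.1| ^ 3 + s ^ 3) =
        s ^ 3 / (|freq L a i.1| ^ 3 + s ^ 3) := by
      field_simp
      ring
    rw [← h1, Complex.ofReal_sub, Complex.ofReal_one]
  calc _ = ∑ n, ‖inner ℂ (ψ n) (evalVec hL ha hm x e)‖ ^ 2 :=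
        Finset.sum_congr rfl fun n _ => by
          rw [inner_repFun hL ha hm (hrep n), norm_inner_symm]
    _ ≤ ‖evalVec hL ha hm x e‖ ^ 2 := hψ.sum_inner_products_le _
    _ ≤ _ := by
        rw [norm_evalVec_sq]
        exact mul_le_mul_of_nonneg_right hle (by positivity)

set_option maxHeartbeats 1000000 in
/-- The layer-cake lower bound: in every direction `e`, all but at most `√(A s)` of
`√μ`, where `μ = ⟨U(x) e, e⟩`, comes from frequencies above `s`; integrating the square of the
difference against `2 s ds` gives `μ³ / (15 A²)`. -/
theorem cube_le_lintegral_highPass (hL : 0 < L) (ha : IntegrableOn a (Set.Ioc 0 L))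
    (hflux : ∀ j : ℤ, flux L a ≠ j) {ψ : Fin N → L2Space L M} (hψ : Orthonormal ℂ ψ)
    (hsum : ∀ n, Summable fun i => ‖(modeBasis hL ha).repr (ψ n) i‖) (x : ℝ)
    {e : EuclideanSpace ℂ (Fin M)} (he : ‖e‖ = 1) {A : ℝ}
    (hA : A = supK₂ (flux L a) / (2 * Real.pi)) :
    ENNReal.ofReal ((∑ n, ‖inner ℂ e (repFun hL ha (ψ n) x)‖ ^ 2) ^ 3 / (15 * A ^ 2)) ≤
      ∫⁻ s in Set.Ioi (0 : ℝ),
        ENNReal.ofReal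
          (2 * s * ∑ n, ‖inner ℂ e (repFun hL ha (highPass hL ha s (ψ n)) x)‖ ^ 2) := by
  set μ := ∑ n, ‖inner ℂ e (repFun hL ha (ψ n) x)‖ ^ 2 with hμ
  have hA0 : 0 < A := by
    have := supK₂_pos hflux
    rw [hA]
    positivity
  have hμ0 : 0 ≤ μ := by positivity
  rw [← lintegral_sqrt_sub_sqrt hμ0 hA0]
  refine (setLIntegral_mono' measurableSet_Ioc fun s hs => ?_).trans
    (lintegral_mono_set Set.Ioc_subset_Ioi_self)
  have hs0 : 0 < s := hs.1
  refine ENNReal.ofReal_le_ofReal (mul_le_mul_of_nonneg_left ?_ (by positivity))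
  have h1 := sqrt_sum_norm_add_sq_le
    (fun n => inner ℂ e (repFun hL ha (highPass hL ha s (ψ n)) x))
    (fun n => inner ℂ e (repFun hL ha (ψ n - highPass hL ha s (ψ n)) x))
  simp_rw [← inner_add_right, repFun_sub hL ha (hsum _)
    (summable_norm_repr_highPass hL ha s (hsum _)), add_sub_cancel] at h1
  simp_rw [← repFun_sub hL ha (hsum _) (summable_norm_repr_highPass hL ha s (hsum _))] at h1
  have h2 := sum_inner_lowPass_le hL ha hflux hψ hs0 x e
  rw [he, one_pow, mul_one, ← hA] at h2
  have h3 := Real.sqrt_le_sqrt h2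
  have h4 : √(A * s) ≤ √μ := by
    refine Real.sqrt_le_sqrt ?_
    have := (le_div_iff₀ hA0).1 hs.2
    linarith
  calc (√μ - √(A * s)) ^ 2 ≤
      √(∑ n, ‖inner ℂ e (repFun hL ha (highPass hL ha s (ψ n)) x)‖ ^ 2) ^ 2 := by
        refine pow_le_pow_left₀ (sub_nonneg.2 h4) ?_ 2
        linarith
    _ = _ := Real.sq_sqrt (by positivity)

theorem sum_lintegral_inner_sq (e : OrthonormalBasis (Fin M) ℂ (EuclideanSpace ℂ (Fin M)))
    {P : Fin N → ℝ → EuclideanSpace ℂ (Fin M)} (hP : ∀ n, Continuous (P n)) :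
    ∑ i, ∫⁻ s in Set.Ioi (0 : ℝ), ENNReal.ofReal (2 * s * ∑ n, ‖inner ℂ (e i) (P n s)‖ ^ 2) =
      ∑ n, ∫⁻ s in Set.Ioi (0 : ℝ), ENNReal.ofReal (2 * s * ‖P n s‖ ^ 2) := by
  rw [← lintegral_finsetSum _ fun i _ => by
      have : Continuous fun s => 2 * s * ∑ n, ‖inner ℂ (e i) (P n s)‖ ^ 2 := by fun_prop
      exact this.measurable.ennreal_ofReal,
    ← lintegral_finsetSum _ fun n _ => by
      have : Continuous fun s => 2 * s * ‖P n s‖ ^ 2 := by fun_prop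
      exact this.measurable.ennreal_ofReal]
  refine setLIntegral_congr_fun measurableSet_Ioi fun s hs => ?_
  have hs0 : (0 : ℝ) < s := hs
  rw [← ENNReal.ofReal_sum_of_nonneg fun i _ => by positivity,
    ← ENNReal.ofReal_sum_of_nonneg fun i _ => by positivity, ← Finset.mul_sum, ← Finset.mul_sum,
    Finset.sum_comm]
  simp_rw [e.sum_sq_norm_inner_right]

theorem trace_cube_le_lintegral (φ : Fin N → EuclideanSpace ℂ (Fin M))
    {P : Fin N → ℝ → EuclideanSpace ℂ (Fin M)} (hP : ∀ n, Continuous (P n)) {B : ℝ} (hB : 0 ≤ B)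
    (hle : ∀ e : EuclideanSpace ℂ (Fin M), ‖e‖ = 1 →
      ENNReal.ofReal ((∑ n, ‖inner ℂ e (φ n)‖ ^ 2) ^ 3 / B) ≤
        ∫⁻ s in Set.Ioi (0 : ℝ), ENNReal.ofReal (2 * s * ∑ n, ‖inner ℂ e (P n s)‖ ^ 2)) :
    ENNReal.ofReal ((densityMatrix φ ^ 3).trace.re / B) ≤
      ∑ n, ∫⁻ s in Set.Ioi (0 : ℝ), ENNReal.ofReal (2 * s * ‖P n s‖ ^ 2) := by
  have hU := posSemidef_densityMatrix φ
  have h0 : ∀ i, hU.1.eigenvalues i = ∑ n, ‖inner ℂ (hU.1.eigenvectorBasis i) (φ n)‖ ^ 2 :=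
    fun i => by
      rw [eigenvalues_densityMatrix φ i]
      exact Finset.sum_congr rfl fun n _ => by rw [norm_inner_symm]
  rw [trace_pow_three hU.1, Finset.sum_div, ENNReal.ofReal_sum_of_nonneg fun i _ =>
    div_nonneg (pow_nonneg (hU.eigenvalues_nonneg i) 3) hB,
    ← sum_lintegral_inner_sq hU.1.eigenvectorBasis hP]
  refine Finset.sum_le_sum fun i _ => ?_
  rw [h0]
  exact hle _ (hU.1.eigenvectorBasis.norm_eq_one i)

theorem lintegral_norm_sq (u : L2Space L M) :
    ∫⁻ x in Set.Ioc 0 L, ENNReal.ofReal (‖u x‖ ^ 2) = ENNReal.ofReal (‖u‖ ^ 2) := by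
  have h1 : ∀ x, ‖u x‖ ^ 2 = RCLike.re (inner ℂ (u x) (u x)) := fun x =>
    norm_sq_eq_re_inner (𝕜 := ℂ) (u x)
  have hi := L2.integrable_inner (𝕜 := ℂ) u u
  simp_rw [h1]
  rw [← ofReal_integral_eq_lintegral_ofReal hi.re
    (Filter.Eventually.of_forall fun x => by
      change 0 ≤ RCLike.re (inner ℂ (u x) (u x))
      rw [← h1]
      positivity), norm_sq_eq_re_inner (𝕜 := ℂ) u, L2.inner_def]
  exact congrArg _ (integral_re hi)

theorem lintegral_tsum_highMult (hL : 0 < L) (hflux : ∀ j : ℤ, flux L a ≠ j) {ι : Type*}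
    [Countable ι] (f : ι → ℤ) {c : ι → ℝ} {X : ℝ} {Y : ℝ → ℝ}
    (hY : ∀ s, HasSum (fun i => (highMult L a s (f i)) ^ 2 * c i ^ 2) (Y s))
    (hX : HasSum (fun i => freq L a (f i) ^ 2 * c i ^ 2) X) :
    ∫⁻ s in Set.Ioi (0 : ℝ), ENNReal.ofReal (2 * s * Y s) =
      ENNReal.ofReal (4 * Real.pi / (9 * √3) * X) := by
  have h1 : ∀ s ∈ Set.Ioi (0 : ℝ), ENNReal.ofReal (2 * s * Y s) =
      ∑' i, ENNReal.ofReal (2 * s * (highMult L a s (f i)) ^ 2) * ENNReal.ofReal (c i ^ 2) := by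
    intro s hs0
    have : (0 : ℝ) < s := hs0
    have h2 := (hY s).mul_left (2 * s)
    rw [← h2.tsum_eq, ENNReal.ofReal_tsum_of_nonneg (fun i => by positivity) h2.summable]
    exact tsum_congr fun i => by rw [← mul_assoc, ENNReal.ofReal_mul (by positivity)]
  have hmeas : ∀ n : ℤ, Measurable fun s => ENNReal.ofReal (2 * s * (highMult L a s n) ^ 2) := by
    intro n
    refine Measurable.ennreal_ofReal ?_
    simp only [highMult]
    fun_prop
  have hkin := hX.mul_left (4 * Real.pi / (9 * √3))
  rw [setLIntegral_congr_fun measurableSet_Ioi h1,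
    lintegral_tsum fun i => ((hmeas (f i)).mul_const _).aemeasurable, ← hkin.tsum_eq,
    ENNReal.ofReal_tsum_of_nonneg (fun i => by positivity) hkin.summable]
  refine tsum_congr fun i => ?_
  rw [lintegral_mul_const _ (hmeas (f i))]
  simp only [highMult]
  rw [lintegral_cube_multiplier (abs_pos.2 (freq_ne_zero hL hflux (f i))), sq_abs,
    ← ENNReal.ofReal_mul (by positivity), mul_assoc]

/-- Integrating over all cutoffs recovers the kinetic energy. -/
theorem lintegral_norm_highPass_sq (hL : 0 < L) (ha : IntegrableOn a (Set.Ioc 0 L))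
    (hflux : ∀ j : ℤ, flux L a ≠ j) {u g : L2Space L M} (h : (u, g) ∈ magDeriv L a M) :
    ∫⁻ s in Set.Ioi (0 : ℝ), ENNReal.ofReal (2 * s * ‖highPass hL ha s u‖ ^ 2) =
      ENNReal.ofReal (4 * Real.pi / (9 * √3) * ‖g‖ ^ 2) := by
  refine lintegral_tsum_highMult (ι := ℤ × Fin M) hL hflux Prod.fst (fun s => ?_)
    (norm_sq_eq_tsum_of_mem_magDeriv hL ha h)
  refine (hasSum_norm_repr_sq (modeBasis hL ha) _).congr_fun fun i => ?_
  rw [repr_highPass, norm_mul, mul_pow, Complex.norm_real, Real.norm_eq_abs, sq_abs]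

theorem lintegral_repFun_highPass (hL : 0 < L) (ha : IntegrableOn a (Set.Ioc 0 L))
    (hflux : ∀ j : ℤ, flux L a ≠ j) {u g : L2Space L M} (h : (u, g) ∈ magDeriv L a M) :
    ∫⁻ x in Set.Ioc 0 L, ∫⁻ s in Set.Ioi (0 : ℝ),
        ENNReal.ofReal (2 * s * ‖repFun hL ha (highPass hL ha s u) x‖ ^ 2) =
      ENNReal.ofReal (4 * Real.pi / (9 * √3) * ‖g‖ ^ 2) := by
  have hsum := summable_norm_repr_of_mem_magDeriv hL ha hflux h
  have hc := continuous_repFun_highPass hL ha hflux hsum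
  have hc2 : Continuous fun q : ℝ × ℝ =>
      2 * q.2 * ‖repFun hL ha (highPass hL ha q.2 u) q.1‖ ^ 2 := by
    have := hc.comp continuous_swap
    simp only [Function.comp_def, Prod.fst_swap, Prod.snd_swap] at this
    fun_prop
  rw [lintegral_lintegral_swap hc2.measurable.ennreal_ofReal.aemeasurable,
    ← lintegral_norm_highPass_sq hL ha hflux h]
  refine setLIntegral_congr_fun measurableSet_Ioi fun s hs => ?_
  have hs0 : (0 : ℝ) < s := hs
  simp_rw [ENNReal.ofReal_mul (show 0 ≤ 2 * s by positivity)]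
  rw [lintegral_const_mul' _ _ ENNReal.ofReal_ne_top, ← lintegral_norm_sq]
  congr 1
  refine lintegral_congr_ae ?_
  filter_upwards [repFun_ae_eq hL ha (summable_norm_repr_highPass hL ha s hsum)] with x hx
  rw [hx]

theorem isLiebThirringConst_K₂ {α : ℝ} (hα : ∀ j : ℤ, α ≠ j) : IsLiebThirringConst α (K₂ α) := by
  refine ⟨by rw [K₂]; positivity, ?_⟩
  rintro L a hL ha rfl M N ψ Dψ hψ hD
  set A := supK₂ (flux L a) / (2 * Real.pi) with hA
  have hA0 : 0 < A := by
    have := supK₂_pos hα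
    positivity
  have hsum := fun n => summable_norm_repr_of_mem_magDeriv hL ha hα (hD n)
  set f := fun x => ((densityMatrix fun n => ψ n x) ^ 3).trace.re with hf
  have hmain : ∫⁻ x in Set.Ioc 0 L, ENNReal.ofReal (f x / (15 * A ^ 2)) ≤
      ENNReal.ofReal (4 * Real.pi / (9 * √3) * ∑ n, ‖Dψ n‖ ^ 2) := by
    calc
      _ ≤ ∫⁻ x in Set.Ioc 0 L, ∑ n, ∫⁻ s in Set.Ioi (0 : ℝ),
        ENNReal.ofReal (2 * s * ‖repFun hL ha (highPass hL ha s (ψ n)) x‖ ^ 2) := by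
          refine lintegral_mono_ae ?_
          filter_upwards [ae_eq_repFun hL ha hα hD] with x hx
          simp_rw [hf, hx]
          exact trace_cube_le_lintegral (fun n => repFun hL ha (ψ n) x)
            (P := fun n s => repFun hL ha (highPass hL ha s (ψ n)) x)
            (fun n => continuous_repFun_highPass_left hL ha hα (hsum n) x) (by positivity)
            fun e he => cube_le_lintegral_highPass hL ha hα hψ hsum x he hA
      _ = ∑ n, ENNReal.ofReal (4 * Real.pi / (9 * √3) * ‖Dψ n‖ ^ 2) := by
          rw [lintegral_finsetSum _ fun n _ => ?_]
          · exact Finset.sum_congr rfl fun n _ => lintegral_repFun_highPass hL ha hα (hD n)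
          · have hc := continuous_repFun_highPass hL ha hα (hsum n)
            have hc2 : Continuous fun q : ℝ × ℝ =>
                2 * q.2 * ‖repFun hL ha (highPass hL ha q.2 (ψ n)) q.1‖ ^ 2 := by
              have := hc.comp continuous_swap
              simp only [Function.comp_def, Prod.fst_swap, Prod.snd_swap] at this
              fun_prop
            exact hc2.measurable.ennreal_ofReal.lintegral_prod_right'
      _ = _ := by
          rw [← ENNReal.ofReal_sum_of_nonneg fun i _ => by positivity, Finset.mul_sum]
  have hK : K₂ (flux L a) = 15 * A ^ 2 * (4 * Real.pi / (9 * √3)) := by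
    rw [K₂_eq, hA]
    have := Real.pi_pos
    have h3 : √(3 : ℝ) ≠ 0 := by positivity
    field_simp
    ring
  by_cases hint : IntegrableOn f (Set.Ioc 0 L)
  · have h1 := ofReal_integral_eq_lintegral_ofReal (hint.div_const (15 * A ^ 2))
      (Filter.Eventually.of_forall fun x =>
        div_nonneg (trace_densityMatrix_cube_nonneg _) (by positivity))
    rw [← h1] at hmain
    have h2 := (ENNReal.ofReal_le_ofReal_iff (by positivity)).1 hmain
    rw [integral_div, div_le_iff₀ (by positivity)] at h2
    rw [hK]
    linarith
  · rw [integral_undef hint, K₂]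
    positivity

end Tiling

/-! ### The optimal constant -/

theorem K_nonneg (α : ℝ) : 0 ≤ K α := Real.sInf_nonneg fun _ h => h.1

theorem K_le_min {α : ℝ} (hα : ∀ j : ℤ, α ≠ j) : K α ≤ min (K₁ α) (K₂ α) :=
  le_min (csInf_le ⟨0, fun _ h => h.1⟩ (isLiebThirringConst_K₁ hα))
    (csInf_le ⟨0, fun _ h => h.1⟩ (isLiebThirringConst_K₂ hα))

theorem isLiebThirringConst_K {α : ℝ} (hα : ∀ j : ℤ, α ≠ j) : IsLiebThirringConst α (K α) := by
  refine ⟨K_nonneg α, ?_⟩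
  intro L a hL ha hflux M N ψ Dψ hψ hD
  have hne : {C | IsLiebThirringConst α C}.Nonempty := ⟨_, isLiebThirringConst_K₁ hα⟩
  refine le_of_forall_pos_le_add fun ε hε => ?_
  set X := ∑ n, ‖Dψ n‖ ^ 2 with hX
  have hX0 : 0 ≤ X := by positivity
  obtain ⟨C, hC, hlt⟩ := exists_lt_of_csInf_lt hne
    (lt_add_of_pos_right (K α) (show 0 < ε / (X + 1) by positivity))
  calc _ ≤ C * X := hC.2 L a hL ha hflux M N ψ Dψ hψ hD
    _ ≤ (K α + ε / (X + 1)) * X := by gcongr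
    _ = K α * X + ε * (X / (X + 1)) := by ring
    _ ≤ _ := by
        gcongr
        exact mul_le_of_le_one_right hε.le ((div_le_one (by positivity)).2 (by linarith))

/-! ### Operators with compact symmetric resolvent -/

section CompactResolvent

variable {H : Type*} [NormedAddCommGroup H] [InnerProductSpace ℂ H] {T : Submodule ℂ (H × H)}
  {z₀ : ℂ} {R : H →L[ℂ] H}

theorem mem_graph_iff (hR : ∀ f u : H, (u, f + z₀ • u) ∈ T ↔ u = R f) (z : ℂ) (f u : H) :
    (u, f + z • u) ∈ T ↔ u = R f + (z - z₀) • R u := by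
  rw [← map_smul, ← map_add, ← hR, add_assoc, ← add_smul, sub_add_cancel]

theorem mem_eigenspace_iff (hR : ∀ f u : H, (u, f + z₀ • u) ∈ T ↔ u = R f) (z : ℂ) (u : H) :
    u ∈ eigenspace T z ↔ u = (z - z₀) • R u := by
  have h := mem_graph_iff hR z 0 u
  rw [zero_add, map_zero, zero_add] at h
  exact h

theorem eigenspace_eq (hR : ∀ f u : H, (u, f + z₀ • u) ∈ T ↔ u = R f) {z : ℂ} (hz : z - z₀ ≠ 0) :
    eigenspace T z = Module.End.eigenspace (R : H →ₗ[ℂ] H) (z - z₀)⁻¹ := by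
  ext u
  rw [mem_eigenspace_iff hR, Module.End.mem_eigenspace_iff, ContinuousLinearMap.coe_coe]
  refine ⟨fun h => ?_, fun h => ?_⟩
  · nth_rewrite 2 [h]
    rw [smul_smul, inv_mul_cancel₀ hz, one_smul]
  · rw [h, smul_smul, mul_inv_cancel₀ hz, one_smul]

theorem eigenspace_base (hR : ∀ f u : H, (u, f + z₀ • u) ∈ T ↔ u = R f) : eigenspace T z₀ = ⊥ := by
  rw [eq_bot_iff]
  intro u hu
  rw [mem_eigenspace_iff hR, sub_self, zero_smul] at hu
  exact hu

/-- Only finitely many eigenvalues of a compact symmetric operator have modulus at least `δ > 0`: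
the images of infinitely many orthonormal eigenvectors would have mutual distances at least `δ`. -/
theorem finite_eigenvalues_norm_ge (hs : (R : H →ₗ[ℂ] H).IsSymmetric) (hc : IsCompactOperator R)
    {δ : ℝ} (hδ : 0 < δ) :
    {μ : ℂ | δ ≤ ‖μ‖ ∧ Module.End.HasEigenvalue (R : H →ₗ[ℂ] H) μ}.Finite := by
  by_contra hinf
  have hinf' : Set.Infinite {μ : ℂ | δ ≤ ‖μ‖ ∧ Module.End.HasEigenvalue (R : H →ₗ[ℂ] H) μ} := hinf
  set μ := hinf'.natEmbedding with hμ
  have hev : ∀ n, ∃ e : H, ‖e‖ = 1 ∧ R e = (μ n : ℂ) • e := by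
    intro n
    obtain ⟨v, hv⟩ := (μ n).2.2.exists_hasEigenvector
    have hv0 : ‖v‖ ≠ 0 := norm_ne_zero_iff.2 hv.2
    refine ⟨((‖v‖⁻¹ : ℝ) : ℂ) • v, ?_, ?_⟩
    · rw [norm_smul, Complex.norm_real, norm_inv, norm_norm, inv_mul_cancel₀ hv0]
    · rw [map_smul, smul_comm]
      exact congrArg _ hv.apply_eq_smul
  choose e he1 he2 using hev
  have horth : ∀ n m, n ≠ m → inner ℂ (R (e n)) (R (e m)) = 0 := by
    intro n m hnm
    have hne : (μ n : ℂ) ≠ μ m := fun h => hnm (μ.injective (Subtype.ext h))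
    have h : inner ℂ (e n) (e m) = 0 := hs.orthogonalFamily_eigenspaces hne
      ⟨e n, Module.End.mem_eigenspace_iff.2 (he2 n)⟩ ⟨e m, Module.End.mem_eigenspace_iff.2 (he2 m)⟩
    rw [he2, he2, inner_smul_left, inner_smul_right, h]
    simp
  obtain ⟨K, hK, hKsub⟩ := IsCompactOperator.image_closedBall_subset_compact (𝕜₁ := ℂ) hc 1
  obtain ⟨v, -, φ, hφ, hlim⟩ := hK.tendsto_subseq (x := fun n => R (e n)) fun n =>
    hKsub ⟨e n, by simp [he1], rfl⟩
  obtain ⟨n₀, hn₀⟩ := Metric.cauchySeq_iff.1 hlim.cauchySeq δ hδ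
  have h1 := hn₀ (n₀ + 1) (by omega) n₀ le_rfl
  have h2 := horth (φ (n₀ + 1)) (φ n₀) (hφ (Nat.lt_succ_self n₀)).ne'
  have h3 := norm_sub_sq (𝕜 := ℂ) (R (e (φ (n₀ + 1)))) (R (e (φ n₀)))
  rw [h2] at h3
  simp only [Function.comp_apply, dist_eq_norm] at h1
  have h4 : δ ≤ ‖R (e (φ n₀))‖ := by
    rw [he2, norm_smul, he1, mul_one]
    exact (μ (φ n₀)).2.1
  simp only [map_zero, mul_zero, sub_zero] at h3
  nlinarith [sq_nonneg ‖R (e (φ (n₀ + 1)))‖, norm_nonneg (R (e (φ (n₀ + 1))) - R (e (φ n₀)))]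

variable [CompleteSpace H]

/-- By the Fredholm alternative, every point of the spectrum is an eigenvalue. -/
theorem eigenspace_ne_bot_of_mem_spectrum (hR : ∀ f u : H, (u, f + z₀ • u) ∈ T ↔ u = R f)
    (hc : IsCompactOperator R) {z : ℂ} (hz : z ∈ spectrum T) :
    z - z₀ ≠ 0 ∧ Module.End.HasEigenvalue (R : H →ₗ[ℂ] H) (z - z₀)⁻¹ := by
  have hne : z - z₀ ≠ 0 := by
    intro h
    refine hz ⟨R, fun f u => ?_⟩
    rw [sub_eq_zero.1 h]
    exact hR f u
  refine ⟨hne, (hc.hasEigenvalue_iff_mem_spectrum (inv_ne_zero hne)).2 fun hres => hz ?_⟩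
  rw [spectrum.mem_resolventSet_iff] at hres
  obtain ⟨B, hB⟩ := hres
  have hBr : ∀ x, (B : H →L[ℂ] H) x = (z - z₀)⁻¹ • x - R x := fun x => by
    rw [hB]
    simp [Algebra.algebraMap_eq_smul_one]
  have h1 : ∀ x, ((B⁻¹ : (H →L[ℂ] H)ˣ) : H →L[ℂ] H) ((B : H →L[ℂ] H) x) = x := fun x => by
    rw [← mul_apply_eq_comp, Units.inv_mul]
    rfl
  have h2 : ∀ x, (B : H →L[ℂ] H) (((B⁻¹ : (H →L[ℂ] H)ˣ) : H →L[ℂ] H) x) = x := fun x => by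
    rw [← mul_apply_eq_comp, Units.mul_inv]
    rfl
  refine ⟨(z - z₀)⁻¹ • (((B⁻¹ : (H →L[ℂ] H)ˣ) : H →L[ℂ] H) * R), fun f u => ?_⟩
  have h3 : (u = R f + (z - z₀) • R u) ↔ (B : H →L[ℂ] H) u = (z - z₀)⁻¹ • R f := by
    rw [hBr, sub_eq_iff_eq_add]
    refine ⟨fun h => ?_, fun h => ?_⟩
    · nth_rewrite 1 [h]
      rw [smul_add, smul_smul, inv_mul_cancel₀ hne, one_smul]
    · have := congrArg (fun v => (z - z₀) • v) h
      simpa [smul_add, smul_smul, mul_inv_cancel₀ hne] using this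
  rw [mem_graph_iff hR, h3]
  refine ⟨fun h => ?_, fun h => ?_⟩
  · rw [← h1 u, h]
    simp
  · rw [h]
    simp [h2]

theorem hasDiscreteSpectrum_of_compact_resolvent (hR : ∀ f u : H, (u, f + z₀ • u) ∈ T ↔ u = R f)
    (hc : IsCompactOperator R) (hs : (R : H →ₗ[ℂ] H).IsSymmetric) : HasDiscreteSpectrum T := by
  intro z hz
  obtain ⟨hne, hev⟩ := eigenspace_ne_bot_of_mem_spectrum hR hc hz
  rw [eigenspace_eq hR hne]
  refine ⟨?_, hev, ContinuousLinearMap.finite_dimensional_eigenspace hc _ (inv_ne_zero hne)⟩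
  have hfin : {w | w ∈ spectrum T ∧ dist w z < 1}.Finite := by
    have h1 : (0 : ℝ) < (‖z - z₀‖ + 1)⁻¹ := by positivity
    refine ((finite_eigenvalues_norm_ge hs hc h1).image fun μ => μ⁻¹ + z₀).subset ?_
    rintro w ⟨hw, hwz⟩
    obtain ⟨hwne, hwev⟩ := eigenspace_ne_bot_of_mem_spectrum hR hc hw
    refine ⟨(w - z₀)⁻¹, ⟨?_, hwev⟩, by simp⟩
    rw [norm_inv]
    refine inv_anti₀ (norm_pos_iff.2 hwne) ?_
    rw [dist_eq_norm] at hwz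
    calc ‖w - z₀‖ = ‖(z - z₀) + (w - z)‖ := by congr 1; ring
      _ ≤ ‖z - z₀‖ + ‖w - z‖ := norm_add_le _ _
      _ ≤ _ := by linarith
  have hopen := (hfin.subset (Set.sdiff_subset (t := {z}))).isClosed.isOpen_compl
  obtain ⟨r, hr, hball⟩ := Metric.isOpen_iff.1 hopen z (by simp)
  refine ⟨min r 1, by positivity, fun w hw hwz => ?_⟩
  by_contra! hlt
  exact hball (Metric.mem_ball.2 (hlt.trans_le (min_le_left _ _)))
    ⟨⟨hw, hlt.trans_le (min_le_right _ _)⟩, hwz⟩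

end CompactResolvent

/-! ### Form perturbations of an operator with compact inverse -/

section FormPerturbation

variable {H : Type*} [NormedAddCommGroup H] [InnerProductSpace ℂ H] [CompleteSpace H]

/-- Let `D` be the inverse of the compact symmetric operator `G` and let the symmetric operator `W`
represent a quadratic form `v` by `⟨h, W g⟩ = v(G h, G g)`. If `1 - W + Λ G²` is coercive, then
`D² - v` has the compact symmetric resolvent `G (1 - W + Λ G²)⁻¹ G` at `-Λ`. -/
theorem exists_compact_resolvent {G W : H →L[ℂ] H} (hGc : IsCompactOperator G)
    (hGs : ∀ u v, inner ℂ (G u) v = inner ℂ u (G v))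
    (hWs : ∀ u v, inner ℂ (W u) v = inner ℂ u (W v)) {Λ : ℝ}
    (hpos : ∀ g, 1 / 2 * ‖g‖ ^ 2 ≤ ‖g‖ ^ 2 - (inner ℂ g (W g)).re + Λ * ‖G g‖ ^ 2)
    {T : Submodule ℂ (H × H)} (hT : ∀ u f, (u, f) ∈ T ↔ ∃ g, u = G g ∧ g - W g = G f) :
    ∃ R : H →L[ℂ] H, IsCompactOperator R ∧ (R : H →ₗ[ℂ] H).IsSymmetric ∧
      ∀ f u : H, (u, f + (-Λ : ℂ) • u) ∈ T ↔ u = R f := by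
  set S : H →L[ℂ] H := 1 - W + (Λ : ℂ) • (G * G) with hS
  have hSa : ∀ g, S g = g - W g + (Λ : ℂ) • G (G g) := fun g => rfl
  have hSs : ∀ u v, inner ℂ (S u) v = inner ℂ u (S v) := fun u v => by
    rw [hSa, hSa, inner_add_left, inner_sub_left, inner_smul_left, inner_add_right,
      inner_sub_right, inner_smul_right, hWs, hGs, hGs, Complex.conj_ofReal]
  have hSi : ∀ g, (inner ℂ (S g) g).re =
      ‖g‖ ^ 2 - (inner ℂ g (W g)).re + Λ * ‖G g‖ ^ 2 := fun g => by
    rw [hSs, hSa, inner_add_right, inner_sub_right, inner_smul_right, ← hGs,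
      inner_self_eq_norm_sq_to_K, inner_self_eq_norm_sq_to_K]
    simp only [Complex.coe_algebraMap]
    rw [← Complex.ofReal_pow, ← Complex.ofReal_pow, ← Complex.ofReal_mul]
    simp only [Complex.add_re, Complex.sub_re, Complex.ofReal_re]
  have hu : IsUnit S := by
    refine ContinuousLinearMap.isUnit_of_forall_le_norm_inner_map S (c := 1 / 2) (by norm_num)
      fun g => ?_
    refine le_trans ?_ (Complex.re_le_norm _)
    rw [hSi, mul_comm]
    exact_mod_cast hpos g
  obtain ⟨B, hB⟩ := hu
  set J : H →L[ℂ] H := ((B⁻¹ : (H →L[ℂ] H)ˣ) : H →L[ℂ] H) with hJ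
  have h1 : ∀ x, J (S x) = x := fun x => by
    rw [hJ, ← hB, ← mul_apply_eq_comp, Units.inv_mul]
    rfl
  have h2 : ∀ x, S (J x) = x := fun x => by
    rw [hJ, ← hB, ← mul_apply_eq_comp, Units.mul_inv]
    rfl
  have hJs : ∀ u v, inner ℂ (J u) v = inner ℂ u (J v) := fun u v => by
    nth_rewrite 1 [← h2 v]
    rw [← hSs, h2]
  refine ⟨G * (J * G), hGc.comp_clm (J * G), fun u v => ?_, fun f u => ?_⟩
  · change inner ℂ (G (J (G u))) v = inner ℂ u (G (J (G v)))
    rw [hGs, hJs, hGs]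
  · rw [hT]
    change _ ↔ u = G (J (G f))
    refine ⟨?_, ?_⟩
    · rintro ⟨g, rfl, hg⟩
      have : S g = G f := by
        rw [hSa, hg, map_add, map_smul, neg_smul, neg_add_cancel_right]
      rw [← this, h1]
    · intro h
      refine ⟨J (G f), h, ?_⟩
      have := h2 (G f)
      rw [hSa, ← h] at this
      rw [map_add, map_smul, neg_smul, ← sub_eq_add_neg]
      exact eq_sub_of_add_eq this

end FormPerturbation

/-! ### The magnetic Schrödinger operator has compact resolvent -/

section Schrodinger

variable {L : ℝ} {a : ℝ → ℝ} {M : ℕ}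

theorem tendsto_inv_freq (hL : 0 < L) :
    Filter.Tendsto (fun i : ℤ × Fin M => -(freq L a i.1)⁻¹) Filter.cofinite (nhds 0) := by
  have h1 : Filter.Tendsto (fun n : ℤ => |(n : ℝ)|) Filter.cofinite Filter.atTop :=
    tendsto_norm_cocompact_atTop.comp Int.tendsto_coe_cofinite
  have hc : 0 < 2 * Real.pi / L := by positivity
  have h2 : Filter.Tendsto (fun n : ℤ => |freq L a n|) Filter.cofinite Filter.atTop := by
    refine Filter.tendsto_atTop_mono (fun n => ?_)
      ((Filter.tendsto_atTop_add_const_right _ (-|flux L a|) h1).const_mul_atTop hc)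
    rw [freq, abs_mul, abs_of_pos hc]
    have := abs_sub_abs_le_abs_add (n : ℝ) (flux L a)
    gcongr
    linarith
  have h3 : Filter.Tendsto (fun n : ℤ => -(freq L a n)⁻¹) Filter.cofinite (nhds 0) := by
    rw [tendsto_zero_iff_abs_tendsto_zero]
    refine (tendsto_inv_atTop_zero.comp h2).congr fun n => ?_
    simp [abs_inv]
  refine h3.comp (Filter.Tendsto.cofinite_of_finite_preimage_singleton fun n => ?_)
  refine ((Set.finite_singleton n).prod (Set.toFinite (Set.univ : Set (Fin M)))).subset ?_
  rintro ⟨m, j⟩ h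
  exact ⟨h, trivial⟩

/-- For a flux outside `ℤ` the operator `i d/dx - a` has a compact self-adjoint inverse. -/
theorem exists_magDeriv_inverse (M : ℕ) (hL : 0 < L) (ha : IntegrableOn a (Set.Ioc 0 L))
    (hflux : ∀ j : ℤ, flux L a ≠ j) :
    ∃ G : L2Space L M →L[ℂ] L2Space L M, IsCompactOperator G ∧
      (∀ u v, inner ℂ (G u) v = inner ℂ u (G v)) ∧ ∀ u g, (u, g) ∈ magDeriv L a M ↔ u = G g := by
  have ht := tendsto_inv_freq (a := a) (M := M) hL
  have ht' : Filter.Tendsto (fun i : ℤ × Fin M => ((-(freq L a i.1)⁻¹ : ℝ) : ℂ)) Filter.cofinite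
      (nhds 0) := by
    have := (Complex.continuous_ofReal.tendsto 0).comp ht
    rwa [Complex.ofReal_zero] at this
  obtain ⟨C, hC⟩ := ht'.norm.bddAbove_range_of_cofinite
  have hm : ∀ i : ℤ × Fin M, ‖((-(freq L a i.1)⁻¹ : ℝ) : ℂ)‖ ≤ max C 0 :=
    fun i => (hC ⟨i, rfl⟩).trans (le_max_left _ _)
  refine ⟨diagOp (modeBasis hL ha) _ (max C 0) hm (le_max_right _ _),
    isCompactOperator_diagOp _ _ _ hm _ ht',
    inner_diagOp_left _ _ _ hm _ fun i => Complex.conj_ofReal _, fun u g => ?_⟩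
  rw [mem_magDeriv_iff hL ha hflux]
  have hf : ∀ i : ℤ × Fin M, (freq L a i.1 : ℂ) ≠ 0 := fun i => by
    exact_mod_cast freq_ne_zero hL hflux i.1
  refine ⟨fun h => ext_repr (modeBasis hL ha) fun i => ?_, fun h i => ?_⟩
  · rw [repr_diagOp, h i]
    push_cast
    rw [neg_mul, neg_mul, mul_neg, neg_neg, inv_mul_cancel_left₀ (hf i)]
  · rw [h, repr_diagOp]
    push_cast
    rw [neg_mul, neg_mul, mul_neg, neg_neg, mul_inv_cancel_left₀ (hf i)]

theorem potentialDensity_eq_sum (V : ℝ → Matrix (Fin M) (Fin M) ℂ)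
    (v u : ℝ → EuclideanSpace ℂ (Fin M)) (x : ℝ) :
    potentialDensity V v u x =
      ∑ i, ∑ j, (starRingEnd ℂ) (v x i) * (V x i j * u x j) := by
  rw [potentialDensity, PiLp.inner_apply]
  refine Finset.sum_congr rfl fun i _ => ?_
  rw [Matrix.toLpLin_apply]
  simp only [RCLike.inner_apply, Matrix.mulVec, dotProduct, Finset.sum_mul]
  refine Finset.sum_congr rfl fun j _ => ?_
  ring

theorem aestronglyMeasurable_potentialDensity {V : ℝ → Matrix (Fin M) (Fin M) ℂ}
    (hVmeas : ∀ i j, AEMeasurable (fun x => V x i j) (volume.restrict (Set.Ioc 0 L)))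
    (v u : L2Space L M) :
    AEStronglyMeasurable (potentialDensity V v u) (volume.restrict (Set.Ioc 0 L)) := by
  have hc : ∀ (w : L2Space L M) (i : Fin M),
      AEStronglyMeasurable (fun x => w x i) (volume.restrict (Set.Ioc 0 L)) := fun w i =>
    (EuclideanSpace.proj (𝕜 := ℂ) i).continuous.comp_aestronglyMeasurable
      (Lp.aestronglyMeasurable w)
  have he : potentialDensity V v u = fun x =>
      ∑ i, ∑ j, (starRingEnd ℂ) (v x i) * (V x i j * u x j) :=
    funext fun x => potentialDensity_eq_sum V v u x
  rw [he]
  refine Finset.aestronglyMeasurable_fun_sum _ fun i _ =>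
    Finset.aestronglyMeasurable_fun_sum _ fun j _ => ?_
  exact (Complex.continuous_conj.comp_aestronglyMeasurable (hc v i)).mul
    ((hVmeas i j).aestronglyMeasurable.mul (hc u j))

variable {V : ℝ → Matrix (Fin M) (Fin M) ℂ}

theorem integrable_trace
    (hVmeas : ∀ i j, AEMeasurable (fun x => V x i j) (volume.restrict (Set.Ioc 0 L)))
    (hVpos : ∀ᵐ x ∂(volume.restrict (Set.Ioc 0 L)), (V x).PosSemidef)
    (hVint : IntegrableOn (fun x => traceThreeHalves (V x)) (Set.Ioc 0 L)) :
    IntegrableOn (fun x => (V x).trace.re) (Set.Ioc 0 L) := by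
  have hmeas : AEStronglyMeasurable (fun x => (V x).trace.re) (volume.restrict (Set.Ioc 0 L)) := by
    simp only [Matrix.trace, Matrix.diag]
    exact Complex.continuous_re.comp_aestronglyMeasurable
      (Finset.aestronglyMeasurable_fun_sum _ fun i _ => (hVmeas i i).aestronglyMeasurable)
  refine Integrable.mono' ((integrable_const (M : ℝ)).add hVint) hmeas ?_
  filter_upwards [hVpos] with x hx
  rw [Real.norm_eq_abs, abs_of_nonneg (trace_re_nonneg hx)]
  exact trace_re_le hx

theorem integrableOn_potentialDensity
    (hVmeas : ∀ i j, AEMeasurable (fun x => V x i j) (volume.restrict (Set.Ioc 0 L)))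
    (hVpos : ∀ᵐ x ∂(volume.restrict (Set.Ioc 0 L)), (V x).PosSemidef)
    (htr : IntegrableOn (fun x => (V x).trace.re) (Set.Ioc 0 L)) {v u : L2Space L M} {A B : ℝ}
    (hv : ∀ᵐ x ∂volume.restrict (Set.Ioc 0 L), ‖v x‖ ≤ A)
    (hu : ∀ᵐ x ∂volume.restrict (Set.Ioc 0 L), ‖u x‖ ≤ B) :
    IntegrableOn (potentialDensity V v u) (Set.Ioc 0 L) ∧
      ‖∫ x in Set.Ioc 0 L, potentialDensity V v u x‖ ≤
        (∫ x in Set.Ioc 0 L, (V x).trace.re) * (A * B) := by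
  have hle : ∀ᵐ x ∂volume.restrict (Set.Ioc 0 L),
      ‖potentialDensity V v u x‖ ≤ (V x).trace.re * (A * B) := by
    filter_upwards [hVpos, hv, hu] with x hx h1 h2
    refine (norm_inner_toEuclideanLin_le hx _ _).trans ?_
    have := trace_re_nonneg hx
    have := (norm_nonneg _).trans h1
    gcongr
  refine ⟨Integrable.mono' (htr.mul_const _) (aestronglyMeasurable_potentialDensity hVmeas v u) hle,
    ?_⟩
  rw [← integral_mul_const]
  exact norm_integral_le_of_norm_le (htr.mul_const _) hle

theorem conj_potentialDensity (hVpos : ∀ᵐ x ∂(volume.restrict (Set.Ioc 0 L)), (V x).PosSemidef)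
    (v u : ℝ → EuclideanSpace ℂ (Fin M)) :
    (starRingEnd ℂ) (∫ x in Set.Ioc 0 L, potentialDensity V v u x) =
      ∫ x in Set.Ioc 0 L, potentialDensity V u v x := by
  rw [← integral_conj]
  refine integral_congr_ae ?_
  filter_upwards [hVpos] with x hx
  rw [potentialDensity, potentialDensity, inner_conj_symm, inner_toEuclideanLin_comm hx.1]

/-- A potential whose form is bounded with respect to the kinetic energy is represented by a bounded
operator `W`, once the form is pulled back by `G`. -/
theorem exists_potential_operator
    (hVmeas : ∀ i j, AEMeasurable (fun x => V x i j) (volume.restrict (Set.Ioc 0 L)))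
    (hVpos : ∀ᵐ x ∂(volume.restrict (Set.Ioc 0 L)), (V x).PosSemidef)
    (htr : IntegrableOn (fun x => (V x).trace.re) (Set.Ioc 0 L))
    (G : L2Space L M →L[ℂ] L2Space L M) {C : ℝ}
    (hG : ∀ g, ∀ᵐ x ∂volume.restrict (Set.Ioc 0 L), ‖G g x‖ ≤ C * ‖g‖) :
    ∃ W : L2Space L M →L[ℂ] L2Space L M, ∀ h g,
      inner ℂ (W h) g = ∫ x in Set.Ioc 0 L, potentialDensity V (G h) (G g) x := by
  have hi := fun h g => integrableOn_potentialDensity hVmeas hVpos htr (hG h) (hG g)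
  let B : L2Space L M →ₗ⋆[ℂ] L2Space L M →ₗ[ℂ] ℂ :=
    LinearMap.mk₂'ₛₗ (starRingEnd ℂ) (RingHom.id ℂ)
      (fun h g => ∫ x in Set.Ioc 0 L, potentialDensity V (G h) (G g) x)
      (fun h h' g => by
        rw [← integral_add (hi h g).1 (hi h' g).1, map_add]
        refine integral_congr_ae ?_
        filter_upwards [Lp.coeFn_add (G h) (G h')] with x hx
        simp only [potentialDensity]
        rw [hx, Pi.add_apply, inner_add_left])
      (fun c h g => by
        rw [smul_eq_mul, ← integral_const_mul, map_smul]
        refine integral_congr_ae ?_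
        filter_upwards [Lp.coeFn_smul c (G h)] with x hx
        simp only [potentialDensity]
        rw [hx, Pi.smul_apply, inner_smul_left])
      (fun h g g' => by
        rw [← integral_add (hi h g).1 (hi h g').1, map_add]
        refine integral_congr_ae ?_
        filter_upwards [Lp.coeFn_add (G g) (G g')] with x hx
        simp only [potentialDensity]
        rw [hx, Pi.add_apply, map_add, inner_add_right])
      (fun c h g => by
        rw [smul_eq_mul, ← integral_const_mul, map_smul]
        refine integral_congr_ae ?_
        filter_upwards [Lp.coeFn_smul c (G g)] with x hx
        simp only [potentialDensity]
        rw [hx, Pi.smul_apply, map_smul, inner_smul_right]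
        rfl)
  refine ⟨InnerProductSpace.continuousLinearMapOfBilin
    (B.mkContinuous₂ ((∫ x in Set.Ioc 0 L, (V x).trace.re) * (C * C)) fun h g => ?_),
    fun h g => ?_⟩
  · refine ((hi h g).2).trans (le_of_eq ?_)
    ring
  · rw [InnerProductSpace.continuousLinearMapOfBilin_apply]
    rfl

theorem norm_le_of_mem_magDeriv (hL : 0 < L) (ha : IntegrableOn a (Set.Ioc 0 L))
    (hflux : ∀ j : ℤ, flux L a ≠ j) {u g : L2Space L M} (h : (u, g) ∈ magDeriv L a M)
    {s : ℝ} (hs : 0 < s) :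
    ∀ᵐ x ∂volume.restrict (Set.Ioc 0 L),
      ‖u x‖ ≤ √(k (flux L a) / (2 * s) * (‖g‖ ^ 2 + s ^ 2 * ‖u‖ ^ 2)) := by
  filter_upwards [repFun_ae_eq hL ha (summable_norm_repr_of_mem_magDeriv hL ha hflux h)] with x hx
  rw [hx]
  exact Real.le_sqrt_of_sq_le (norm_repFun_sq_le hL ha hflux h hs x)

/-- The Schrödinger operator has a compact symmetric resolvent at a point of the negative
half-axis: the interpolation inequality makes `V` form-bounded with relative bound zero. -/
theorem exists_schrodinger_resolvent (hL : 0 < L) (ha : IntegrableOn a (Set.Ioc 0 L))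
    (hflux : ∀ j : ℤ, flux L a ≠ j)
    (hVmeas : ∀ i j, AEMeasurable (fun x => V x i j) (volume.restrict (Set.Ioc 0 L)))
    (hVpos : ∀ᵐ x ∂(volume.restrict (Set.Ioc 0 L)), (V x).PosSemidef)
    (hVint : IntegrableOn (fun x => traceThreeHalves (V x)) (Set.Ioc 0 L)) :
    ∃ (R : L2Space L M →L[ℂ] L2Space L M) (z₀ : ℂ), IsCompactOperator R ∧
      (R : L2Space L M →ₗ[ℂ] L2Space L M).IsSymmetric ∧
      ∀ f u, (u, f + z₀ • u) ∈ schrodinger L a M V ↔ u = R f := by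
  obtain ⟨G, hGc, hGs, hG⟩ := exists_magDeriv_inverse M hL ha hflux
  have hmem : ∀ g, (G g, g) ∈ magDeriv L a M := fun g => (hG _ _).2 rfl
  have htr := integrable_trace hVmeas hVpos hVint
  have hk := k_pos hflux
  set t := ∫ x in Set.Ioc 0 L, (V x).trace.re with ht
  have ht0 : 0 ≤ t := integral_nonneg_of_ae (hVpos.mono fun x hx => trace_re_nonneg hx)
  have hbd : ∀ g, ∀ᵐ x ∂volume.restrict (Set.Ioc 0 L),
      ‖G g x‖ ≤ √(k (flux L a) / (2 * 1) * (1 + ‖G‖ ^ 2)) * ‖g‖ := by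
    intro g
    filter_upwards [norm_le_of_mem_magDeriv hL ha hflux (hmem g) one_pos] with x hx
    refine hx.trans ?_
    rw [← Real.sqrt_sq (norm_nonneg g), ← Real.sqrt_mul (by positivity),
      Real.sqrt_sq (norm_nonneg g)]
    refine Real.sqrt_le_sqrt ?_
    have h1 : ‖G g‖ ^ 2 ≤ ‖G‖ ^ 2 * ‖g‖ ^ 2 := by
      rw [← mul_pow]
      exact pow_le_pow_left₀ (norm_nonneg _) (G.le_opNorm g) 2
    rw [mul_assoc, one_pow, one_mul]
    refine mul_le_mul_of_nonneg_left ?_ (by positivity)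
    linarith
  obtain ⟨W, hW⟩ := exists_potential_operator hVmeas hVpos htr G hbd
  have hWs : ∀ u v, inner ℂ (W u) v = inner ℂ u (W v) := fun u v => by
    rw [hW, ← inner_conj_symm u, hW, conj_potentialDensity hVpos]
  -- With this `s` the potential energy is at most half of `‖D u‖² + s² ‖u‖²`.
  set s := k (flux L a) * (t + 1) with hs
  have hs0 : 0 < s := by positivity
  have hpos : ∀ g, 1 / 2 * ‖g‖ ^ 2 ≤
      ‖g‖ ^ 2 - (inner ℂ g (W g)).re + (s ^ 2 / 2) * ‖G g‖ ^ 2 := by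
    intro g
    have h1 := norm_le_of_mem_magDeriv hL ha hflux (hmem g) hs0
    have h2 := (integrableOn_potentialDensity hVmeas hVpos htr h1 h1).2
    rw [← hW, hWs, Real.mul_self_sqrt (by positivity), ← ht] at h2
    have h3 := (Complex.re_le_norm _).trans h2
    have h4 : t * (k (flux L a) / (2 * s)) ≤ 1 / 2 := by
      rw [hs, mul_div_assoc', div_le_div_iff₀ (by positivity) two_pos]
      nlinarith
    have h5 : 0 ≤ ‖g‖ ^ 2 + s ^ 2 * ‖G g‖ ^ 2 := by positivity
    have h6 := mul_le_mul_of_nonneg_right h4 h5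
    linarith
  have hT : ∀ u f, (u, f) ∈ schrodinger L a M V ↔ ∃ g, u = G g ∧ g - W g = G f := by
    intro u f
    constructor
    · rintro ⟨g, hg, H⟩
      have hu : u = G g := (hG _ _).1 hg
      refine ⟨g, hu, ext_inner_left ℂ fun h => ?_⟩
      have h1 := (H (G h) h (hmem h)).2
      simp only at h1
      rw [hu, ← hW, hWs, hGs] at h1
      rw [inner_sub_right, h1]
    · rintro ⟨g, rfl, hg⟩
      refine ⟨g, hmem g, fun v h hv => ?_⟩
      obtain rfl := (hG _ _).1 hv
      refine ⟨(integrableOn_potentialDensity hVmeas hVpos htr (hbd h) (hbd g)).1, ?_⟩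
      simp only
      rw [← hW, hWs, hGs, ← hg, inner_sub_right]
  obtain ⟨R, h1, h2, h3⟩ := exists_compact_resolvent hGc hGs hWs hpos hT
  exact ⟨R, _, h1, h2, h3⟩

end Schrodinger

/-! ### The sum of the negative eigenvalues -/

section EigenvalueSum

variable {L : ℝ} {a : ℝ → ℝ} {M N : ℕ} {V : ℝ → Matrix (Fin M) (Fin M) ℂ}

theorem continuous_trace_densityMatrix_cube : Continuous
    fun φ : Fin N → EuclideanSpace ℂ (Fin M) => ((densityMatrix φ) ^ 3).trace.re := by
  have h : Continuous fun φ : Fin N → EuclideanSpace ℂ (Fin M) => densityMatrix φ := by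
    refine continuous_finsetSum _ fun n _ => ?_
    have h1 : Continuous fun φ : Fin N → EuclideanSpace ℂ (Fin M) => (φ n).ofLp :=
      (PiLp.continuous_ofLp 2 _).comp (continuous_apply n)
    exact h1.matrix_vecMulVec h1.star
  exact Complex.continuous_re.comp (h.pow 3).matrix_trace

theorem integrable_trace_densityMatrix_cube {ψ : Fin N → L2Space L M} {B : ℝ}
    (hB : ∀ n, ∀ᵐ x ∂volume.restrict (Set.Ioc 0 L), ‖ψ n x‖ ≤ B) :
    IntegrableOn (fun x => ((densityMatrix fun n => ψ n x) ^ 3).trace.re) (Set.Ioc 0 L) := by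
  have hc := continuous_trace_densityMatrix_cube (M := M) (N := N)
  have hm : AEStronglyMeasurable (fun x => fun n => ψ n x) (volume.restrict (Set.Ioc 0 L)) :=
    (aemeasurable_pi_lambda _ fun n => (Lp.aestronglyMeasurable (ψ n)).aemeasurable)
      |>.aestronglyMeasurable
  obtain ⟨C, hC⟩ := (isCompact_closedBall (0 : Fin N → EuclideanSpace ℂ (Fin M)) |B|)
    |>.exists_bound_of_continuousOn hc.continuousOn
  refine Integrable.of_bound (hc.comp_aestronglyMeasurable hm) C ?_
  filter_upwards [ae_all_iff.2 hB] with x hx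
  refine hC _ (mem_closedBall_zero_iff.2 ((pi_norm_le_iff_of_nonneg (abs_nonneg B)).2 fun n => ?_))
  exact (hx n).trans (le_abs_self B)

/-- The sum of the eigenvalues of an orthonormal system of eigenfunctions: by duality the
Lieb–Thirring inequality for orthonormal systems controls the potential energy. -/
theorem sum_neg_eigenvalue_le (hL : 0 < L) (ha : IntegrableOn a (Set.Ioc 0 L))
    (hflux : ∀ j : ℤ, flux L a ≠ j)
    (hVpos : ∀ᵐ x ∂(volume.restrict (Set.Ioc 0 L)), (V x).PosSemidef)
    (hVint : IntegrableOn (fun x => traceThreeHalves (V x)) (Set.Ioc 0 L))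
    {C : ℝ} (hC : IsLiebThirringConst (flux L a) C) (hC0 : 0 < C)
    {ψ : Fin N → L2Space L M} (hψ : Orthonormal ℂ ψ) {E : Fin N → ℝ}
    (hE : ∀ n, (ψ n, (E n : ℂ) • ψ n) ∈ schrodinger L a M V) :
    ∑ n, -E n ≤ 2 / (3 * √3) * √C * ∫ x in Set.Ioc 0 L, traceThreeHalves (V x) := by
  choose g hg hform using hE
  simp only at hg hform
  have hint := fun n => (hform n (ψ n) (g n) (hg n)).1
  have henergy : ∀ n, -E n =
      (∫ x in Set.Ioc 0 L, (potentialDensity V (ψ n) (ψ n) x).re) - ‖g n‖ ^ 2 := by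
    intro n
    have h1 := (hform n (ψ n) (g n) (hg n)).2
    rw [inner_smul_right, inner_self_eq_norm_sq_to_K, inner_self_eq_norm_sq_to_K, hψ.1 n] at h1
    have h2 := congrArg Complex.re h1
    have h3 := integral_re (hint n)
    simp only [RCLike.re_to_complex] at h3
    rw [h3]
    simp only [Complex.coe_algebraMap, Complex.ofReal_one, one_pow, mul_one, Complex.sub_re,
      ← Complex.ofReal_pow, Complex.ofReal_re] at h2
    linarith
  have hbd : ∀ n, ∃ B, ∀ᵐ x ∂volume.restrict (Set.Ioc 0 L), ‖ψ n x‖ ≤ B := fun n =>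
    ⟨_, norm_le_of_mem_magDeriv hL ha hflux (hg n) one_pos⟩
  choose B hB using hbd
  have hU := integrable_trace_densityMatrix_cube (ψ := ψ) (B := ∑ n, |B n|) fun n =>
    (hB n).mono fun x hx => (hx.trans (le_abs_self _)).trans
      (Finset.single_le_sum (f := fun n => |B n|) (fun _ _ => abs_nonneg _) (Finset.mem_univ n))
  have hre : ∀ n, Integrable (fun x => (potentialDensity V (ψ n) (ψ n) x).re)
      (volume.restrict (Set.Ioc 0 L)) := fun n => (hint n).re
  have hV2 := hVint.const_mul (2 / (3 * √3) * √C)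
  have hpot : ∑ n, ∫ x in Set.Ioc 0 L, (potentialDensity V (ψ n) (ψ n) x).re ≤
      (∫ x in Set.Ioc 0 L, ((densityMatrix fun n => ψ n x) ^ 3).trace.re) / C +
        2 / (3 * √3) * √C * ∫ x in Set.Ioc 0 L, traceThreeHalves (V x) := by
    rw [← integral_finsetSum _ fun n _ => hre n, ← integral_div, ← integral_const_mul,
      ← integral_add (hU.div_const C) hV2]
    refine integral_mono_ae (integrable_finsetSum _ fun n _ => hre n)
      ((hU.div_const C).add hV2) ?_
    filter_upwards [hVpos] with x hx
    exact sum_inner_toEuclideanLin_le hx (fun n => ψ n x) hC0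
  have hkin := hC.2 L a hL ha rfl M N ψ g hψ hg
  have hkin' : (∫ x in Set.Ioc 0 L, ((densityMatrix fun n => ψ n x) ^ 3).trace.re) / C ≤
      ∑ n, ‖g n‖ ^ 2 := by
    rw [div_le_iff₀ hC0, mul_comm]
    exact hkin
  simp_rw [henergy]
  rw [Finset.sum_sub_distrib]
  linarith

theorem IsLiebThirringConst.mono {α C C' : ℝ} (h : IsLiebThirringConst α C) (hle : C ≤ C') :
    IsLiebThirringConst α C' :=
  ⟨h.1.trans hle, fun L a hL ha hα M N ψ Dψ hψ hD => (h.2 L a hL ha hα M N ψ Dψ hψ hD).trans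
    (mul_le_mul_of_nonneg_right hle (by positivity))⟩

theorem sum_neg_eigenvalue_le_K (hL : 0 < L) (ha : IntegrableOn a (Set.Ioc 0 L))
    (hflux : ∀ j : ℤ, flux L a ≠ j)
    (hVpos : ∀ᵐ x ∂(volume.restrict (Set.Ioc 0 L)), (V x).PosSemidef)
    (hVint : IntegrableOn (fun x => traceThreeHalves (V x)) (Set.Ioc 0 L))
    {ψ : Fin N → L2Space L M} (hψ : Orthonormal ℂ ψ) {E : Fin N → ℝ}
    (hE : ∀ n, (ψ n, (E n : ℂ) • ψ n) ∈ schrodinger L a M V) :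
    ∑ n, -E n ≤
      2 / (3 * √3) * √(K (flux L a)) * ∫ x in Set.Ioc 0 L, traceThreeHalves (V x) := by
  set I := ∫ x in Set.Ioc 0 L, traceThreeHalves (V x) with hI
  have hcont : Continuous fun ε : ℝ => 2 / (3 * √3) * √(K (flux L a) + ε) * I := by fun_prop
  have hlim := (hcont.tendsto 0).mono_left (nhdsWithin_le_nhds (s := Set.Ioi 0))
  rw [add_zero] at hlim
  refine ge_of_tendsto hlim ?_
  filter_upwards [self_mem_nhdsWithin] with ε hε
  have hε0 : (0 : ℝ) < ε := hε
  have := K_nonneg (flux L a)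
  exact sum_neg_eigenvalue_le hL ha hflux hVpos hVint
    ((isLiebThirringConst_K hflux).mono (by linarith)) (by linarith) hψ hE

/-- Eigenspaces of an operator with symmetric resolvent are mutually orthogonal. -/
theorem orthogonalFamily_eigenspace {H : Type*} [NormedAddCommGroup H] [InnerProductSpace ℂ H]
    {T : Submodule ℂ (H × H)} {z₀ : ℂ} {R : H →L[ℂ] H}
    (hR : ∀ f u : H, (u, f + z₀ • u) ∈ T ↔ u = R f) (hs : (R : H →ₗ[ℂ] H).IsSymmetric) :
    OrthogonalFamily ℂ (fun z => eigenspace T z) fun z => (eigenspace T z).subtypeₗᵢ := by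
  rintro z w hzw ⟨u, hu⟩ ⟨v, hv⟩
  change inner ℂ u v = 0
  by_cases hz : z - z₀ = 0
  · rw [sub_eq_zero.1 hz, eigenspace_base hR, Submodule.mem_bot] at hu
    rw [hu, inner_zero_left]
  by_cases hw : w - z₀ = 0
  · rw [sub_eq_zero.1 hw, eigenspace_base hR, Submodule.mem_bot] at hv
    rw [hv, inner_zero_right]
  rw [eigenspace_eq hR hz] at hu
  rw [eigenspace_eq hR hw] at hv
  have hne : (z - z₀)⁻¹ ≠ (w - z₀)⁻¹ := fun h => hzw (sub_left_injective (inv_injective h))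
  exact hs.orthogonalFamily_eigenspaces hne ⟨u, hu⟩ ⟨v, hv⟩

theorem sum_multiplicity_mul_neg_le {H : Type*} [NormedAddCommGroup H] [InnerProductSpace ℂ H]
    [CompleteSpace H] {T : Submodule ℂ (H × H)} {z₀ : ℂ} {R : H →L[ℂ] H}
    (hR : ∀ f u : H, (u, f + z₀ • u) ∈ T ↔ u = R f) (hs : (R : H →ₗ[ℂ] H).IsSymmetric)
    (hc : IsCompactOperator R) {B : ℝ}
    (hB : ∀ (N : ℕ) (ψ : Fin N → H) (E : Fin N → ℝ), Orthonormal ℂ ψ →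
      (∀ n, (ψ n, (E n : ℂ) • ψ n) ∈ T) → ∑ n, -E n ≤ B) (s : Finset (negEigenvalues T)) :
    ∑ E ∈ s, (multiplicity T ((E : ℝ) : ℂ) : ℝ) * -(E : ℝ) ≤ B := by
  have hfd : ∀ E : s, FiniteDimensional ℂ (eigenspace T ((E : ℝ) : ℂ)) := by
    intro E
    have hne : ((E : ℝ) : ℂ) - z₀ ≠ 0 := fun h => E.1.2.2 (by
      rw [sub_eq_zero.1 h, eigenspace_base hR])
    rw [eigenspace_eq hR hne]
    exact ContinuousLinearMap.finite_dimensional_eigenspace hc _ (inv_ne_zero hne)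
  have hinj : Function.Injective fun E : s => ((E : ℝ) : ℂ) := fun E E' h =>
    Subtype.ext (Subtype.ext (Complex.ofReal_injective h))
  have horth := ((orthogonalFamily_eigenspace hR hs).comp hinj).orthonormal_sigma_orthonormal
    (v_family := fun E => stdOrthonormalBasis ℂ (eigenspace T ((E : ℝ) : ℂ)))
    fun E => (stdOrthonormalBasis ℂ (eigenspace T ((E : ℝ) : ℂ))).orthonormal
  let e := (Fintype.equivFin
    (Σ E : s, Fin (Module.finrank ℂ (eigenspace T ((E : ℝ) : ℂ))))).symm
  have h := hB _ _ (fun n => ((e n).1 : ℝ)) (horth.comp e e.injective) fun n =>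
    (stdOrthonormalBasis ℂ (eigenspace T (((e n).1 : ℝ) : ℂ)) (e n).2).2
  rw [e.sum_comp fun p => -(p.1 : ℝ), Fintype.sum_sigma] at h
  simp only [Finset.sum_const, Finset.card_univ, Fintype.card_fin, nsmul_eq_mul] at h
  rw [← Finset.sum_coe_sort]
  exact h

end EigenvalueSum

/-! ### The semiclassical constant -/

theorem integral_rpow_mul_one_sub_rpow {p q : ℝ} (hp : 0 < p) (hq : 0 < q) :
    ∫ x in (0 : ℝ)..1, x ^ (p - 1) * (1 - x) ^ (q - 1) =
      Real.Gamma p * Real.Gamma q / Real.Gamma (p + q) := by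
  have h := ProbabilityTheory.beta_eq_betaIntegralReal p q hp hq
  have h2 : Complex.betaIntegral p q =
      ((∫ x in (0 : ℝ)..1, x ^ (p - 1) * (1 - x) ^ (q - 1) : ℝ) : ℂ) := by
    rw [Complex.betaIntegral, ← intervalIntegral.integral_ofReal]
    refine intervalIntegral.integral_congr fun x hx => ?_
    rw [Set.uIcc_of_le zero_le_one] at hx
    rw [Complex.ofReal_mul, Complex.ofReal_cpow hx.1, Complex.ofReal_cpow (sub_nonneg.2 hx.2)]
    push_cast
    rfl
  rw [h2, Complex.ofReal_re] at h
  exact h.symm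

theorem integral_radial_profile {γ : ℝ} (hγ : 0 < γ) {d : ℕ} (hd : 1 ≤ d) :
    ∫ y in Set.Ioi (0 : ℝ), y ^ (d - 1) * (max (1 - y ^ 2) 0) ^ γ =
      1 / 2 * (Real.Gamma ((d : ℝ) / 2) * Real.Gamma (γ + 1) /
        Real.Gamma ((d : ℝ) / 2 + (γ + 1))) := by
  have hd0 : (0 : ℝ) < d := by exact_mod_cast hd
  -- The substitution `t = y²`.
  have h1 := integral_comp_rpow_Ioi_of_pos (p := 2)
    (g := fun t : ℝ => 1 / 2 * (t ^ ((d : ℝ) / 2 - 1) * (max (1 - t) 0) ^ γ)) two_pos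
  have h2 : ∫ y in Set.Ioi (0 : ℝ), y ^ (d - 1) * (max (1 - y ^ 2) 0) ^ γ =
      ∫ y in Set.Ioi (0 : ℝ), ((2 : ℝ) * y ^ ((2 : ℝ) - 1)) •
        (1 / 2 * ((y ^ (2 : ℝ)) ^ ((d : ℝ) / 2 - 1) * (max (1 - y ^ (2 : ℝ)) 0) ^ γ)) := by
    refine setIntegral_congr_fun measurableSet_Ioi fun y hy => ?_
    have hy0 : (0 : ℝ) < y := hy
    have e1 : y ^ (d - 1) = y ^ ((2 : ℝ) - 1) * (y ^ (2 : ℝ)) ^ ((d : ℝ) / 2 - 1) := by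
      rw [← Real.rpow_mul hy0.le, ← Real.rpow_add hy0, ← Real.rpow_natCast, Nat.cast_sub hd]
      congr 1
      push_cast
      ring
    simp only [smul_eq_mul]
    rw [e1, Real.rpow_two]
    ring
  have h3 : ∫ t in Set.Ioi (0 : ℝ), t ^ ((d : ℝ) / 2 - 1) * (max (1 - t) 0) ^ γ =
      ∫ t in (0 : ℝ)..1, t ^ ((d : ℝ) / 2 - 1) * (1 - t) ^ (γ + 1 - 1) := by
    rw [intervalIntegral.integral_of_le (zero_le_one (α := ℝ)),
      setIntegral_eq_of_subset_of_forall_sdiff_eq_zero measurableSet_Ioi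
        (Set.Ioc_subset_Ioi_self : Set.Ioc (0 : ℝ) 1 ⊆ Set.Ioi 0)]
    · refine setIntegral_congr_fun measurableSet_Ioc fun t ht => ?_
      rw [max_eq_left (sub_nonneg.2 ht.2), add_sub_cancel_right]
    · rintro t ⟨ht, ht1⟩
      have : 1 < t := by
        by_contra! h
        exact ht1 ⟨ht, h⟩
      rw [max_eq_right (by linarith), Real.zero_rpow hγ.ne', mul_zero]
  rw [h2, h1, integral_const_mul, h3,
    integral_rpow_mul_one_sub_rpow (by positivity) (by positivity)]

theorem Lcl_eq {γ : ℝ} {d : ℕ} (hγ : 0 < γ) (hd : 1 ≤ d) :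
    Lcl γ d = Real.Gamma (γ + 1) /
      (2 ^ d * Real.pi ^ ((d : ℝ) / 2) * Real.Gamma (γ + (d : ℝ) / 2 + 1)) := by
  have hd0 : (0 : ℝ) < d := by exact_mod_cast hd
  have : Nonempty (Fin d) := ⟨⟨0, hd⟩⟩
  have hπ := Real.pi_pos
  have h1 := integral_fun_norm_addHaar (volume : Measure (EuclideanSpace ℝ (Fin d)))
    fun y : ℝ => (max (1 - y ^ 2) 0) ^ γ
  have hv : (volume : Measure (EuclideanSpace ℝ (Fin d))).real (Metric.ball 0 1) =
      √Real.pi ^ d / Real.Gamma ((d : ℝ) / 2 + 1) := by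
    rw [Measure.real, EuclideanSpace.volume_ball]
    simp only [ENNReal.ofReal_one, one_pow, one_mul, Fintype.card_fin]
    refine ENNReal.toReal_ofReal (div_nonneg (by positivity) (Real.Gamma_nonneg_of_nonneg ?_))
    positivity
  rw [Lcl, h1, hv, finrank_euclideanSpace, Fintype.card_fin]
  simp only [smul_eq_mul, nsmul_eq_mul]
  rw [integral_radial_profile hγ hd, Real.Gamma_add_one (s := (d : ℝ) / 2) (by positivity)]
  have hG : Real.Gamma ((d : ℝ) / 2) ≠ 0 := (Real.Gamma_pos_of_pos (by positivity)).ne'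
  have hG2 : Real.Gamma ((d : ℝ) / 2 + (γ + 1)) ≠ 0 := (Real.Gamma_pos_of_pos (by positivity)).ne'
  have e1 : γ + (d : ℝ) / 2 + 1 = (d : ℝ) / 2 + (γ + 1) := by ring
  have e2 : √Real.pi ^ d = Real.pi ^ ((d : ℝ) / 2) := by
    rw [Real.sqrt_eq_rpow, ← Real.rpow_natCast, ← Real.rpow_mul hπ.le]
    congr 1
    ring
  have e3 : (2 * Real.pi) ^ d = 2 ^ d * (Real.pi ^ ((d : ℝ) / 2) * Real.pi ^ ((d : ℝ) / 2)) := by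
    rw [mul_pow, ← Real.rpow_add hπ, add_halves, Real.rpow_natCast]
  have hpd : Real.pi ^ ((d : ℝ) / 2) ≠ 0 := (Real.rpow_pos_of_pos hπ _).ne'
  rw [e1, e2, e3]
  field_simp

theorem Lcl_one_one : Lcl 1 1 = 2 / (3 * Real.pi) := by
  have hπ := Real.pi_pos
  rw [Lcl_eq one_pos le_rfl]
  have e1 : (1 : ℝ) + ((1 : ℕ) : ℝ) / 2 + 1 = 1 / 2 + 1 + 1 := by norm_num
  have e2 : Real.pi ^ (((1 : ℕ) : ℝ) / 2) = √Real.pi := by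
    rw [Real.sqrt_eq_rpow]
    norm_num
  rw [e1, e2, Real.Gamma_add_one (s := 1 / 2 + 1) (by norm_num),
    Real.Gamma_add_one (s := 1 / 2) (by norm_num), Real.Gamma_one_half_eq, one_add_one_eq_two,
    Real.Gamma_two]
  have e3 : √Real.pi * √Real.pi = Real.pi := Real.mul_self_sqrt hπ.le
  rw [show (2 : ℝ) ^ 1 * √Real.pi * ((1 / 2 + 1) * (1 / 2 * √Real.pi)) =
    3 / 2 * (√Real.pi * √Real.pi) by ring, e3]
  field_simp

end MagneticLT

end

theorem theorem3p2 (L : ℝ) (hL : 0 < L) (a : ℝ → ℝ)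
    (ha : MeasureTheory.IntegrableOn a (Set.Ioc 0 L))
    (hflux : ∀ j : ℤ, MagneticLT.flux L a ≠ j)
    (M : ℕ) (V : ℝ → Matrix (Fin M) (Fin M) ℂ)
    (hVmeas : ∀ i j, AEMeasurable (fun x => V x i j)
      (MeasureTheory.volume.restrict (Set.Ioc 0 L)))
    (hVpos : ∀ᵐ x ∂(MeasureTheory.volume.restrict (Set.Ioc 0 L)), (V x).PosSemidef)
    (hVint : MeasureTheory.IntegrableOn
      (fun x => MagneticLT.traceThreeHalves (V x)) (Set.Ioc 0 L)) :
    -- the spectrum is discrete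
    MagneticLT.HasDiscreteSpectrum (MagneticLT.schrodinger L a M V) ∧
    -- the sum of the `λₙ`, eigenvalues `-λₙ < 0` being repeated according to multiplicity
    Summable (fun E : MagneticLT.negEigenvalues (MagneticLT.schrodinger L a M V) =>
      (MagneticLT.multiplicity (MagneticLT.schrodinger L a M V) ((E : ℝ) : ℂ) : ℝ) * -(E : ℝ)) ∧
    ∑' E : MagneticLT.negEigenvalues (MagneticLT.schrodinger L a M V),
        (MagneticLT.multiplicity (MagneticLT.schrodinger L a M V) ((E : ℝ) : ℂ) : ℝ) * -(E : ℝ) ≤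
      2 / (3 * √3) * √(MagneticLT.K (MagneticLT.flux L a)) *
        ∫ x in Set.Ioc 0 L, MagneticLT.traceThreeHalves (V x) ∧
    2 / (3 * √3) * √(MagneticLT.K (MagneticLT.flux L a)) *
        ∫ x in Set.Ioc 0 L, MagneticLT.traceThreeHalves (V x) =
      Real.pi / √3 * √(MagneticLT.K (MagneticLT.flux L a)) * MagneticLT.Lcl 1 1 *
        ∫ x in Set.Ioc 0 L, MagneticLT.traceThreeHalves (V x) ∧
    -- `K(α)` is an admissible constant, and it is at most `min (K₁(α)) (K₂(α))`
    MagneticLT.IsLiebThirringConst (MagneticLT.flux L a)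
      (MagneticLT.K (MagneticLT.flux L a)) ∧
    MagneticLT.K (MagneticLT.flux L a) ≤
      min (MagneticLT.K₁ (MagneticLT.flux L a)) (MagneticLT.K₂ (MagneticLT.flux L a)) ∧
    -- the closed form of the semiclassical constant
    ∀ (γ : ℝ) (d : ℕ), 0 < γ → 1 ≤ d →
      MagneticLT.Lcl γ d =
        Real.Gamma (γ + 1) /
          (2 ^ d * Real.pi ^ ((d : ℝ) / 2) * Real.Gamma (γ + (d : ℝ) / 2 + 1)) := by
  obtain ⟨R, z₀, hc, hs, hR⟩ :=
    MagneticLT.exists_schrodinger_resolvent hL ha hflux hVmeas hVpos hVint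
  have hsum := MagneticLT.sum_multiplicity_mul_neg_le hR hs hc fun N ψ E hψ hE =>
    MagneticLT.sum_neg_eigenvalue_le_K hL ha hflux hVpos hVint hψ hE
  have hnn : ∀ E : MagneticLT.negEigenvalues (MagneticLT.schrodinger L a M V),
      0 ≤ (MagneticLT.multiplicity (MagneticLT.schrodinger L a M V) ((E : ℝ) : ℂ) : ℝ) *
        -(E : ℝ) := fun E => mul_nonneg (Nat.cast_nonneg _) (neg_nonneg.2 E.2.1.le)
  have hsummable := summable_of_sum_le hnn hsum
  refine ⟨MagneticLT.hasDiscreteSpectrum_of_compact_resolvent hR hc hs, hsummable,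
    hsummable.tsum_le_of_sum_le hsum, ?_, MagneticLT.isLiebThirringConst_K hflux,
    MagneticLT.K_le_min hflux, fun γ d hγ hd => MagneticLT.Lcl_eq hγ hd⟩
  rw [MagneticLT.Lcl_one_one]
  have := Real.pi_pos
  have h3 : √(3 : ℝ) ≠ 0 := by positivity
  field_simp
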